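/- **Definitions.** For a graph $G$ on $n$ sites and angles $\vec\theta\in\mathbb R^n$, the *instantaneously-deep QNN* (IDQNN) defines a conditional distribution $p(y\mid x;\vec\theta)$ on $x,y\in\{0,1\}^n$: prepare qubit $i$ in $|+\rangle$ if $x_i=0$ and in $|0\rangle$ if $x_i=1$, apply $R_Z(\theta_i)=e^{-i\theta_iZ/2}$ to each qubit $i$ and $CZ$ on every edge of $G$, and measure all qubits in the Pauli-$X$ basis to obtain $y$. TVD denotes total variation distance. A *layered circuit* $D$ on $m$ qubits has $R\ge 1$ rounds, each consisting of Hadamard gates on all qubits, $R_Z$ gates with arbitrary angles on all qubits, and $CZ$ gates on some nearest-neighbour pairs of the line; for $y'\in\{0,1\}^{(R-1)m}$, $D(y')$ is $D$ with an additional $Z$ gate on qubit $i$ at the end of round $j$ whenever $y'_{j,i}=1$ ($1\le j\le R-1$). For $\eta:\mathbb N\to\mathbb R$ let $\mathrm{Conj}(\eta)$ be the statement: there are polynomial-size quantum circuits $C_n$ on $n$ qubits and layered circuits $D_n$ on $n$ qubits with polynomially many rounds, with $D_n=D_n(0)$ within $2^{-n}$ of $C_n$ in diamond distance for $n\ge1$,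 such that no family of polynomial-size classical (Boolean) circuits, fed with uniformly random bits, outputs for every $n\ge 1$ a pair $(y',z)$ whose distribution is within TVD $\eta(n)$ of that of a uniformly random $y'$ together with the outcome $z$ of measuring $D_n(y')|0^n\rangle$ in the standard basis. (For $\eta=0$ this is hardness of exact sampling.) **Theorem.** 1. *(Decoupling.)* For every graph $G$ and $\vec\theta\in\mathbb R^n$, if $x_i=0$ and $x_j=1$ for all neighbours $j$ of $i$, then $\Pr[y_i=1\mid x]=\frac{1-\cos\theta_i}{2}$. 2. *(Learning the parameters.)* For every $\Delta$ there is $K$ such that the following holds for all $n,a,b\ge1$, all graphs $G$ on $n$ sites of maximum degree at most $\Delta$, all $\vec\theta\in[0,\pi]^n$ and all $N\ge(n+a+b)^K$. Given $N$ independent samples $(x,y)$ with $x$ uniform and $y\sim p(\cdot\mid x;\vec\theta)$, let $\hat\theta_i=\arccos(1-2\bar y_i)$, where $\bar y_i$ is the mean of $y_i$ over the samples whose $x$ is $0$ at $i$ and $1$ at all neighbours of $i$. Then with probability at least $1-1/b$, $|\hat\theta_i-\theta_i|\le1/a$ for all $i$. 3. *(Quantum easiness.)* For every $\Delta$ there are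 a (uniform, deterministic classical) learning program, an inference program and $K$ such that, for all $n,a,b\ge1$, all $N$ and all $G$ of maximum degree at most $\Delta$: given $G,a,b$ and a data set of $N$ pairs, the learning program outputs a model in time at most $(n+a+b+N)^K$; given the model and any $x\in\{0,1\}^n$, the inference program outputs, in time at most $(n+a+b+N)^K$, the description of a quantum circuit on $n$ qubits with gates $H$, $CZ$, $R_Z(\pi u/v)$ ($u,v\in\mathbb N$); and if $N\ge(n+a+b)^K$ and the data are $N$ independent samples as in 2 for some $\vec\theta\in[0,\pi]^n$, then with probability at least $1-1/b$ over the data, for all $x$, running the circuit on $|0^n\rangle$ and measuring in the standard basis yields a distribution within TVD $1/a$ of $p(\cdot\mid x;\vec\theta)$. 4. *(Classical hardness.)* For every $\eta:\mathbb N\to\mathbb R$, if $\mathrm{Conj}(\eta)$ holds, then there are polynomially bounded $s_n\ge1$, graphs $G_n$ equal to the $s_n\times n$ square lattice with some edges within the rows (fixed first coordinate) removed, so of degree at most $4$, and angles $\vec\theta^{(n)}\in[0,\pi]^{s_nn}$ such that (a) no family of polynomial-size classical circuits with uniformly random bits samples, for all $n\ge1$, from a distribution within TVD $\eta(n)$ of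 $p(\cdot\mid 0^{s_nn};\vec\theta^{(n)})$ of the IDQNN on $G_n$; and (b) the IDQNNs on $(G_n)$ cannot be learned classically: for no $\delta<1$, no choice of training-input distributions and no polynomially bounded number of samples is there a family of polynomial-size classical circuits, taking the data set, a new input $x$ and uniformly random bits, such that for all $n\ge1$ and all $\vec\theta\in[0,\pi]^{s_nn}$, with probability at least $1-\delta$ over the data, the output is for all $x$ within TVD $\eta(n)$ of $p(\cdot\mid x;\vec\theta)$. -/

import Mathlib

open scoped Matrix

noncomputable section

/-! ## Bit strings, distributions, data sets -/

/-- Bit strings of length `n`; `true` is the bit `1`. -/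
abbrev Bits (n : ℕ) : Type := Fin n → Bool

/-- The all-zero bit string. -/
def zeroBits (n : ℕ) : Bits n := fun _ => false

/-- Total variation distance of two real weight functions on a finite type. -/
def tvDist {α : Type} [Fintype α] (p q : α → ℝ) : ℝ := (1 / 2) * ∑ a, |p a - q a|

/-- `p` is a probability distribution on the finite type `α`. -/
def IsDistribution {α : Type} [Fintype α] (p : α → ℝ) : Prop :=
  (∀ a, 0 ≤ p a) ∧ ∑ a, p a = 1

/-- The uniform distribution on bit strings of length `n`. -/
def uniformBits (n : ℕ) : Bits n → ℝ := fun _ => 1 / 2 ^ n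

/-- A data set of `N` input-output pairs `(x, y)`. -/
abbrev Dataset (n N : ℕ) : Type := Fin N → Bits n × Bits n

/-- Probability that `N` independent pairs `(x, y)`, with `x` drawn from `q` and then `y` drawn
from the conditional distribution `p x`, form a data set in `S`. -/
def datasetProb {n N : ℕ} (q : Bits n → ℝ) (p : Bits n → Bits n → ℝ) (S : Set (Dataset n N)) : ℝ :=
  ∑ d : Dataset n N, S.indicator (fun d => ∏ t, q (d t).1 * p (d t).1 (d t).2) d

/-- Polynomially bounded functions of one natural number. -/
def PolyBounded (f : ℕ → ℕ) : Prop := ∃ k : ℕ, ∀ n, f n ≤ n ^ k + k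

/-! ## Operators on `n` qubits, as matrices in the computational basis -/

/-- Matrices acting on `n` qubits. -/
abbrev QMat (n : ℕ) : Type := Matrix (Bits n) (Bits n) ℂ

/-- The Hadamard gate. -/
def hadamard : Matrix Bool Bool ℂ :=
  Matrix.of fun b c => (if b && c then -1 else 1) / (Real.sqrt 2 : ℂ)

/-- The diagonal entries of `R_Z(θ) = exp(-i θ Z / 2)`. -/
def rzPhase (θ : ℝ) (b : Bool) : ℂ :=
  Complex.exp (-Complex.I * (θ / 2 : ℂ) * (if b then -1 else 1))

/-- The rotation gate `R_Z(θ) = exp(-i θ Z / 2)`. -/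
def rzGate (θ : ℝ) : Matrix Bool Bool ℂ := Matrix.diagonal (rzPhase θ)

/-- The controlled-`Z` gate. -/
def czGate : Matrix (Bool × Bool) (Bool × Bool) ℂ :=
  Matrix.diagonal fun b => if b.1 && b.2 then -1 else 1

/-- A Hadamard gate on every qubit. -/
def hLayer (n : ℕ) : QMat n := Matrix.of fun b c => ∏ i, hadamard (b i) (c i)

/-- The gate `R_Z(θ i)` on every qubit `i`. -/
def rzLayer {n : ℕ} (θ : Fin n → ℝ) : QMat n := Matrix.diagonal fun b => ∏ i, rzPhase (θ i) (b i)

/-- A `Z` gate on every qubit `i` with `s i = 1`. -/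
def zLayer {n : ℕ} (s : Bits n) : QMat n :=
  Matrix.diagonal fun b => ∏ i, if s i && b i then -1 else 1

open Classical in
/-- A controlled-`Z` gate on every edge of `G`. -/
def czLayer {n : ℕ} (G : SimpleGraph (Fin n)) : QMat n :=
  Matrix.diagonal fun b =>
    ∏ e ∈ Finset.univ.filter (fun e : Fin n × Fin n => e.1 < e.2 ∧ G.Adj e.1 e.2),
      if b e.1 && b e.2 then -1 else 1

open Classical in
/-- The one-qubit operator `U` acting on qubit `i`. -/
def onQubit {n : ℕ} (i : Fin n) (U : Matrix Bool Bool ℂ) : QMat n :=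
  Matrix.of fun b c => if ∀ k, k ≠ i → b k = c k then U (b i) (c i) else 0

open Classical in
/-- The two-qubit operator `U` acting on the (distinct) qubits `i` and `j`. -/
def onQubits {n : ℕ} (i j : Fin n) (U : Matrix (Bool × Bool) (Bool × Bool) ℂ) : QMat n :=
  Matrix.of fun b c => if ∀ k, k ≠ i → k ≠ j → b k = c k then U (b i, b j) (c i, c j) else 0

/-- Distribution of the outcome when `U |0…0⟩` is measured in the standard basis. -/
def measureZero {n : ℕ} (U : QMat n) (z : Bits n) : ℝ :=
  ‖(U *ᵥ Pi.single (zeroBits n) (1 : ℂ)) z‖ ^ 2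

/-! ## Instantaneously-deep quantum neural networks -/

/-- The product input state of `x`: qubit `i` is `|+⟩` if `x i = 0` and `|0⟩` if `x i = 1`. -/
def inputState {n : ℕ} (x : Bits n) : Bits n → ℂ := fun b =>
  ∏ i, if x i then (if b i then 0 else 1) else 1 / (Real.sqrt 2 : ℂ)

/-- The conditional distribution `p(y | x; θ)` of the instantaneously-deep QNN with connectivity
graph `G`: prepare the state of `x`, rotate by `R_Z(θ i)`, apply `CZ` on all edges, and measure in
the Pauli-`X` basis (that is, apply Hadamard gates and measure in the standard basis). -/
def idqnn {n : ℕ} (G : SimpleGraph (Fin n)) (θ : Fin n → ℝ) (x y : Bits n) : ℝ :=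
  ‖(hLayer n *ᵥ (czLayer G *ᵥ (rzLayer θ *ᵥ inputState x))) y‖ ^ 2

/-- The angles lie in `[0, π]`, where `θ` is determined by `cos θ`. -/
def AnglesInRange {n : ℕ} (θ : Fin n → ℝ) : Prop := ∀ i, θ i ∈ Set.Icc 0 Real.pi

/-- Every vertex of `G` has at most `Δ` neighbours. -/
def DegreeLE {n : ℕ} (G : SimpleGraph (Fin n)) (Δ : ℕ) : Prop :=
  ∀ v, (G.neighborSet v).ncard ≤ Δ

/-- The input `x` decouples site `i`: it is `0` at `i` and `1` at all neighbours of `i`. -/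
def Decouples {n : ℕ} (G : SimpleGraph (Fin n)) (i : Fin n) (x : Bits n) : Prop :=
  x i = false ∧ ∀ j, G.Adj i j → x j = true

open Classical in
/-- The estimator `arccos (1 - 2 * m)`, where `m` is the mean of the output bit at site `i` over
those samples of the data set whose input decouples `i`. -/
def angleEstimate {n N : ℕ} (G : SimpleGraph (Fin n)) (d : Dataset n N) (i : Fin n) : ℝ :=
  Real.arccos (1 - 2 *
    ((∑ t ∈ Finset.univ.filter (fun t => Decouples G i (d t).1), if (d t).2 i then (1 : ℝ) else 0) /
      ((Finset.univ.filter (fun t => Decouples G i (d t).1)).card : ℝ)))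

/-- `G` is the `s × m` square lattice with some edges within a row removed. The vertex with first
coordinate `i₁ < s` and second coordinate `i₂ < m` is number `i₁ * m + i₂`. -/
def IsSquareLattice (s m : ℕ) (G : SimpleGraph (Fin (s * m))) : Prop :=
  (∀ u v, G.Adj u v →
    Nat.dist u.divNat v.divNat + Nat.dist u.modNat v.modNat = 1) ∧
  (∀ u v, Nat.dist u.divNat v.divNat + Nat.dist u.modNat v.modNat = 1 →
    u.divNat ≠ v.divNat → G.Adj u v)

/-! ## Classical circuits -/

/-- A binary Boolean gate. A wire is an input or the output of a gate, given by its number. -/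
structure BoolGate (I : Type) where
  op : Bool → Bool → Bool
  left : I ⊕ ℕ
  right : I ⊕ ℕ

/-- A Boolean circuit with inputs indexed by `I` and outputs indexed by `O`: a straight-line list
of gates, each of which sees the inputs and the gates before it (other wires carry `0`). -/
structure BoolCircuit (I O : Type) where
  gates : List (BoolGate I)
  out : O → I ⊕ ℕ

namespace BoolCircuit

variable {I O : Type}

/-- The number of gates. -/
def size (c : BoolCircuit I O) : ℕ := c.gates.length

/-- The value of a wire, given the inputs and the values of the gates computed so far. -/
def wire (a : I → Bool) (vals : List Bool) : I ⊕ ℕ → Bool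
  | Sum.inl i => a i
  | Sum.inr k => vals.getD k false

/-- The values of all gates. -/
def gateValues (c : BoolCircuit I O) (a : I → Bool) : List Bool :=
  c.gates.foldl (fun vals g => vals ++ [g.op (wire a vals g.left) (wire a vals g.right)]) []

/-- The function computed by the circuit. -/
def eval (c : BoolCircuit I O) (a : I → Bool) : O → Bool :=
  fun o => wire a (c.gateValues a) (c.out o)

open Classical in
/-- The output distribution of a circuit that reads the input `a` and `k` uniformly random bits. -/
def law {k : ℕ} (c : BoolCircuit (I ⊕ Fin k) O) (a : I → Bool) (w : O → Bool) : ℝ :=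
  ((Finset.univ.filter fun ρ : Fin k → Bool => c.eval (Sum.elim a ρ) = w).card : ℝ) / 2 ^ k

end BoolCircuit

/-- Polynomial-size classical circuits can take uniformly random bits and sample from `p n` up to
total variation distance `η n`, for every `n ≥ 1` (exact sampling is the case `η = 0`). -/
def ClassicallySamplable (O : ℕ → Type) [∀ n, Fintype (O n)] [∀ n, DecidableEq (O n)]
    (p : ∀ n, (O n → Bool) → ℝ) (η : ℕ → ℝ) : Prop :=
  ∃ (k : ℕ → ℕ) (S : ∀ n, BoolCircuit (Empty ⊕ Fin (k n)) (O n)),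
    PolyBounded (fun n => (S n).size) ∧
    ∀ n, 1 ≤ n → tvDist ((S n).law Empty.elim) (p n) ≤ η n

/-- The input wires of a classical learner: the inputs and the outputs of the `N` samples, and the
new input string. -/
abbrev LearnerInput (n N : ℕ) : Type := (Fin N × Fin n) ⊕ (Fin N × Fin n) ⊕ Fin n

/-- The input bits of a classical learner with data set `d` and new input `x`. -/
def learnerBits {n N : ℕ} (d : Dataset n N) (x : Bits n) : LearnerInput n N → Bool
  | Sum.inl (t, i) => (d t).1 i
  | Sum.inr (Sum.inl (t, i)) => (d t).2 i
  | Sum.inr (Sum.inr i) => x i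

/-- Polynomial-size classical circuits can learn the instantaneously-deep QNNs on the graphs `G n`
(with angles in `[0, π]`) for some choice of the distributions `q n` of the training inputs: given
polynomially many samples, a new input `x` and random bits, they output a sample from a
distribution within `η n` of `p(· | x; θ)` in total variation distance for all `x`, with
probability at least `1 - δ` over the samples. -/
def ClassicallyLearnable (size : ℕ → ℕ) (G : ∀ n, SimpleGraph (Fin (size n))) (η : ℕ → ℝ)
    (δ : ℝ) : Prop :=
  ∃ (q : ∀ n, Bits (size n) → ℝ) (N k : ℕ → ℕ)
    (L : ∀ n, BoolCircuit (LearnerInput (size n) (N n) ⊕ Fin (k n)) (Fin (size n))),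
    (∀ n, IsDistribution (q n)) ∧ PolyBounded N ∧ PolyBounded (fun n => (L n).size) ∧
    ∀ n, 1 ≤ n → ∀ θ : Fin (size n) → ℝ, AnglesInRange θ →
      1 - δ ≤ datasetProb (q n) (idqnn (G n) θ)
        {d : Dataset (size n) (N n) |
          ∀ x, tvDist ((L n).law (learnerBits d x)) (idqnn (G n) θ x) ≤ η n}

/-! ## Deep quantum circuits and the hardness conjecture -/

/-- An elementary gate of a general quantum circuit: any unitary on one or two qubits. -/
inductive QGate (n : ℕ) : Type
  | one (i : Fin n) (U : Matrix.unitaryGroup Bool ℂ) : QGate n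
  | two (i j : Fin n) (hij : i ≠ j) (U : Matrix.unitaryGroup (Bool × Bool) ℂ) : QGate n

/-- The operator of a gate. -/
def QGate.toMat {n : ℕ} : QGate n → QMat n
  | .one i U => onQubit i (U : Matrix Bool Bool ℂ)
  | .two i j _ U => onQubits i j (U : Matrix (Bool × Bool) (Bool × Bool) ℂ)

/-- The operator of a list of operators, applied from the first to the last. -/
def runOps {n : ℕ} (l : List (QMat n)) : QMat n := l.foldl (fun M g => g * M) 1

/-- Trace norm: the sum of the singular values. -/
def traceNorm {ι : Type} [Fintype ι] [DecidableEq ι] (A : Matrix ι ι ℂ) : ℝ :=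
  ∑ i, Real.sqrt ((Matrix.isHermitian_conjTranspose_mul_self A).eigenvalues i)

open scoped Kronecker ComplexOrder in
/-- The channels `ρ ↦ U ρ U†` and `ρ ↦ V ρ V†` differ by at most `ε` in diamond distance. -/
def DiamondClose {n : ℕ} (ε : ℝ) (U V : QMat n) : Prop :=
  ∀ (k : ℕ) (ρ : Matrix (Bits n × Fin k) (Bits n × Fin k) ℂ), ρ.PosSemidef → ρ.trace = 1 →
    traceNorm ((U ⊗ₖ (1 : Matrix (Fin k) (Fin k) ℂ)) * ρ * (U ⊗ₖ (1 : Matrix (Fin k) (Fin k) ℂ))ᴴ -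
      (V ⊗ₖ (1 : Matrix (Fin k) (Fin k) ℂ)) * ρ * (V ⊗ₖ (1 : Matrix (Fin k) (Fin k) ℂ))ᴴ) ≤ ε

/-- A one-dimensional circuit on `m` qubits with `r + 1` rounds, each consisting of Hadamard gates
on all qubits, `R_Z` gates on all qubits, and `CZ` gates on some pairs of nearest neighbours. -/
structure LayeredCircuit (m : ℕ) where
  r : ℕ
  angle : Fin (r + 1) → Fin m → ℝ
  cz : Fin (r + 1) → SimpleGraph (Fin m)
  cz_le : ∀ j, cz j ≤ SimpleGraph.pathGraph m

namespace LayeredCircuit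

variable {m : ℕ} (D : LayeredCircuit m)

/-- The number of rounds. -/
def rounds : ℕ := D.r + 1

/-- The operator of one round. -/
def round (j : Fin (D.r + 1)) : QMat m := czLayer (D.cz j) * rzLayer (D.angle j) * hLayer m

/-- Rounds `0, …, k`, with the gates `Z ^ y' j` inserted at the end of each round `j < k`. -/
def upTo (y' : Fin D.r → Bits m) : (k : ℕ) → k ≤ D.r → QMat m
  | 0, _ => D.round 0
  | k + 1, h => D.round ⟨k + 1, Nat.lt_succ_of_le h⟩ * zLayer (y' ⟨k, h⟩) *
      upTo y' k (Nat.le_of_succ_le h)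

/-- The member `D(y')` of the family: a `Z` gate is applied to qubit `i` at the end of round `j`
if `y' j i = 1`, for all rounds `j` but the last. -/
def unitary (y' : Fin D.r → Bits m) : QMat m := D.upTo y' D.r le_rfl

/-- The index set of the bits `(y', z)`. -/
abbrev Out : Type := (Fin D.r × Fin m) ⊕ Fin m

/-- The distribution of `(y', z)`, where `y'` is uniformly random and `z` is the outcome of
measuring `D(y') |0…0⟩` in the standard basis. -/
def law (w : D.Out → Bool) : ℝ :=
  1 / 2 ^ (D.r * m) *
    measureZero (D.unitary fun j i => w (Sum.inl (j, i))) fun i => w (Sum.inr i)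

end LayeredCircuit

/-- The conjecture on classical hardness of sampling deep quantum circuits: there are
polynomial-size quantum circuits `C n` on `n` qubits, and layered one-dimensional circuits `D n`
with polynomially many rounds and exponentially close to `C n`, such that no polynomial-size
classical circuits sample `y'` uniformly together with the outcome of measuring `D n (y') |0…0⟩`,
up to total variation distance `η n`. The case `η = 0` is exact sampling. -/
def HardDeepSampling (η : ℕ → ℝ) : Prop :=
  ∃ (C : ∀ n, List (QGate n)) (D : ∀ n, LayeredCircuit n),
    PolyBounded (fun n => (C n).length) ∧
    PolyBounded (fun n => (D n).rounds) ∧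
    (∀ n, 1 ≤ n → DiamondClose ((1 / 2) ^ n) (runOps ((C n).map QGate.toMat))
      ((D n).unitary fun _ => zeroBits n)) ∧
    ¬ ClassicallySamplable (fun n => (D n).Out) (fun n => (D n).law) η

/-! ## Uniform algorithms

A register machine with natural-number registers, random access to a read-only input list and a
write-only output list. Every evaluation of an expression is charged the bit lengths of all the
values involved, so that its time is polynomially related to that of a Turing machine. -/

/-- Arithmetic expressions. -/
inductive RExpr : Type
  | const (c : ℕ)
  | reg (i : ℕ)
  | input (e : RExpr)
  | add (e f : RExpr)
  | sub (e f : RExpr)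
  | mul (e f : RExpr)
  | div (e f : RExpr)

namespace RExpr

/-- The value of an expression; reading beyond the input gives `0`. -/
def val (inp : List ℕ) (σ : ℕ → ℕ) : RExpr → ℕ
  | const c => c
  | reg i => σ i
  | input e => inp.getD (e.val inp σ) 0
  | add e f => e.val inp σ + f.val inp σ
  | sub e f => e.val inp σ - f.val inp σ
  | mul e f => e.val inp σ * f.val inp σ
  | div e f => e.val inp σ / f.val inp σ

/-- The cost of evaluating an expression: one plus the bit length of the value, for each node. -/
def cost (inp : List ℕ) (σ : ℕ → ℕ) : RExpr → ℕ
  | const c => 1 + Nat.size c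
  | reg i => 1 + Nat.size (σ i)
  | input e => 1 + Nat.size ((input e).val inp σ) + e.cost inp σ
  | add e f => 1 + Nat.size ((add e f).val inp σ) + e.cost inp σ + f.cost inp σ
  | sub e f => 1 + Nat.size ((sub e f).val inp σ) + e.cost inp σ + f.cost inp σ
  | mul e f => 1 + Nat.size ((mul e f).val inp σ) + e.cost inp σ + f.cost inp σ
  | div e f => 1 + Nat.size ((div e f).val inp σ) + e.cost inp σ + f.cost inp σ

end RExpr

/-- Programs. A condition counts as true if its value is not `0`. -/
inductive RProg : Type
  | skip
  | assign (i : ℕ) (e : RExpr)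
  | emit (e : RExpr)
  | seq (p q : RProg)
  | cond (e : RExpr) (p q : RProg)
  | loop (e : RExpr) (p : RProg)

/-- `RProg.Runs inp p σ o t σ' o'`: on input `inp`, started with registers `σ` and output `o`, the
program `p` halts after time `t` with registers `σ'` and output `o'`. -/
inductive RProg.Runs (inp : List ℕ) :
    RProg → (ℕ → ℕ) → List ℕ → ℕ → (ℕ → ℕ) → List ℕ → Prop
  | skip (σ : ℕ → ℕ) (o : List ℕ) : Runs inp .skip σ o 1 σ o
  | assign (σ : ℕ → ℕ) (o : List ℕ) (i : ℕ) (e : RExpr) :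
      Runs inp (.assign i e) σ o (1 + e.cost inp σ) (Function.update σ i (e.val inp σ)) o
  | emit (σ : ℕ → ℕ) (o : List ℕ) (e : RExpr) :
      Runs inp (.emit e) σ o (1 + e.cost inp σ) σ (o ++ [e.val inp σ])
  | seq {σ σ' σ'' : ℕ → ℕ} {o o' o'' : List ℕ} {p q : RProg} {t t' : ℕ} :
      Runs inp p σ o t σ' o' → Runs inp q σ' o' t' σ'' o'' →
      Runs inp (.seq p q) σ o (1 + t + t') σ'' o''
  | condTrue {σ σ' : ℕ → ℕ} {o o' : List ℕ} {e : RExpr} {p q : RProg} {t : ℕ} :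
      e.val inp σ ≠ 0 → Runs inp p σ o t σ' o' →
      Runs inp (.cond e p q) σ o (1 + e.cost inp σ + t) σ' o'
  | condFalse {σ σ' : ℕ → ℕ} {o o' : List ℕ} {e : RExpr} {p q : RProg} {t : ℕ} :
      e.val inp σ = 0 → Runs inp q σ o t σ' o' →
      Runs inp (.cond e p q) σ o (1 + e.cost inp σ + t) σ' o'
  | loopStop {σ : ℕ → ℕ} {o : List ℕ} {e : RExpr} {p : RProg} :
      e.val inp σ = 0 → Runs inp (.loop e p) σ o (1 + e.cost inp σ) σ o
  | loopStep {σ σ' σ'' : ℕ → ℕ} {o o' o'' : List ℕ} {e : RExpr} {p : RProg} {t t' : ℕ} :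
      e.val inp σ ≠ 0 → Runs inp p σ o t σ' o' → Runs inp (.loop e p) σ' o' t' σ'' o'' →
      Runs inp (.loop e p) σ o (1 + e.cost inp σ + t + t') σ'' o''

/-- On input `inp`, the program halts within time `T` with output `out`. -/
def RProg.ComputesWithin (p : RProg) (inp : List ℕ) (T : ℕ) (out : List ℕ) : Prop :=
  ∃ (t : ℕ) (σ : ℕ → ℕ), t ≤ T ∧ RProg.Runs inp p (fun _ => 0) [] t σ out

/-- A bit string as a list of numbers. -/
def encodeBits {n : ℕ} (x : Bits n) : List ℕ := List.ofFn fun i => (x i).toNat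

open Classical in
/-- The adjacency matrix of `G`, row by row. -/
def encodeGraph {n : ℕ} (G : SimpleGraph (Fin n)) : List ℕ :=
  (List.finRange n).flatMap fun i => (List.finRange n).map fun j => if G.Adj i j then 1 else 0

/-- The pairs of a data set, one after the other. -/
def encodeDataset {n N : ℕ} (d : Dataset n N) : List ℕ :=
  (List.finRange N).flatMap fun t => encodeBits (d t).1 ++ encodeBits (d t).2

/-- The input of the learning phase: accuracy `1 / a`, failure probability `1 / b`. -/
def learnInput {n N : ℕ} (G : SimpleGraph (Fin n)) (a b : ℕ) (d : Dataset n N) : List ℕ :=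
  [n, a, b, N] ++ encodeGraph G ++ encodeDataset d

/-- The input of the inference phase: the new input string and the learned model. -/
def inferInput {n : ℕ} (x : Bits n) (model : List ℕ) : List ℕ :=
  [n] ++ encodeBits x ++ model

/-- The gate on `n` qubits described by four numbers: `H` on qubit `i` (kind `0`), `CZ` on qubits
`i ≠ u` (kind `1`), `R_Z(π * u / v)` on qubit `i` (any other kind); the identity if a qubit number
is out of range. -/
def describedGate (n kind i u v : ℕ) : QMat n :=
  if hi : i < n then
    match kind with
    | 0 => onQubit ⟨i, hi⟩ hadamard
    | 1 => if hu : u < n ∧ i ≠ u then onQubits ⟨i, hi⟩ ⟨u, hu.1⟩ czGate else 1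
    | _ => onQubit ⟨i, hi⟩ (rzGate (Real.pi * u / v))
  else 1

/-- The gates of a circuit on `n` qubits, described by a list with four numbers per gate. -/
def describedGates (n : ℕ) : List ℕ → List (QMat n)
  | kind :: i :: u :: v :: l => describedGate n kind i u v :: describedGates n l
  | _ => []

/-- Distribution of the outcome when a quantum computer runs the described circuit on `|0…0⟩` and
measures all qubits in the standard basis. -/
def quantumOutput (n : ℕ) (desc : List ℕ) : Bits n → ℝ := measureZero (runOps (describedGates n desc))

/-- A quantum computer efficiently learns all instantaneously-deep QNNs of degree at most `Δ` with
angles in `[0, π]`. A learning program turns a data set into a model, and an inference program turns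
the model and any new input `x` into a quantum circuit on `n` qubits, both in polynomial time. If
the data set consists of polynomially many samples with uniformly random inputs, then with
probability at least `1 - 1 / b` the circuit's output is within `1 / a` of `p(· | x; θ)` in total
variation distance, for all `x`. -/
def QuantumlyLearnable (Δ : ℕ) : Prop :=
  ∃ (learn infer : RProg) (K : ℕ), ∀ n a b N : ℕ, 1 ≤ n → 1 ≤ a → 1 ≤ b →
    ∀ G : SimpleGraph (Fin n), DegreeLE G Δ →
    ∃ (model : Dataset n N → List ℕ) (circuit : Dataset n N → Bits n → List ℕ),
      (∀ d, learn.ComputesWithin (learnInput G a b d) ((n + a + b + N) ^ K) (model d)) ∧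
      (∀ d x, infer.ComputesWithin (inferInput x (model d)) ((n + a + b + N) ^ K) (circuit d x)) ∧
      ((n + a + b) ^ K ≤ N → ∀ θ : Fin n → ℝ, AnglesInRange θ →
        1 - 1 / (b : ℝ) ≤ datasetProb (uniformBits n) (idqnn G θ)
          {d : Dataset n N |
            ∀ x, tvDist (quantumOutput n (circuit d x)) (idqnn G θ x) ≤ 1 / (a : ℝ)})

end

open scoped Matrix

noncomputable section

/-! ## Tensor products of one-qubit operators -/

/-! Decoupling. Before the final Hadamards the network is in a state `ψ = graphState G θ x`, and
since Hadamards turn Pauli-X into Pauli-Z, the expectation of `(-1) ^ y i` is `⟨ψ, X_i ψ⟩`, the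
overlap of `ψ` with itself after flipping bit `i`. If all neighbours of `i` are prepared in `|0⟩`,
the support of `ψ` has bit 0 at them, no `CZ` sign changes under the flip, and only the relative
phase `exp (± I θ_i)` of `R_Z` remains; averaging over the two values of bit `i` gives `cos θ_i`
(`idqnn_decoupled`).

Learning. A uniform input decouples a site with probability at least `2 ^ (-(Δ + 1))`
(`le_decoupleProb`). Chebyshev's inequality, applied for every site to the number of decoupling
samples and to the centred sum of their output bits, together with a union bound over these `2 n`
events, makes all empirical means accurate. The angle is only Hölder continuous of exponent 1/2 in
its cosine (`abs_sub_sq_le_of_cos`), so the means are needed to accuracy of order `1 / a ^ 2`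
(`estimates_accurate_prob`).

Quantum easiness. The output distribution is Lipschitz in the angles, uniformly in `x`
(`tvDist_idqnn_le`), so it suffices to run the network with angles `π u / v` that are accurate to
order `1 / (n a)`. The empirical cosine `1 - 2 c / m` is rational, and the binary digits of its arc
cosine in units of `π` are extracted exactly by angle doubling: `x` is replaced by `2 x ^ 2 - 1`,
and the sign of `x` tells in which half of `[0, π]` the angle lies (`ArcState.Holds.next`).
Numerators and denominators double in length at each step, but only about `log (n a)` steps are
made, so all numbers keep polynomial length. The programs are verified with a Hoare-style calculus
(`RunsIn`) that tracks result, register length and time together; time is bounded by a syntactic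
weight, polynomial in the bound on loop counts.

Hardness. On input 0 the lattice network is a measurement-based computation. Expanding the amplitude
as a sum over the bits of all rows, the `CZ` gates between consecutive rows form, up to
normalization, the matrix of the Hadamard layer, while the X-measurement of row `j` with outcome `y
j` inserts `Z ^ (y j)`. Thus each row performs one round of the layered circuit
(`amplitude_latticeGraph`, `LayeredCircuit.pathState_eq`). One extra row, with zero angles and no
internal edges, cancels the Hadamards of the final measurement, so that its outcome is a
standard-basis measurement of the circuit; the outcome of the row before it only affects signs and
is uniform. Reducing angles to `[0, π]` costs factors `Z`, which amount to known flips of `y'`.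
Hence the law of `(y', z)` is the image of the network's output under selecting and flipping bits
(`LayeredCircuit.sum_idqnn_latticeGraph`), and since images do not increase total variation
distance, a sampler for the network gives one for the circuits. A learner gives a sampler as well:
as `δ < 1`, good data exist and can be hardwired nonuniformly (`ClassicallyLearnable.samplable`). -/

/-- The tensor product of the one-qubit operators `V i`. -/
def tensorMat {n : ℕ} (V : Fin n → Matrix Bool Bool ℂ) : QMat n :=
  Matrix.of fun b c => ∏ i, V i (b i) (c i)

lemma tensorMat_mul {n : ℕ} (V W : Fin n → Matrix Bool Bool ℂ) :
    tensorMat V * tensorMat W = tensorMat (fun i => V i * W i) := by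
  ext b c
  simp only [tensorMat, Matrix.mul_apply, Matrix.of_apply, Fintype.prod_sum, Finset.prod_mul_distrib]

lemma tensorMat_one (n : ℕ) : tensorMat (fun _ : Fin n => (1 : Matrix Bool Bool ℂ)) = 1 := by
  ext b c
  simp only [tensorMat, Matrix.of_apply, Matrix.one_apply]
  by_cases h : b = c
  · simp [h]
  · obtain ⟨i, hi⟩ := Function.ne_iff.mp h
    rw [if_neg h]
    exact Finset.prod_eq_zero (Finset.mem_univ i) (by simp [hi])

lemma sqrt_two_mul_self : (Real.sqrt 2 : ℂ) * (Real.sqrt 2 : ℂ) = 2 := by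
  rw [← Complex.ofReal_mul, Real.mul_self_sqrt (by norm_num)]; norm_num

lemma hadamard_mul_hadamard : hadamard * hadamard = 1 := by
  have h : (Real.sqrt 2 : ℂ)⁻¹ * (Real.sqrt 2 : ℂ)⁻¹ = 1 / 2 := by
    rw [← mul_inv, sqrt_two_mul_self, one_div]
  ext b c
  rw [Matrix.mul_apply, Fintype.sum_bool]
  cases b <;> cases c <;> simp [hadamard, neg_div, h] <;> norm_num

lemma hadamard_conjTranspose : hadamardᴴ = hadamard := by
  ext b c
  cases b <;> cases c <;> simp [hadamard, Matrix.conjTranspose_apply]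

lemma hLayer_eq_tensorMat (n : ℕ) : hLayer n = tensorMat fun _ => hadamard := rfl

lemma hLayer_mul_hLayer (n : ℕ) : hLayer n * hLayer n = 1 := by
  rw [hLayer_eq_tensorMat, tensorMat_mul, hadamard_mul_hadamard, tensorMat_one]

lemma hLayer_conjTranspose (n : ℕ) : (hLayer n)ᴴ = hLayer n := by
  ext b c
  have h : ∀ b c, star (hadamard b c) = hadamard c b := fun b c => by
    conv_rhs => rw [← hadamard_conjTranspose]
    rfl
  simp only [hLayer, Matrix.conjTranspose_apply, Matrix.of_apply, star_prod, h]

/-- The layer of Hadamard gates preserves inner products. -/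
lemma star_hLayer_dotProduct (n : ℕ) (v w : Bits n → ℂ) :
    star (hLayer n *ᵥ v) ⬝ᵥ (hLayer n *ᵥ w) = star v ⬝ᵥ w := by
  rw [Matrix.star_mulVec, hLayer_conjTranspose, ← Matrix.dotProduct_mulVec, Matrix.mulVec_mulVec,
    hLayer_mul_hLayer, Matrix.one_mulVec]

lemma star_dotProduct_self {ι : Type} [Fintype ι] (v : ι → ℂ) :
    star v ⬝ᵥ v = ((∑ b, ‖v b‖ ^ 2 : ℝ) : ℂ) := by
  simp [dotProduct, Complex.conj_mul']

lemma sum_norm_sq_hLayer (n : ℕ) (v : Bits n → ℂ) :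
    ∑ b, ‖(hLayer n *ᵥ v) b‖ ^ 2 = ∑ b, ‖v b‖ ^ 2 := by
  have h := star_hLayer_dotProduct n v v
  rw [star_dotProduct_self, star_dotProduct_self] at h
  exact_mod_cast h

/-! ## The state before the measurement -/

open Classical in
/-- The diagonal of `czLayer G`. -/
def czSign {n : ℕ} (G : SimpleGraph (Fin n)) (b : Bits n) : ℂ :=
  ∏ e ∈ Finset.univ.filter (fun e : Fin n × Fin n => e.1 < e.2 ∧ G.Adj e.1 e.2),
    if b e.1 && b e.2 then -1 else 1

lemma czLayer_mulVec {n : ℕ} (G : SimpleGraph (Fin n)) (v : Bits n → ℂ) (b : Bits n) :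
    (czLayer G *ᵥ v) b = czSign G b * v b := by
  rw [czLayer, Matrix.mulVec_diagonal]; rfl

lemma rzLayer_mulVec {n : ℕ} (θ : Fin n → ℝ) (v : Bits n → ℂ) (b : Bits n) :
    (rzLayer θ *ᵥ v) b = (∏ i, rzPhase (θ i) (b i)) * v b := by
  rw [rzLayer, Matrix.mulVec_diagonal]

lemma norm_czSign {n : ℕ} (G : SimpleGraph (Fin n)) (b : Bits n) : ‖czSign G b‖ = 1 := by
  rw [czSign, norm_prod]
  refine Finset.prod_eq_one fun e _ => ?_
  split_ifs <;> simp

lemma rzPhase_eq_exp (θ : ℝ) (b : Bool) :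
    rzPhase θ b = Complex.exp ((((if b then 1 else -1) * (θ / 2) : ℝ) : ℂ) * Complex.I) := by
  rw [rzPhase]
  congr 1
  cases b <;> push_cast <;> simp <;> ring

lemma norm_rzPhase (θ : ℝ) (b : Bool) : ‖rzPhase θ b‖ = 1 := by
  rw [rzPhase_eq_exp, Complex.norm_exp_ofReal_mul_I]

lemma norm_prod_rzPhase {n : ℕ} (θ : Fin n → ℝ) (b : Bits n) : ‖∏ i, rzPhase (θ i) (b i)‖ = 1 := by
  rw [norm_prod]
  exact Finset.prod_eq_one fun i _ => norm_rzPhase _ _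

/-- The state is a product, so the sum over bit strings is a product over qubits of one-qubit norms.
-/
lemma sum_norm_sq_inputState {n : ℕ} (x : Bits n) : ∑ b, ‖inputState x b‖ ^ 2 = 1 := by
  have h : ∀ b : Bits n, ‖inputState x b‖ ^ 2 =
      ∏ i, (if x i then (if b i then (0 : ℝ) else 1) else 1 / 2) := by
    intro b
    rw [inputState, norm_prod, ← Finset.prod_pow]
    refine Finset.prod_congr rfl fun i _ => ?_
    split_ifs <;> simp
  simp only [h]
  rw [← Fintype.prod_sum (f := fun i (c : Bool) => (if x i then (if c then (0 : ℝ) else 1) else 1 / 2))]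
  refine Finset.prod_eq_one fun i _ => ?_
  cases x i <;> norm_num

/-- The state of the network just before the final Hadamard gates. -/
def graphState {n : ℕ} (G : SimpleGraph (Fin n)) (θ : Fin n → ℝ) (x : Bits n) : Bits n → ℂ :=
  czLayer G *ᵥ (rzLayer θ *ᵥ inputState x)

lemma graphState_apply {n : ℕ} (G : SimpleGraph (Fin n)) (θ : Fin n → ℝ) (x b : Bits n) :
    graphState G θ x b = czSign G b * ((∏ i, rzPhase (θ i) (b i)) * inputState x b) := by
  rw [graphState, czLayer_mulVec, rzLayer_mulVec]

lemma idqnn_eq {n : ℕ} (G : SimpleGraph (Fin n)) (θ : Fin n → ℝ) (x y : Bits n) :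
    idqnn G θ x y = ‖(hLayer n *ᵥ graphState G θ x) y‖ ^ 2 := rfl

lemma idqnn_nonneg {n : ℕ} (G : SimpleGraph (Fin n)) (θ : Fin n → ℝ) (x y : Bits n) :
    0 ≤ idqnn G θ x y := sq_nonneg _

lemma norm_graphState {n : ℕ} (G : SimpleGraph (Fin n)) (θ : Fin n → ℝ) (x b : Bits n) :
    ‖graphState G θ x b‖ = ‖inputState x b‖ := by
  rw [graphState_apply, norm_mul, norm_mul, norm_czSign, norm_prod_rzPhase, one_mul, one_mul]

lemma sum_idqnn {n : ℕ} (G : SimpleGraph (Fin n)) (θ : Fin n → ℝ) (x : Bits n) :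
    ∑ y, idqnn G θ x y = 1 := by
  simp only [idqnn_eq, sum_norm_sq_hLayer, norm_graphState, sum_norm_sq_inputState]

/-! ## Decoupling -/

/-- Flip the bit at site `i`. -/
def flipAt {n : ℕ} (i : Fin n) (b : Bits n) : Bits n := Function.update b i (!b i)

lemma flipAt_involutive {n : ℕ} (i : Fin n) : Function.Involutive (flipAt i) := by
  intro b
  simp [flipAt]

lemma flipAt_self {n : ℕ} (i : Fin n) (b : Bits n) : flipAt i b i = !b i := by simp [flipAt]

lemma flipAt_ne {n : ℕ} {i k : Fin n} (h : k ≠ i) (b : Bits n) : flipAt i b k = b k := by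
  simp [flipAt, h]

lemma sum_flipAt {n : ℕ} {M : Type*} [AddCommMonoid M] (i : Fin n) (f : Bits n → M) :
    ∑ b, f (flipAt i b) = ∑ b, f b :=
  Equiv.sum_comp (flipAt_involutive i).toPerm f

/-- Hadamards conjugate `X_i` to `Z_i`: only the factor at site `i` notices the flip, and it changes
by the sign `(-1) ^ y i`. -/
lemma hLayer_mulVec_flipAt {n : ℕ} (i : Fin n) (v : Bits n → ℂ) (y : Bits n) :
    (hLayer n *ᵥ fun b => v (flipAt i b)) y = (if y i then -1 else 1) * (hLayer n *ᵥ v) y := by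
  simp only [Matrix.mulVec, dotProduct]
  rw [← sum_flipAt i, Finset.mul_sum]
  refine Finset.sum_congr rfl fun b _ => ?_
  rw [flipAt_involutive i b, ← mul_assoc]
  congr 1
  simp only [hLayer, Matrix.of_apply]
  rw [← Finset.mul_prod_erase _ _ (Finset.mem_univ i), ← Finset.mul_prod_erase _ _ (Finset.mem_univ i),
    ← mul_assoc]
  congr 1
  · rw [flipAt_self]
    cases y i <;> cases b i <;> simp [hadamard, neg_div]
  · refine Finset.prod_congr rfl fun k hk => ?_
    rw [flipAt_ne (Finset.ne_of_mem_erase hk)]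

lemma inputState_eq_zero {n : ℕ} {x b : Bits n} {j : Fin n} (hx : x j = true) (hb : b j = true) :
    inputState x b = 0 :=
  Finset.prod_eq_zero (Finset.mem_univ j) (by simp [hx, hb])

lemma inputState_flipAt {n : ℕ} {x : Bits n} {i : Fin n} (hx : x i = false) (b : Bits n) :
    inputState x (flipAt i b) = inputState x b := by
  refine Finset.prod_congr rfl fun k _ => ?_
  by_cases h : k = i
  · subst h; simp [hx]
  · rw [flipAt_ne h]

/-- Every `CZ` touching `i` has the bit 0 at its other end, so it acts trivially whatever the bit at
`i` is. -/
lemma czSign_flipAt {n : ℕ} (G : SimpleGraph (Fin n)) {i : Fin n} {b : Bits n}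
    (hb : ∀ j, G.Adj i j → b j = false) : czSign G (flipAt i b) = czSign G b := by
  classical
  refine Finset.prod_congr rfl fun e he => ?_
  have hadj : G.Adj e.1 e.2 := (Finset.mem_filter.mp he).2.2
  by_cases h1 : e.1 = i
  · have h2 : e.2 ≠ i := fun h => hadj.ne (h1.trans h.symm)
    have := hb e.2 (h1 ▸ hadj)
    rw [flipAt_ne h2, this]; simp
  · by_cases h2 : e.2 = i
    · have := hb e.1 (h2 ▸ hadj.symm)
      rw [flipAt_ne h1, this]; simp
    · rw [flipAt_ne h1, flipAt_ne h2]

lemma prod_rzPhase_flipAt {n : ℕ} (θ : Fin n → ℝ) (i : Fin n) (b : Bits n) :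
    star (∏ k, rzPhase (θ k) (b k)) * ∏ k, rzPhase (θ k) (flipAt i b k) =
      star (rzPhase (θ i) (b i)) * rzPhase (θ i) (!b i) := by
  rw [star_prod, ← Finset.prod_mul_distrib, ← Finset.mul_prod_erase _ _ (Finset.mem_univ i),
    flipAt_self, Finset.prod_eq_one, mul_one]
  intro k hk
  rw [flipAt_ne (Finset.ne_of_mem_erase hk)]
  change (starRingEnd ℂ) _ * _ = 1
  rw [Complex.conj_mul', norm_rzPhase]; norm_num

/-- If some neighbour of `i` has bit 1 in `b`, both sides vanish because that neighbour is prepared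
in `|0⟩`. Otherwise the `CZ` signs of `b` and of its flip agree and cancel, as do all phases except
those at `i`. -/
lemma star_graphState_mul_flipAt {n : ℕ} {G : SimpleGraph (Fin n)} (θ : Fin n → ℝ) {i : Fin n}
    {x : Bits n} (hx : Decouples G i x) (b : Bits n) :
    star (graphState G θ x b) * graphState G θ x (flipAt i b) =
      (star (rzPhase (θ i) (b i)) * rzPhase (θ i) (!b i)) * (‖inputState x b‖ ^ 2 : ℝ) := by
  simp only [graphState_apply]
  rw [inputState_flipAt hx.1]
  by_cases hb : ∀ j, G.Adj i j → b j = false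
  · rw [czSign_flipAt G hb, ← prod_rzPhase_flipAt]
    have h1 : star (czSign G b) * czSign G b = 1 := by
      change (starRingEnd ℂ) _ * _ = 1
      rw [Complex.conj_mul', norm_czSign]; norm_num
    have h2 : star (inputState x b) * inputState x b = ((‖inputState x b‖ ^ 2 : ℝ) : ℂ) := by
      change (starRingEnd ℂ) _ * _ = _
      rw [Complex.conj_mul']; norm_num
    rw [← h2, star_mul', star_mul']
    linear_combination (star (∏ k, rzPhase (θ k) (b k)) * star (inputState x b) *
      (∏ k, rzPhase (θ k) (flipAt i b k)) * inputState x b) * h1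
  · push Not at hb
    obtain ⟨j, hj, hbj⟩ := hb
    rw [inputState_eq_zero (hx.2 j hj) (by simpa using hbj)]
    simp

lemma star_rzPhase_mul_add (θ : ℝ) (b : Bool) :
    star (rzPhase θ b) * rzPhase θ (!b) + star (rzPhase θ (!b)) * rzPhase θ b =
      2 * (Real.cos θ : ℂ) := by
  have h : ∀ c : Bool, star (rzPhase θ c) * rzPhase θ (!c) =
      Complex.exp (((if c then -1 else 1 : ℝ) * θ : ℝ) * Complex.I) := by
    intro c
    rw [rzPhase_eq_exp, rzPhase_eq_exp]
    change (starRingEnd ℂ) _ * _ = _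
    rw [← Complex.exp_conj, ← Complex.exp_add]
    congr 1
    rw [map_mul, Complex.conj_ofReal, Complex.conj_I]
    cases c <;> push_cast <;> simp <;> ring
  have h' := h (!b)
  rw [Bool.not_not] at h'
  rw [h, h', Complex.ofReal_cos, Complex.two_cos]
  cases b <;> simp [add_comm]

/-- The bias of `y i` is the expectation of `X_i` in the state before the Hadamards, because these
preserve inner products. -/
theorem idqnn_decoupled {n : ℕ} (G : SimpleGraph (Fin n)) (θ : Fin n → ℝ) (i : Fin n) (x : Bits n)
    (hx : Decouples G i x) :
    ∑ y : Bits n, (if y i then idqnn G θ x y else 0) = (1 - Real.cos (θ i)) / 2 := by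
  have hZ : ∑ y, (if y i then -1 else 1) * idqnn G θ x y = Real.cos (θ i) := by
    have h1 := star_hLayer_dotProduct n (graphState G θ x) fun b => graphState G θ x (flipAt i b)
    have h2 : star (hLayer n *ᵥ graphState G θ x) ⬝ᵥ
        (hLayer n *ᵥ fun b => graphState G θ x (flipAt i b)) =
        ((∑ y, (if y i then -1 else 1) * idqnn G θ x y : ℝ) : ℂ) := by
      simp only [dotProduct, hLayer_mulVec_flipAt, idqnn_eq, Pi.star_apply]
      push_cast
      refine Finset.sum_congr rfl fun y _ => ?_
      rw [← Complex.conj_mul']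
      change (starRingEnd ℂ) _ * _ = _
      split_ifs <;> push_cast <;> ring
    have h3 : star (graphState G θ x) ⬝ᵥ (fun b => graphState G θ x (flipAt i b)) =
        ((Real.cos (θ i) : ℝ) : ℂ) := by
      simp only [dotProduct, Pi.star_apply, star_graphState_mul_flipAt θ hx]
      set f : Bits n → ℂ := fun b =>
        (star (rzPhase (θ i) (b i)) * rzPhase (θ i) (!b i)) * (‖inputState x b‖ ^ 2 : ℝ) with hf
      -- The phase in `f b` is one of `exp (± I θ_i)`, depending on `b i`. Adding the term of the
      -- flipped string gives `2 cos θ_i` for every `b`, and the two sums are equal by reindexing.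
      have hsum : ∑ b, f b + ∑ b, f (flipAt i b) = 2 * ((Real.cos (θ i) : ℝ) : ℂ) := by
        rw [← Finset.sum_add_distrib]
        have : ∀ b, f b + f (flipAt i b) =
            2 * ((Real.cos (θ i) : ℝ) : ℂ) * ((‖inputState x b‖ ^ 2 : ℝ) : ℂ) := by
          intro b
          rw [hf]
          simp only [flipAt_self, inputState_flipAt hx.1, Bool.not_not]
          rw [← add_mul, star_rzPhase_mul_add]
        simp only [this]
        rw [← Finset.mul_sum, ← Complex.ofReal_sum, sum_norm_sq_inputState]
        simp
      rw [sum_flipAt i f, ← two_mul] at hsum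
      exact mul_left_cancel₀ two_ne_zero hsum
    rw [h2, h3] at h1
    exact_mod_cast h1
  have hone := sum_idqnn G θ x
  have : ∑ y : Bits n, (if y i then idqnn G θ x y else 0) =
      ∑ y, (idqnn G θ x y - (if y i then -1 else 1) * idqnn G θ x y) / 2 := by
    refine Finset.sum_congr rfl fun y _ => ?_
    split_ifs <;> ring
  rw [this, ← Finset.sum_div, Finset.sum_sub_distrib, hone, hZ]

/-! ## Second moments of sums of independent variables -/

/-- Independence: the sum over families factorizes over the indices. For `s ≠ t` the factor at `s`
is the mean of `f`, which is zero. -/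
lemma sum_prod_mul_mul {α : Type} [Fintype α] {N : ℕ} {w f : α → ℝ} (hw : ∑ a, w a = 1)
    (hf : ∑ a, w a * f a = 0) (s t : Fin N) :
    ∑ d : Fin N → α, (∏ k, w (d k)) * (f (d s) * f (d t)) =
      if s = t then ∑ a, w a * f a ^ 2 else 0 := by
  have h : ∀ d : Fin N → α, (∏ k, w (d k)) * (f (d s) * f (d t)) =
      ∏ k, w (d k) * ((if k = s then f (d k) else 1) * (if k = t then f (d k) else 1)) := by
    intro d
    rw [Finset.prod_mul_distrib, Finset.prod_mul_distrib]
    simp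
  simp only [h]
  rw [← Fintype.prod_sum (f := fun k a =>
    w a * ((if k = s then f a else 1) * (if k = t then f a else 1)))]
  split_ifs with hst
  · subst hst
    rw [← Finset.mul_prod_erase _ _ (Finset.mem_univ s), Finset.prod_eq_one, mul_one]
    · simp [sq]
    · intro k hk
      simp [Finset.ne_of_mem_erase hk, hw]
  · refine Finset.prod_eq_zero (Finset.mem_univ s) ?_
    simp [hst, hf]

lemma sum_prod_mul_sq {α : Type} [Fintype α] {N : ℕ} {w f : α → ℝ} (hw : ∑ a, w a = 1)
    (hf : ∑ a, w a * f a = 0) :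
    ∑ d : Fin N → α, (∏ k, w (d k)) * (∑ t, f (d t)) ^ 2 = N * ∑ a, w a * f a ^ 2 := by
  have hsq : ∀ d : Fin N → α, (∏ k, w (d k)) * (∑ t, f (d t)) ^ 2 =
      ∑ s, ∑ t, (∏ k, w (d k)) * (f (d s) * f (d t)) := by
    intro d
    rw [sq, Finset.sum_mul_sum]
    simp only [Finset.mul_sum]
  simp only [hsq]
  rw [Finset.sum_comm]
  have : ∀ s : Fin N, ∑ d : Fin N → α, ∑ t, (∏ k, w (d k)) * (f (d s) * f (d t)) =
      ∑ a, w a * f a ^ 2 := by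
    intro s
    rw [Finset.sum_comm]
    simp [sum_prod_mul_mul hw hf]
  simp [this]

/-- Chebyshev's inequality for the sum of independent copies of a centred variable. -/
lemma sum_indicator_le_of_centred {α : Type} [Fintype α] {N : ℕ} {w f : α → ℝ} (hw0 : ∀ a, 0 ≤ w a)
    (hw : ∑ a, w a = 1) (hf : ∑ a, w a * f a = 0) (hf1 : ∀ a, |f a| ≤ 1) {r : ℝ} (hr : 0 < r) :
    ∑ d : Fin N → α, {d : Fin N → α | r < |∑ t, f (d t)|}.indicator (fun d => ∏ k, w (d k)) d ≤
      N / r ^ 2 := by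
  have hvar : ∑ a, w a * f a ^ 2 ≤ 1 := by
    rw [← hw]
    refine Finset.sum_le_sum fun a _ => mul_le_of_le_one_right (hw0 a) ?_
    rw [← sq_abs]
    exact pow_le_one₀ (abs_nonneg _) (hf1 a)
  have h0 : ∀ d : Fin N → α, 0 ≤ ∏ k, w (d k) := fun d => Finset.prod_nonneg fun k _ => hw0 _
  calc ∑ d : Fin N → α, {d : Fin N → α | r < |∑ t, f (d t)|}.indicator (fun d => ∏ k, w (d k)) d
      ≤ ∑ d : Fin N → α, (∏ k, w (d k)) * (∑ t, f (d t)) ^ 2 / r ^ 2 := by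
        refine Finset.sum_le_sum fun d _ => ?_
        by_cases hd : r < |∑ t, f (d t)|
        · rw [Set.indicator_of_mem (by exact hd), le_div_iff₀ (by positivity)]
          refine mul_le_mul_of_nonneg_left ?_ (h0 d)
          rw [← sq_abs (∑ t, f (d t))]
          exact pow_le_pow_left₀ hr.le hd.le 2
        · rw [Set.indicator_of_notMem (by exact hd)]
          have := h0 d
          positivity
    _ ≤ N / r ^ 2 := by
        rw [← Finset.sum_div, sum_prod_mul_sq hw hf]
        gcongr
        exact mul_le_of_le_one_right (Nat.cast_nonneg N) hvar

/-! ## Data sets -/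

/-- The probability of a single sample. -/
def sampleWeight {n : ℕ} (q : Bits n → ℝ) (p : Bits n → Bits n → ℝ) (s : Bits n × Bits n) : ℝ :=
  q s.1 * p s.1 s.2

lemma datasetProb_eq {n N : ℕ} (q : Bits n → ℝ) (p : Bits n → Bits n → ℝ) (S : Set (Dataset n N)) :
    datasetProb q p S =
      ∑ d : Dataset n N, S.indicator (fun d => ∏ t, sampleWeight q p (d t)) d := rfl

lemma sampleWeight_nonneg {n : ℕ} {q : Bits n → ℝ} {p : Bits n → Bits n → ℝ} (hq : ∀ x, 0 ≤ q x)
    (hp : ∀ x y, 0 ≤ p x y) (s : Bits n × Bits n) : 0 ≤ sampleWeight q p s :=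
  mul_nonneg (hq _) (hp _ _)

lemma sum_sampleWeight {n : ℕ} {q : Bits n → ℝ} {p : Bits n → Bits n → ℝ} (hq : ∑ x, q x = 1)
    (hp : ∀ x, ∑ y, p x y = 1) : ∑ s, sampleWeight q p s = 1 := by
  simp [sampleWeight, Fintype.sum_prod_type, ← Finset.mul_sum, hp, hq]

lemma sum_prod_sampleWeight {n : ℕ} (N : ℕ) {q : Bits n → ℝ} {p : Bits n → Bits n → ℝ}
    (hq : ∑ x, q x = 1) (hp : ∀ x, ∑ y, p x y = 1) :
    ∑ d : Dataset n N, ∏ t, sampleWeight q p (d t) = 1 := by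
  rw [← Fintype.sum_pow, sum_sampleWeight hq hp, one_pow]

lemma datasetProb_mono {n N : ℕ} {q : Bits n → ℝ} {p : Bits n → Bits n → ℝ} (hq : ∀ x, 0 ≤ q x)
    (hp : ∀ x y, 0 ≤ p x y) {S T : Set (Dataset n N)} (h : S ⊆ T) :
    datasetProb q p S ≤ datasetProb q p T :=
  Finset.sum_le_sum fun d _ => Set.indicator_le_indicator_of_subset h
    (fun d => Finset.prod_nonneg fun t _ => sampleWeight_nonneg hq hp (d t)) d

/-- The union bound. -/
lemma one_sub_le_datasetProb {n N : ℕ} {ι : Type} [Fintype ι] {q : Bits n → ℝ}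
    {p : Bits n → Bits n → ℝ} (hq : IsDistribution q) (hp0 : ∀ x y, 0 ≤ p x y)
    (hp : ∀ x, ∑ y, p x y = 1) (S : Set (Dataset n N)) (T : ι → Set (Dataset n N))
    (h : ∀ d, (∀ i, d ∉ T i) → d ∈ S) :
    1 - ∑ i, datasetProb q p (T i) ≤ datasetProb q p S := by
  have h0 : ∀ d : Dataset n N, 0 ≤ ∏ t, sampleWeight q p (d t) :=
    fun d => Finset.prod_nonneg fun t _ => sampleWeight_nonneg hq.1 hp0 (d t)
  rw [sub_le_iff_le_add, ← sum_prod_sampleWeight N hq.2 hp]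
  simp only [datasetProb_eq]
  rw [Finset.sum_comm, ← Finset.sum_add_distrib]
  refine Finset.sum_le_sum fun d _ => ?_
  have hT : ∀ i, 0 ≤ (T i).indicator (fun d => ∏ t, sampleWeight q p (d t)) d :=
    fun i => Set.indicator_nonneg (fun d _ => h0 d) d
  by_cases hd : d ∈ S
  · rw [Set.indicator_of_mem hd]
    linarith [Finset.sum_nonneg fun i (_ : i ∈ Finset.univ) => hT i]
  · rw [Set.indicator_of_notMem hd, zero_add]
    have : ∃ i, d ∈ T i := by
      by_contra hc
      exact hd (h d (by simpa using hc))
    obtain ⟨i, hi⟩ := this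
    calc _ = (T i).indicator (fun d => ∏ t, sampleWeight q p (d t)) d := by
            rw [Set.indicator_of_mem hi]
      _ ≤ _ := Finset.single_le_sum (f := fun i =>
            (T i).indicator (fun d => ∏ t, sampleWeight q p (d t)) d) (fun i _ => hT i)
            (Finset.mem_univ i)

lemma isDistribution_uniformBits (n : ℕ) : IsDistribution (uniformBits n) := by
  refine ⟨fun _ => by unfold uniformBits; positivity, ?_⟩
  simp [uniformBits]

/-! ## The angle is a Hölder continuous function of its cosine -/

/-- For `β ≤ α`, the difference of cosines is `2 sin ((α + β) / 2) sin ((α - β) / 2)` in absolute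
value. Jordan's inequality bounds the second sine below by `(α - β) / π`, and the first is at least
the second, since `(α + β) / 2` is at least as far from both `0` and `π` as `(α - β) / 2` is from
`0`. -/
lemma abs_sub_sq_le_of_cos {α β : ℝ} (hα : α ∈ Set.Icc 0 Real.pi) (hβ : β ∈ Set.Icc 0 Real.pi) :
    (α - β) ^ 2 ≤ Real.pi ^ 2 / 2 * |Real.cos α - Real.cos β| := by
  wlog h : β ≤ α generalizing α β
  · have := this hβ hα (not_le.mp h).le
    rw [abs_sub_comm]
    linarith [this, sq (α - β), sq (β - α), mul_comm α β]
  have hpi := Real.pi_pos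
  obtain ⟨hα0, hα1⟩ := hα
  obtain ⟨hβ0, hβ1⟩ := hβ
  have h1 : 2 / Real.pi * ((α - β) / 2) ≤ Real.sin ((α - β) / 2) :=
    Real.mul_le_sin (by linarith) (by linarith)
  have h1' : (α - β) / Real.pi ≤ Real.sin ((α - β) / 2) := by
    refine le_trans (le_of_eq ?_) h1
    field_simp
  have h2 : Real.sin ((α - β) / 2) ≤ Real.sin ((α + β) / 2) := by
    rcases le_total ((α + β) / 2) (Real.pi / 2) with h' | h'
    · exact Real.sin_le_sin_of_le_of_le_pi_div_two (by linarith) h' (by linarith)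
    · rw [← Real.sin_pi_sub ((α + β) / 2)]
      exact Real.sin_le_sin_of_le_of_le_pi_div_two (by linarith) (by linarith) (by linarith)
  have h0 : 0 ≤ (α - β) / Real.pi := div_nonneg (by linarith) hpi.le
  have h3 : |Real.cos α - Real.cos β| = 2 * Real.sin ((α + β) / 2) * Real.sin ((α - β) / 2) := by
    rw [Real.cos_sub_cos, abs_of_nonpos]
    · ring
    · nlinarith
  have h4 : ((α - β) / Real.pi) ^ 2 ≤ Real.sin ((α + β) / 2) * Real.sin ((α - β) / 2) := by
    rw [sq]
    exact mul_le_mul (h1'.trans h2) h1' h0 (by linarith)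
  rw [h3]
  calc (α - β) ^ 2 = Real.pi ^ 2 * ((α - β) / Real.pi) ^ 2 := by field_simp
    _ ≤ Real.pi ^ 2 * (Real.sin ((α + β) / 2) * Real.sin ((α - β) / 2)) := by gcongr
    _ = _ := by ring

lemma pi_sq_lt_ten : Real.pi ^ 2 < 10 := by
  have := Real.pi_lt_d2
  nlinarith [Real.pi_pos]

/-! ## Learning the angles -/

open Classical in
/-- The indicator of the inputs that decouple site `i`. -/
def decoupleInd {n : ℕ} (G : SimpleGraph (Fin n)) (i : Fin n) (x : Bits n) : ℝ :=
  if Decouples G i x then 1 else 0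

/-- The probability that a uniformly random input decouples site `i`. -/
def decoupleProb {n : ℕ} (G : SimpleGraph (Fin n)) (i : Fin n) : ℝ :=
  ∑ x, uniformBits n x * decoupleInd G i x

lemma decoupleInd_mem {n : ℕ} (G : SimpleGraph (Fin n)) (i : Fin n) (x : Bits n) :
    0 ≤ decoupleInd G i x ∧ decoupleInd G i x ≤ 1 := by
  unfold decoupleInd
  split_ifs <;> norm_num

lemma decoupleProb_mem {n : ℕ} (G : SimpleGraph (Fin n)) (i : Fin n) :
    0 ≤ decoupleProb G i ∧ decoupleProb G i ≤ 1 := by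
  have hu := isDistribution_uniformBits n
  constructor
  · exact Finset.sum_nonneg fun x _ => mul_nonneg (hu.1 x) (decoupleInd_mem G i x).1
  · rw [← hu.2]
    exact Finset.sum_le_sum fun x _ => mul_le_of_le_one_right (hu.1 x) (decoupleInd_mem G i x).2

/-- The bits of a uniform input are independent, and only those at `i` and its at most `Δ`
neighbours are constrained, each with probability `1 / 2`. -/
lemma le_decoupleProb {n Δ : ℕ} {G : SimpleGraph (Fin n)} (hG : DegreeLE G Δ) (i : Fin n) :
    (1 / 2) ^ (Δ + 1) ≤ decoupleProb G i := by
  classical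
  set g : Fin n → Bool → ℝ := fun k c =>
    if k = i then (if c then 0 else 1) else if G.Adj i k then (if c then 1 else 0) else 1 with hg
  have h1 : ∀ x : Bits n, uniformBits n x * decoupleInd G i x = ∏ k, (1 / 2 * g k (x k)) := by
    intro x
    rw [Finset.prod_mul_distrib]
    congr 1
    · simp [uniformBits]
    · unfold decoupleInd
      split_ifs with h
      · refine (Finset.prod_eq_one fun k _ => ?_).symm
        simp only [hg]
        split_ifs with h1 h2 h3 h4 <;> first | rfl | skip
        · subst h1; simp [h.1] at h2
        · exact absurd (h.2 k h3) h4
      · rw [Decouples, not_and_or] at h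
        rcases h with h | h
        · refine (Finset.prod_eq_zero (Finset.mem_univ i) ?_).symm
          simpa [hg] using h
        · push Not at h
          obtain ⟨j, hj, hx⟩ := h
          refine (Finset.prod_eq_zero (Finset.mem_univ j) ?_).symm
          simp [hg, hj, hj.ne', hx]
  have h2 : decoupleProb G i = ∏ k, (if k = i ∨ G.Adj i k then (1 / 2 : ℝ) else 1) := by
    unfold decoupleProb
    simp only [h1]
    rw [← Fintype.prod_sum (f := fun k c => 1 / 2 * g k c)]
    refine Finset.prod_congr rfl fun k _ => ?_
    rw [Fintype.sum_bool]
    simp only [hg]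
    by_cases hk : k = i
    · simp [hk]
    · by_cases ha : G.Adj i k <;> simp [hk, ha]; norm_num
  rw [h2, Finset.prod_ite, Finset.prod_const_one, mul_one, Finset.prod_const]
  refine pow_le_pow_of_le_one (by norm_num) (by norm_num) ?_
  have h3 : Finset.univ.filter (fun k => k = i ∨ G.Adj i k) ⊆
      insert i (Finset.univ.filter fun k => G.Adj i k) := by
    intro k
    simp
  refine (Finset.card_le_card h3).trans ((Finset.card_insert_le _ _).trans ?_)
  have h4 := hG i
  rw [Set.ncard_eq_toFinset_card'] at h4
  have h5 : (Finset.univ.filter fun k => G.Adj i k) = (G.neighborSet i).toFinset := by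
    ext; simp
  rw [h5]
  omega

/-- The deviation of the output bit at site `i` from its mean, for inputs that decouple `i`. -/
def bitDeviation {n : ℕ} (G : SimpleGraph (Fin n)) (θ : Fin n → ℝ) (i : Fin n)
    (s : Bits n × Bits n) : ℝ :=
  decoupleInd G i s.1 * ((if s.2 i then 1 else 0) - (1 - Real.cos (θ i)) / 2)

/-- The deviation of the indicator of the decoupling inputs from its mean. -/
def decoupleDeviation {n : ℕ} (G : SimpleGraph (Fin n)) (i : Fin n) (s : Bits n × Bits n) : ℝ :=
  decoupleInd G i s.1 - decoupleProb G i

/-- The sum over `y` already vanishes for each fixed `x`: by `idqnn_decoupled` if `x` decouples `i`,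
and because of the indicator otherwise. -/
lemma sum_bitDeviation {n : ℕ} (G : SimpleGraph (Fin n)) (θ : Fin n → ℝ) (i : Fin n) :
    ∑ s, sampleWeight (uniformBits n) (idqnn G θ) s * bitDeviation G θ i s = 0 := by
  rw [Fintype.sum_prod_type]
  refine Finset.sum_eq_zero fun x _ => ?_
  by_cases hx : Decouples G i x
  · have h : ∀ y, sampleWeight (uniformBits n) (idqnn G θ) (x, y) * bitDeviation G θ i (x, y) =
        uniformBits n x * ((if y i then idqnn G θ x y else 0) -
          idqnn G θ x y * ((1 - Real.cos (θ i)) / 2)) := by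
      intro y
      simp only [sampleWeight, bitDeviation, decoupleInd, if_pos hx]
      split_ifs <;> ring
    simp only [h]
    rw [← Finset.mul_sum, Finset.sum_sub_distrib, ← Finset.sum_mul, sum_idqnn,
      idqnn_decoupled G θ i x hx]
    ring
  · simp [bitDeviation, decoupleInd, hx]

lemma sum_decoupleDeviation {n : ℕ} (G : SimpleGraph (Fin n)) (θ : Fin n → ℝ) (i : Fin n) :
    ∑ s, sampleWeight (uniformBits n) (idqnn G θ) s * decoupleDeviation G i s = 0 := by
  simp only [decoupleDeviation, mul_sub, Finset.sum_sub_distrib, ← Finset.sum_mul]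
  rw [sum_sampleWeight (isDistribution_uniformBits n).2 (sum_idqnn G θ), one_mul, decoupleProb,
    Fintype.sum_prod_type, sub_eq_zero]
  refine Finset.sum_congr rfl fun x _ => ?_
  simp only [sampleWeight]
  rw [← Finset.sum_mul, ← Finset.mul_sum, sum_idqnn, mul_one]

lemma abs_bitDeviation_le {n : ℕ} (G : SimpleGraph (Fin n)) (θ : Fin n → ℝ) (i : Fin n)
    (s : Bits n × Bits n) : |bitDeviation G θ i s| ≤ 1 := by
  have h1 := Real.cos_le_one (θ i)
  have h2 := Real.neg_one_le_cos (θ i)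
  have h3 := decoupleInd_mem G i s.1
  rw [bitDeviation, abs_mul, abs_of_nonneg h3.1]
  refine mul_le_one₀ h3.2 (abs_nonneg _) ?_
  rw [abs_le]
  split_ifs <;> constructor <;> linarith

lemma abs_decoupleDeviation_le {n : ℕ} (G : SimpleGraph (Fin n)) (i : Fin n)
    (s : Bits n × Bits n) : |decoupleDeviation G i s| ≤ 1 := by
  have h3 := decoupleInd_mem G i s.1
  have h4 := decoupleProb_mem G i
  rw [decoupleDeviation, abs_le]
  constructor <;> linarith

open Classical in
/-- The number of samples whose input decouples site `i`. -/
def decoupledCount {n N : ℕ} (G : SimpleGraph (Fin n)) (d : Dataset n N) (i : Fin n) : ℕ :=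
  (Finset.univ.filter (fun t => Decouples G i (d t).1)).card

open Classical in
/-- The number of samples whose input decouples site `i` and whose output bit at `i` is `1`. -/
def decoupledOnes {n N : ℕ} (G : SimpleGraph (Fin n)) (d : Dataset n N) (i : Fin n) : ℕ :=
  ∑ t ∈ Finset.univ.filter (fun t => Decouples G i (d t).1), if (d t).2 i then 1 else 0

lemma angleEstimate_eq {n N : ℕ} (G : SimpleGraph (Fin n)) (d : Dataset n N) (i : Fin n) :
    angleEstimate G d i =
      Real.arccos (1 - 2 * ((decoupledOnes G d i : ℝ) / (decoupledCount G d i : ℝ))) := by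
  simp [angleEstimate, decoupledOnes, decoupledCount]

lemma decoupledOnes_le {n N : ℕ} (G : SimpleGraph (Fin n)) (d : Dataset n N) (i : Fin n) :
    decoupledOnes G d i ≤ decoupledCount G d i := by
  rw [decoupledOnes, decoupledCount, Finset.card_eq_sum_ones]
  exact Finset.sum_le_sum fun t _ => by split_ifs <;> simp

lemma sum_decoupleDeviation_dataset {n N : ℕ} (G : SimpleGraph (Fin n)) (d : Dataset n N)
    (i : Fin n) :
    ∑ t, decoupleDeviation G i (d t) = decoupledCount G d i - N * decoupleProb G i := by
  classical
  simp [decoupleDeviation, decoupleInd, Finset.sum_sub_distrib, decoupledCount]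

lemma sum_bitDeviation_dataset {n N : ℕ} (G : SimpleGraph (Fin n)) (θ : Fin n → ℝ)
    (d : Dataset n N) (i : Fin n) :
    ∑ t, bitDeviation G θ i (d t) =
      decoupledOnes G d i - decoupledCount G d i * ((1 - Real.cos (θ i)) / 2) := by
  classical
  simp only [bitDeviation, mul_sub, Finset.sum_sub_distrib, ← Finset.sum_mul]
  congr 1
  · rw [decoupledOnes, Finset.sum_filter]
    push_cast
    refine Finset.sum_congr rfl fun t _ => ?_
    unfold decoupleInd
    split_ifs <;> simp
  · congr 1
    simp [decoupleInd, decoupledCount]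

/-- If the deviations are small, the estimate is accurate, and it is based on at least one sample. -/
lemma estimate_accurate {n N a Δ : ℕ} (ha : 1 ≤ a) (hN : 0 < N) {G : SimpleGraph (Fin n)}
    (hG : DegreeLE G Δ) {θ : Fin n → ℝ} (hθ : AnglesInRange θ) (d : Dataset n N) (i : Fin n)
    (h1 : |∑ t, bitDeviation G θ i (d t)| ≤ 1 / (10 * a ^ 2) * ((1 / 2) ^ (Δ + 1) * N / 2))
    (h2 : |∑ t, decoupleDeviation G i (d t)| ≤ (1 / 2) ^ (Δ + 1) * N / 2) :
    |angleEstimate G d i - θ i| ≤ 1 / (a : ℝ) ∧ 0 < decoupledCount G d i := by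
  have hc := le_decoupleProb hG i
  have ha' : (0 : ℝ) < a := by exact_mod_cast ha
  have hN' : (0 : ℝ) < N := by exact_mod_cast hN
  rw [sum_decoupleDeviation_dataset] at h2
  rw [sum_bitDeviation_dataset] at h1
  set c : ℝ := (1 / 2) ^ (Δ + 1) with hcdef
  have hc0 : 0 < c := by positivity
  set m : ℝ := (decoupledCount G d i : ℝ) with hm
  set k : ℝ := (decoupledOnes G d i : ℝ) with hk
  -- At least `c N` decoupling samples are expected, and the deviation is at most half of that.
  have hm1 : c * N / 2 ≤ m := by
    have := (abs_le.mp h2).1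
    nlinarith
  have hm0 : 0 < m := lt_of_lt_of_le (by positivity) hm1
  refine ⟨?_, Nat.cast_pos.mp hm0⟩
  have hkm : k ≤ m := Nat.cast_le.mpr (decoupledOnes_le G d i)
  have hk0 : 0 ≤ k := Nat.cast_nonneg _
  rw [angleEstimate_eq]
  have h3 : |k / m - (1 - Real.cos (θ i)) / 2| ≤ 1 / (10 * a ^ 2) := by
    have : k / m - (1 - Real.cos (θ i)) / 2 = (k - m * ((1 - Real.cos (θ i)) / 2)) / m := by
      field_simp
    rw [this, abs_div, abs_of_pos hm0, div_le_iff₀ hm0]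
    exact h1.trans (mul_le_mul_of_nonneg_left hm1 (by positivity))
  have hr1 : k / m ≤ 1 := (div_le_one hm0).mpr hkm
  have hr0 : 0 ≤ k / m := by positivity
  have h4 := abs_sub_sq_le_of_cos (α := Real.arccos (1 - 2 * (k / m)))
    ⟨Real.arccos_nonneg _, Real.arccos_le_pi _⟩ (hθ i)
  rw [Real.cos_arccos (by linarith) (by linarith)] at h4
  have h5 : |1 - 2 * (k / m) - Real.cos (θ i)| ≤ 2 * (1 / (10 * a ^ 2)) := by
    rw [abs_le] at h3 ⊢
    constructor <;> linarith [h3.1, h3.2]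
  have h6 : (Real.arccos (1 - 2 * (k / m)) - θ i) ^ 2 ≤ (1 / (a : ℝ)) ^ 2 := by
    refine h4.trans ?_
    -- The accuracy `1 / (10 a ^ 2)` of the mean was chosen so that `π ^ 2 < 10` is enough here.
    calc Real.pi ^ 2 / 2 * |1 - 2 * (k / m) - Real.cos (θ i)|
        ≤ 10 / 2 * (2 * (1 / (10 * a ^ 2))) := by
          gcongr
          exact pi_sq_lt_ten.le
      _ = (1 / (a : ℝ)) ^ 2 := by field_simp
  exact abs_le_of_sq_le_sq h6 (by positivity)

/-- The left side is what the union bound demands, with `404 = 4 * (100 + 1)` from the two variances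
and `4 ^ (Δ + 1)` from the squared decoupling probability. As `n + a + b ≥ 3`, the estimates `404 ≤
3 ^ 6` and `4 ≤ 9` absorb all constants into powers of `n + a + b`. -/
lemma sampleBound {n a b Δ N : ℕ} (hn : 1 ≤ n) (ha : 1 ≤ a) (hb : 1 ≤ b)
    (hN : (n + a + b) ^ (2 * Δ + 14) ≤ N) :
    404 * 4 ^ (Δ + 1) * (n * b * a ^ 4) ≤ N := by
  set s := n + a + b with hs
  have h3 : 3 ≤ s := by omega
  refine le_trans ?_ hN
  calc 404 * 4 ^ (Δ + 1) * (n * b * a ^ 4) ≤ 3 ^ 6 * 9 ^ (Δ + 1) * (s * s * s ^ 4) := by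
        gcongr <;> omega
    _ = 3 ^ (2 * Δ + 8) * s ^ 6 := by
        rw [show (9 : ℕ) = 3 ^ 2 by norm_num, ← pow_mul, ← pow_add]; ring_nf
    _ ≤ s ^ (2 * Δ + 8) * s ^ 6 := by gcongr
    _ = s ^ (2 * Δ + 14) := by rw [← pow_add]

/-- With polynomially many samples, all estimates are accurate and based on at least one sample. -/
theorem estimates_accurate_prob {n a b N Δ : ℕ} (hn : 1 ≤ n) (ha : 1 ≤ a) (hb : 1 ≤ b)
    (hN : (n + a + b) ^ (2 * Δ + 14) ≤ N) {G : SimpleGraph (Fin n)} (hG : DegreeLE G Δ)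
    {θ : Fin n → ℝ} (hθ : AnglesInRange θ) :
    1 - 1 / (b : ℝ) ≤ datasetProb (uniformBits n) (idqnn G θ)
      {d : Dataset n N | ∀ i, |angleEstimate G d i - θ i| ≤ 1 / (a : ℝ) ∧
        0 < decoupledCount G d i} := by
  have hN0 : 0 < N := lt_of_lt_of_le (by positivity) hN
  have hN0' : (0 : ℝ) < N := by exact_mod_cast hN0
  have ha' : (1 : ℝ) ≤ a := by exact_mod_cast ha
  have hb' : (1 : ℝ) ≤ b := by exact_mod_cast hb
  have hn' : (1 : ℝ) ≤ n := by exact_mod_cast hn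
  set c : ℝ := (1 / 2) ^ (Δ + 1) with hc
  have hc0 : 0 < c := by positivity
  set r₁ : ℝ := 1 / (10 * a ^ 2) * (c * N / 2) with hr₁
  set r₂ : ℝ := c * N / 2 with hr₂
  have hr₁0 : 0 < r₁ := by positivity
  have hr₂0 : 0 < r₂ := by positivity
  have hw0 := sampleWeight_nonneg (isDistribution_uniformBits n).1 (idqnn_nonneg G θ)
  have hw1 := sum_sampleWeight (isDistribution_uniformBits n).2 (sum_idqnn G θ)
  -- The bad events: at some site the output bits deviate too much, or the number of decoupling
  -- samples does.
  let T : Fin n ⊕ Fin n → Set (Dataset n N) := Sum.elim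
    (fun i => {d | r₁ < |∑ t, bitDeviation G θ i (d t)|})
    (fun i => {d | r₂ < |∑ t, decoupleDeviation G i (d t)|})
  have hT1 : ∀ i, datasetProb (uniformBits n) (idqnn G θ) (T (Sum.inl i)) ≤ N / r₁ ^ 2 := fun i =>
    sum_indicator_le_of_centred hw0 hw1 (sum_bitDeviation G θ i) (abs_bitDeviation_le G θ i) hr₁0
  have hT2 : ∀ i, datasetProb (uniformBits n) (idqnn G θ) (T (Sum.inr i)) ≤ N / r₂ ^ 2 := fun i =>
    sum_indicator_le_of_centred hw0 hw1 (sum_decoupleDeviation G θ i)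
      (abs_decoupleDeviation_le G i) hr₂0
  refine le_trans ?_ (one_sub_le_datasetProb (isDistribution_uniformBits n) (idqnn_nonneg G θ)
    (sum_idqnn G θ) _ T fun d hd i => estimate_accurate ha hN0 hG hθ d i
      (not_lt.mp (hd (Sum.inl i))) (not_lt.mp (hd (Sum.inr i))))
  refine sub_le_sub_left ?_ 1
  calc ∑ i, datasetProb (uniformBits n) (idqnn G θ) (T i)
      ≤ ∑ _i : Fin n, (N / r₁ ^ 2 : ℝ) + ∑ _i : Fin n, (N / r₂ ^ 2 : ℝ) := by
        rw [Fintype.sum_sum_type]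
        exact add_le_add (Finset.sum_le_sum fun i _ => hT1 i) (Finset.sum_le_sum fun i _ => hT2 i)
    _ = n * (4 * (100 * a ^ 4 + 1) / (c ^ 2 * N)) := by
        simp only [Finset.sum_const, Finset.card_univ, Fintype.card_fin, nsmul_eq_mul, hr₁, hr₂]
        field_simp
        ring
    _ ≤ 1 / b := by
        have h404 : (404 : ℝ) * 4 ^ (Δ + 1) * (n * b * a ^ 4) ≤ N := by
          exact_mod_cast sampleBound hn ha hb hN
        have hc2 : c ^ 2 * 4 ^ (Δ + 1) = 1 := by
          rw [hc, ← pow_mul, mul_comm (Δ + 1) 2, pow_mul, ← mul_pow]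
          norm_num
        have h1 : (404 : ℝ) * (n * b * a ^ 4) ≤ c ^ 2 * N := by
          calc (404 : ℝ) * (n * b * a ^ 4) = c ^ 2 * (404 * 4 ^ (Δ + 1) * (n * b * a ^ 4)) := by
                linear_combination -(404 * (n * b * a ^ 4) : ℝ) * hc2
            _ ≤ c ^ 2 * N := by gcongr
        have ha4 : (1 : ℝ) ≤ (a : ℝ) ^ 4 := one_le_pow₀ ha'
        rw [← mul_div_assoc, div_le_div_iff₀ (by positivity) (by linarith)]
        calc (n : ℝ) * (4 * (100 * a ^ 4 + 1)) * b
              ≤ (n : ℝ) * (4 * (100 * a ^ 4 + a ^ 4)) * b := by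
              gcongr
          _ = (404 : ℝ) * (n * b * a ^ 4) := by ring
          _ ≤ 1 * (c ^ 2 * N) := by linarith

theorem angleEstimate_prob {n a b N Δ : ℕ} (hn : 1 ≤ n) (ha : 1 ≤ a) (hb : 1 ≤ b)
    (hN : (n + a + b) ^ (2 * Δ + 14) ≤ N) {G : SimpleGraph (Fin n)} (hG : DegreeLE G Δ)
    {θ : Fin n → ℝ} (hθ : AnglesInRange θ) :
    1 - 1 / (b : ℝ) ≤ datasetProb (uniformBits n) (idqnn G θ)
      {d : Dataset n N | ∀ i, |angleEstimate G d i - θ i| ≤ 1 / (a : ℝ)} :=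
  (estimates_accurate_prob hn ha hb hN hG hθ).trans
    (datasetProb_mono (isDistribution_uniformBits n).1 (idqnn_nonneg G θ) fun _ hd i => (hd i).1)

/-! ## Dependence of the output distribution on the angles -/

/-- Exchange the factors one at a time; the remaining ones have modulus one. -/
lemma norm_prod_sub_prod_le_sum {ι : Type} (s : Finset ι) (f g : ι → ℂ) (hf : ∀ i, ‖f i‖ = 1)
    (hg : ∀ i, ‖g i‖ = 1) : ‖∏ i ∈ s, f i - ∏ i ∈ s, g i‖ ≤ ∑ i ∈ s, ‖f i - g i‖ := by
  classical
  induction s using Finset.induction_on with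
  | empty => simp
  | insert a s ha ih =>
    rw [Finset.prod_insert ha, Finset.prod_insert ha, Finset.sum_insert ha]
    have h : f a * ∏ i ∈ s, f i - g a * ∏ i ∈ s, g i =
        (f a - g a) * ∏ i ∈ s, f i + g a * (∏ i ∈ s, f i - ∏ i ∈ s, g i) := by ring
    rw [h]
    refine (norm_add_le _ _).trans ?_
    rw [norm_mul, norm_mul, hg, norm_prod, Finset.prod_eq_one fun i _ => hf i, mul_one, one_mul]
    exact add_le_add le_rfl ih

lemma norm_rzPhase_sub_le (θ θ' : ℝ) (b : Bool) :
    ‖rzPhase θ b - rzPhase θ' b‖ ≤ |θ - θ'| / 2 := by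
  have h : rzPhase θ b - rzPhase θ' b = rzPhase θ' b *
      (Complex.exp (Complex.I * (((if b then 1 else -1) * ((θ - θ') / 2) : ℝ) : ℂ)) - 1) := by
    rw [rzPhase_eq_exp, rzPhase_eq_exp, mul_sub, mul_one, ← Complex.exp_add]
    congr 2
    push_cast
    ring
  rw [h, norm_mul, norm_rzPhase, one_mul]
  refine Real.norm_exp_I_mul_ofReal_sub_one_le.trans (le_of_eq ?_)
  rw [Real.norm_eq_abs, abs_mul, abs_div]
  cases b <;> simp

/-- Close unit vectors have close measurement distributions. -/
lemma tvDist_norm_sq_le {ι : Type} [Fintype ι] {v w : ι → ℂ} (hv : ∑ b, ‖v b‖ ^ 2 = 1)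
    (hw : ∑ b, ‖w b‖ ^ 2 = 1) :
    tvDist (fun b => ‖v b‖ ^ 2) (fun b => ‖w b‖ ^ 2) ≤ √(∑ b, ‖v b - w b‖ ^ 2) := by
  -- A difference of squares, to be summed by Cauchy–Schwarz; the second factor has `ℓ²` norm at
  -- most 2 for unit vectors.
  have h1 : ∀ b, |‖v b‖ ^ 2 - ‖w b‖ ^ 2| ≤ ‖v b - w b‖ * (‖v b‖ + ‖w b‖) := by
    intro b
    have : ‖v b‖ ^ 2 - ‖w b‖ ^ 2 = (‖v b‖ - ‖w b‖) * (‖v b‖ + ‖w b‖) := by ring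
    rw [this, abs_mul, abs_of_nonneg (by positivity : 0 ≤ ‖v b‖ + ‖w b‖)]
    exact mul_le_mul_of_nonneg_right (abs_norm_sub_norm_le _ _) (by positivity)
  have h2 : √(∑ b, (‖v b‖ + ‖w b‖) ^ 2) ≤ 2 := by
    rw [Real.sqrt_le_left (by norm_num)]
    calc ∑ b, (‖v b‖ + ‖w b‖) ^ 2 ≤ ∑ b, (2 * ‖v b‖ ^ 2 + 2 * ‖w b‖ ^ 2) :=
          Finset.sum_le_sum fun b _ => by nlinarith [sq_nonneg (‖v b‖ - ‖w b‖)]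
      _ = 2 ^ 2 := by
          rw [Finset.sum_add_distrib, ← Finset.mul_sum, ← Finset.mul_sum, hv, hw]; norm_num
  have h3 := Real.sum_mul_le_sqrt_mul_sqrt Finset.univ (fun b => ‖v b - w b‖)
    (fun b => ‖v b‖ + ‖w b‖)
  unfold tvDist
  calc 1 / 2 * ∑ b, |‖v b‖ ^ 2 - ‖w b‖ ^ 2|
      ≤ 1 / 2 * (√(∑ b, ‖v b - w b‖ ^ 2) * 2) := by
        refine mul_le_mul_of_nonneg_left ?_ (by norm_num)
        exact (Finset.sum_le_sum fun b _ => h1 b).trans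
          (h3.trans (mul_le_mul_of_nonneg_left h2 (Real.sqrt_nonneg _)))
    _ = _ := by ring

/-- The Hadamard layer is an isometry and the `CZ` signs have modulus one, so the distance of the
final states is governed by the difference of two products of phases, each factor of which is
Lipschitz in its angle with constant `1 / 2`. -/
lemma tvDist_idqnn_le {n : ℕ} (G : SimpleGraph (Fin n)) (θ θ' : Fin n → ℝ) (x : Bits n) :
    tvDist (idqnn G θ x) (idqnn G θ' x) ≤ ∑ i, |θ i - θ' i| / 2 := by
  set ε := ∑ i, |θ i - θ' i| / 2 with hε
  have hε0 : 0 ≤ ε := Finset.sum_nonneg fun i _ => by positivity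
  refine (tvDist_norm_sq_le (sum_idqnn G θ x) (sum_idqnn G θ' x)).trans ?_
  rw [Real.sqrt_le_left hε0]
  have h1 : ∀ y, (hLayer n *ᵥ (czLayer G *ᵥ (rzLayer θ *ᵥ inputState x))) y -
      (hLayer n *ᵥ (czLayer G *ᵥ (rzLayer θ' *ᵥ inputState x))) y =
      (hLayer n *ᵥ (graphState G θ x - graphState G θ' x)) y := by
    intro y
    rw [Matrix.mulVec_sub]; rfl
  simp only [h1, sum_norm_sq_hLayer]
  calc ∑ b, ‖(graphState G θ x - graphState G θ' x) b‖ ^ 2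
      ≤ ∑ b, ε ^ 2 * ‖inputState x b‖ ^ 2 := by
        refine Finset.sum_le_sum fun b _ => ?_
        rw [Pi.sub_apply, graphState_apply, graphState_apply, ← mul_sub, ← sub_mul, norm_mul,
          norm_czSign, one_mul, norm_mul, mul_pow]
        refine mul_le_mul_of_nonneg_right ?_ (by positivity)
        refine pow_le_pow_left₀ (norm_nonneg _) ?_ 2
        exact (norm_prod_sub_prod_le_sum _ _ _ (fun i => norm_rzPhase _ _)
          fun i => norm_rzPhase _ _).trans
          (Finset.sum_le_sum fun i _ => norm_rzPhase_sub_le _ _ _)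
    _ = ε ^ 2 := by rw [← Finset.mul_sum, sum_norm_sq_inputState, mul_one]

/-! ## Operators of lists of gates -/

lemma runOps_eq_prod {n : ℕ} (l : List (QMat n)) : runOps l = l.reverse.prod := by
  induction l using List.reverseRecOn with
  | nil => rfl
  | append_singleton l g ih =>
    rw [runOps, List.foldl_append, List.foldl_cons, List.foldl_nil, List.reverse_append]
    change g * runOps l = _
    rw [ih]; simp

lemma runOps_append {n : ℕ} (l l' : List (QMat n)) : runOps (l ++ l') = runOps l' * runOps l := by
  simp [runOps_eq_prod]

lemma runOps_singleton {n : ℕ} (g : QMat n) : runOps [g] = g := by simp [runOps_eq_prod]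

lemma runOps_flatMap_diagonal {n : ℕ} (k : ℕ) (h : ℕ → List (QMat n)) (f : ℕ → Bits n → ℂ)
    (hf : ∀ i < k, runOps (h i) = Matrix.diagonal (f i)) :
    runOps ((List.range k).flatMap h) = Matrix.diagonal fun b => ∏ i ∈ Finset.range k, f i b := by
  induction k with
  | zero => simp [runOps]
  | succ k ih =>
    rw [List.range_succ, List.flatMap_append, runOps_append, ih fun i hi => hf i (by omega)]
    simp only [List.flatMap_cons, List.flatMap_nil, List.append_nil]
    rw [hf k (by omega), Matrix.diagonal_mul_diagonal]
    congr 1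
    ext b
    rw [Finset.prod_range_succ, mul_comm]

lemma onQubit_eq_tensorMat {n : ℕ} (i : Fin n) (U : Matrix Bool Bool ℂ) :
    onQubit i U = tensorMat fun k => if k = i then U else 1 := by
  ext b c
  simp only [onQubit, tensorMat, Matrix.of_apply]
  rw [← Finset.mul_prod_erase _ _ (Finset.mem_univ i), if_pos rfl]
  split_ifs with h
  · rw [Finset.prod_eq_one, mul_one]
    intro k hk
    have hk := Finset.ne_of_mem_erase hk
    rw [if_neg hk, h k hk, Matrix.one_apply_eq]
  · push Not at h
    obtain ⟨k, hk, hbc⟩ := h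
    rw [Finset.prod_eq_zero (Finset.mem_erase.mpr ⟨hk, Finset.mem_univ k⟩), mul_zero]
    simp [hk, hbc]

lemma onQubit_one {n : ℕ} (i : Fin n) : onQubit i (1 : Matrix Bool Bool ℂ) = 1 := by
  rw [onQubit_eq_tensorMat]
  simpa using tensorMat_one n

lemma runOps_onQubit {n : ℕ} (U : Fin n → Matrix Bool Bool ℂ) (g : ℕ → QMat n)
    (hg : ∀ i : Fin n, g i = onQubit i (U i)) :
    runOps ((List.range n).map g) = tensorMat U := by
  -- The gates act on different qubits, so after `k` gates exactly the first `k` tensor factors are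
  -- in place.
  have h : ∀ k ≤ n, runOps ((List.range k).map g) = tensorMat fun j => if j < k then U j else 1 := by
    intro k
    induction k with
    | zero =>
      intro _
      simpa [runOps] using (tensorMat_one n).symm
    | succ k ih =>
      intro hk
      rw [List.range_succ, List.map_append, runOps_append, ih (by omega), List.map_singleton,
        runOps_singleton, hg ⟨k, hk⟩, onQubit_eq_tensorMat, tensorMat_mul]
      congr 1
      funext j
      rcases lt_trichotomy (j : ℕ) k with hj | hj | hj
      · have h1 : j ≠ ⟨k, hk⟩ := fun h => by simp [h] at hj
        simp [h1, hj, hj.trans (Nat.lt_succ_self k)]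
      · have h1 : j = ⟨k, hk⟩ := Fin.ext hj
        subst h1
        simp
      · have h1 : j ≠ ⟨k, hk⟩ := fun h => by simp [h] at hj
        have h2 : ¬ (j : ℕ) < k + 1 := by omega
        have h3 : ¬ (j : ℕ) < k := by omega
        simp [h1, h2, h3]
  rw [h n le_rfl]
  congr 1
  funext j
  simp

lemma tensorMat_rzGate {n : ℕ} (θ : Fin n → ℝ) :
    tensorMat (fun i => rzGate (θ i)) = rzLayer θ := by
  ext b c
  simp only [tensorMat, rzGate, rzLayer, Matrix.of_apply, Matrix.diagonal_apply]
  split_ifs with h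
  · subst h; simp
  · obtain ⟨i, hi⟩ := Function.ne_iff.mp h
    exact Finset.prod_eq_zero (Finset.mem_univ i) (by simp [hi])

lemma onQubits_czGate {n : ℕ} {i j : Fin n} :
    onQubits i j czGate = Matrix.diagonal fun b => if b i && b j then -1 else 1 := by
  ext b c
  simp only [onQubits, czGate, Matrix.of_apply, Matrix.diagonal_apply]
  by_cases hbc : b = c
  · subst hbc; simp
  · rw [if_neg hbc]
    split_ifs with h1 h2 <;> try rfl
    all_goals
      exfalso
      apply hbc
      funext k
      simp only [Prod.mk.injEq] at h2
      by_cases hi : k = i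
      · rw [hi, h2.1]
      · by_cases hj : k = j
        · rw [hj, h2.2]
        · exact h1 k hi hj

lemma tensorMat_mulVec_zero {n : ℕ} (x : Bits n) :
    tensorMat (fun i => if x i then 1 else hadamard) *ᵥ Pi.single (zeroBits n) 1 =
      inputState x := by
  ext b
  rw [Matrix.mulVec_single_one]
  simp only [tensorMat, inputState, zeroBits, Matrix.col_apply, Matrix.of_apply]
  refine Finset.prod_congr rfl fun i _ => ?_
  cases x i <;> cases b i <;> simp [hadamard]

/-! ## Descriptions of circuits -/

lemma describedGates_flatMap {n : ℕ} (L : List ℕ) (k q u v : ℕ → ℕ) (rest : List ℕ) :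
    describedGates n (L.flatMap (fun i => [k i, q i, u i, v i]) ++ rest) =
      L.map (fun i => describedGate n (k i) (q i) (u i) (v i)) ++ describedGates n rest := by
  induction L with
  | nil => rfl
  | cons i L ih =>
    simp only [List.flatMap_cons, List.map_cons, List.cons_append, List.nil_append, describedGates,
      ih]

lemma describedGates_flatMap_flatMap {n : ℕ} (L L' : List ℕ) (k q u v : ℕ → ℕ → ℕ)
    (rest : List ℕ) :
    describedGates n (L.flatMap (fun i => L'.flatMap fun j => [k i j, q i j, u i j, v i j]) ++ rest) =
      L.flatMap (fun i => L'.map fun j => describedGate n (k i j) (q i j) (u i j) (v i j)) ++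
        describedGates n rest := by
  induction L with
  | nil => rfl
  | cons i L ih =>
    simp only [List.flatMap_cons, List.append_assoc, describedGates_flatMap, ih]

/-- The rotations, controlled-`Z` gates and final Hadamard gates of the network with adjacency
matrix `e` and angles `π * A i / v i`. Gates that are absent are represented by gates on a qubit
out of range. -/
def modelDesc (n : ℕ) (e : ℕ → ℕ → ℕ) (A v : ℕ → ℕ) : List ℕ :=
  (List.range n).flatMap (fun i => [2, i, A i, v i]) ++
    ((List.range n).flatMap (fun i => (List.range n).flatMap fun j =>
      [1, i + n * (1 - e i j * (1 - (1 - (j - i)))), j, 0]) ++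
    (List.range n).flatMap (fun i => [0, i, 0, 0]))

/-- Hadamard gates on the qubits where `x` vanishes, followed by the gates of the model. -/
def circuitDesc (n : ℕ) (x : ℕ → ℕ) (model : List ℕ) : List ℕ :=
  (List.range n).flatMap (fun i => [0, i + n * x i, 0, 0]) ++ model

/-- With truncated subtraction, `1 - (1 - (j - i))` is the indicator of `i < j`. So the first qubit
number is `i` for an edge with `i < j`, and `i + n`, which is out of range and means the identity,
for all other pairs. -/
lemma runOps_czGates {n : ℕ} (G : SimpleGraph (Fin n)) (e : ℕ → ℕ → ℕ)
    (he1 : ∀ i j : Fin n, G.Adj i j → e i j = 1) (he0 : ∀ i j : Fin n, ¬ G.Adj i j → e i j = 0) :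
    runOps ((List.range n).flatMap fun i => (List.range n).map fun j =>
      describedGate n 1 (i + n * (1 - e i j * (1 - (1 - (j - i))))) j 0) = czLayer G := by
  classical
  let f : ℕ → ℕ → Bits n → ℂ := fun i j b =>
    if h : i < n ∧ j < n then
      if i < j ∧ G.Adj ⟨i, h.1⟩ ⟨j, h.2⟩ then
        if b ⟨i, h.1⟩ && b ⟨j, h.2⟩ then -1 else 1
      else 1
    else 1
  have hgate : ∀ i < n, ∀ j < n,
      describedGate n 1 (i + n * (1 - e i j * (1 - (1 - (j - i))))) j 0 =
        Matrix.diagonal (f i j) := by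
    intro i hi j hj
    by_cases h : i < j ∧ G.Adj ⟨i, hi⟩ ⟨j, hj⟩
    · have h1 : i + n * (1 - e i j * (1 - (1 - (j - i)))) = i := by
        have h2 : 1 - (1 - (j - i)) = 1 := by omega
        rw [h2, he1 ⟨i, hi⟩ ⟨j, hj⟩ h.2]
        simp
      rw [h1]
      have h3 : i ≠ j := h.1.ne
      simp only [describedGate, dif_pos hi]
      rw [dif_pos ⟨hj, h3⟩, onQubits_czGate]
      congr 1
      funext b
      simp [f, hi, hj, h]
    · have h1 : ¬ (i + n * (1 - e i j * (1 - (1 - (j - i)))) < n) := by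
        have h2 : e i j * (1 - (1 - (j - i))) = 0 := by
          by_cases hij : i < j
          · rw [he0 ⟨i, hi⟩ ⟨j, hj⟩ fun ha => h ⟨hij, ha⟩, zero_mul]
          · rw [show 1 - (1 - (j - i)) = 0 by omega, mul_zero]
        rw [h2]
        simp
      rw [describedGate, dif_neg h1, ← Matrix.diagonal_one]
      congr 1
      funext b
      simp only [f]
      rw [dif_pos ⟨hi, hj⟩, if_neg h]
  have hrow : ∀ i < n, runOps ((List.range n).map fun j =>
      describedGate n 1 (i + n * (1 - e i j * (1 - (1 - (j - i))))) j 0) =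
      Matrix.diagonal fun b => ∏ j ∈ Finset.range n, f i j b := by
    intro i hi
    rw [List.map_eq_flatMap]
    exact runOps_flatMap_diagonal n _ _ fun j hj => by rw [runOps_singleton, hgate i hi j hj]
  rw [runOps_flatMap_diagonal n _ _ hrow, czLayer]
  congr 1
  funext b
  rw [Finset.prod_filter, Fintype.prod_prod_type, Finset.prod_range]
  refine Finset.prod_congr rfl fun i _ => ?_
  rw [Finset.prod_range]
  refine Finset.prod_congr rfl fun j _ => ?_
  simp [f]

/-- The described circuit samples from the network with the described angles. -/
theorem quantumOutput_circuitDesc {n : ℕ} (G : SimpleGraph (Fin n)) (e : ℕ → ℕ → ℕ)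
    (he1 : ∀ i j : Fin n, G.Adj i j → e i j = 1) (he0 : ∀ i j : Fin n, ¬ G.Adj i j → e i j = 0)
    (x : Bits n) (xb : ℕ → ℕ) (hx : ∀ i : Fin n, xb i = (x i).toNat) (A v : ℕ → ℕ) :
    quantumOutput n (circuitDesc n xb (modelDesc n e A v)) =
      idqnn G (fun i => Real.pi * A i / v i) x := by
  have hH : runOps ((List.range n).map fun i => describedGate n 0 (i + n * xb i) 0 0) =
      tensorMat fun i => if x i then 1 else hadamard := by
    refine runOps_onQubit _ _ fun i => ?_
    rw [hx]
    cases x i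
    · simp [describedGate]
    · simp [describedGate, onQubit_one]
  have hR : runOps ((List.range n).map fun i => describedGate n 2 i (A i) (v i)) =
      rzLayer fun i : Fin n => Real.pi * A i / v i := by
    rw [← tensorMat_rzGate]
    exact runOps_onQubit _ _ fun i => by simp [describedGate]
  have hF : runOps ((List.range n).map fun i => describedGate n 0 i 0 0) = hLayer n := by
    rw [hLayer_eq_tensorMat]
    exact runOps_onQubit _ _ fun i => by simp [describedGate]
  have hlist : describedGates n (circuitDesc n xb (modelDesc n e A v)) =
      (List.range n).map (fun i => describedGate n 0 (i + n * xb i) 0 0) ++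
      ((List.range n).map (fun i => describedGate n 2 i (A i) (v i)) ++
      (((List.range n).flatMap fun i => (List.range n).map fun j =>
        describedGate n 1 (i + n * (1 - e i j * (1 - (1 - (j - i))))) j 0) ++
      (List.range n).map fun i => describedGate n 0 i 0 0)) := by
    rw [circuitDesc, modelDesc, describedGates_flatMap, describedGates_flatMap,
      describedGates_flatMap_flatMap]
    congr 3
    have := describedGates_flatMap (n := n) (List.range n) (fun _ => 0) (fun i => i) (fun _ => 0)
      (fun _ => 0) []
    simpa [describedGates] using this
  funext y
  rw [quantumOutput, hlist]
  simp only [runOps_append, hH, hR, hF, runOps_czGates G e he1 he0]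
  rw [measureZero, ← Matrix.mulVec_mulVec, tensorMat_mulVec_zero, ← Matrix.mulVec_mulVec,
    ← Matrix.mulVec_mulVec]
  rfl

/-! ## Running times of register programs -/

/-- The number of nodes of an expression, plus the bit lengths of its constants. -/
def RExpr.weight : RExpr → ℕ
  | const c => 1 + Nat.size c
  | reg _ => 1
  | input e => 1 + e.weight
  | add e f => 1 + e.weight + f.weight
  | sub e f => 1 + e.weight + f.weight
  | mul e f => 1 + e.weight + f.weight
  | div e f => 1 + e.weight + f.weight

lemma getD_lt_two_pow {inp : List ℕ} {B : ℕ} (hinp : ∀ x ∈ inp, x < 2 ^ B) (k : ℕ) :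
    inp.getD k 0 < 2 ^ B := by
  rw [List.getD_eq_getElem?_getD]
  rcases h : inp[k]? with _ | x
  · simp
  · exact hinp x (List.mem_of_getElem? h)

/-- Bit lengths at most add up under multiplication, and addition costs one more bit; subtraction,
division and reading the input create nothing longer than their operands or the input entries. -/
lemma RExpr.val_lt {inp : List ℕ} {σ : ℕ → ℕ} {B : ℕ} (hinp : ∀ x ∈ inp, x < 2 ^ B)
    (hσ : ∀ i, σ i < 2 ^ B) (e : RExpr) : e.val inp σ < 2 ^ (e.weight * (B + 1)) := by
  induction e with
  | const c =>
    refine (Nat.lt_size_self c).trans_le (Nat.pow_le_pow_right (by norm_num) ?_)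
    simp only [RExpr.weight]
    nlinarith
  | reg i =>
    exact (hσ i).trans_le (Nat.pow_le_pow_right (by norm_num) (by simp [RExpr.weight]))
  | input e _ =>
    refine (getD_lt_two_pow hinp _).trans_le (Nat.pow_le_pow_right (by norm_num) ?_)
    simp only [RExpr.weight]
    nlinarith
  | add e f he hf =>
    simp only [RExpr.val, RExpr.weight]
    rw [add_mul, add_mul, pow_add, pow_add]
    have h1 : 2 ≤ 2 ^ (1 * (B + 1)) := by
      rw [one_mul, pow_succ]; have := Nat.one_le_two_pow (n := B); omega
    have h2 : 1 ≤ 2 ^ (e.weight * (B + 1)) := Nat.one_le_two_pow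
    have h3 : 1 ≤ 2 ^ (f.weight * (B + 1)) := Nat.one_le_two_pow
    generalize 2 ^ (1 * (B + 1)) = z at *
    generalize 2 ^ (e.weight * (B + 1)) = x at *
    generalize 2 ^ (f.weight * (B + 1)) = y at *
    calc e.val inp σ + f.val inp σ < x + y := by omega
      _ ≤ 2 * (x * y) := by nlinarith
      _ ≤ z * x * y := by rw [mul_assoc]; exact Nat.mul_le_mul_right _ h1
  | sub e f he hf =>
    refine lt_of_le_of_lt (Nat.sub_le _ _) (he.trans_le (Nat.pow_le_pow_right (by norm_num) ?_))
    simp only [RExpr.weight]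
    gcongr; omega
  | mul e f he hf =>
    simp only [RExpr.val]
    refine (Nat.mul_lt_mul'' he hf).trans_le ?_
    rw [← pow_add, ← add_mul]
    refine Nat.pow_le_pow_right (by norm_num) ?_
    simp only [RExpr.weight]
    gcongr; omega
  | div e f he hf =>
    refine lt_of_le_of_lt (Nat.div_le_self _ _) (he.trans_le (Nat.pow_le_pow_right (by norm_num) ?_))
    simp only [RExpr.weight]
    gcongr; omega

/-- There are at most `weight` nodes, and the value at each has at most `weight * (B + 1)` bits;
hence the square. -/
lemma RExpr.cost_le {inp : List ℕ} {σ : ℕ → ℕ} {B : ℕ} (hinp : ∀ x ∈ inp, x < 2 ^ B)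
    (hσ : ∀ i, σ i < 2 ^ B) (e : RExpr) : e.cost inp σ ≤ e.weight ^ 2 * (B + 2) := by
  have hsize : ∀ e : RExpr, Nat.size (e.val inp σ) ≤ e.weight * (B + 1) := fun e =>
    Nat.size_le.mpr (e.val_lt hinp hσ)
  induction e with
  | const c =>
    simp only [RExpr.cost, RExpr.weight]
    nlinarith
  | reg i =>
    have := Nat.size_le.mpr (hσ i)
    simp only [RExpr.cost, RExpr.weight]
    omega
  | input e he =>
    have := hsize (.input e)
    simp only [RExpr.cost, RExpr.weight] at *
    nlinarith
  | add e f he hf =>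
    have := hsize (.add e f)
    simp only [RExpr.cost, RExpr.weight] at *
    nlinarith [Nat.zero_le (e.weight * f.weight * (B + 2))]
  | sub e f he hf =>
    have := hsize (.sub e f)
    simp only [RExpr.cost, RExpr.weight] at *
    nlinarith [Nat.zero_le (e.weight * f.weight * (B + 2))]
  | mul e f he hf =>
    have := hsize (.mul e f)
    simp only [RExpr.cost, RExpr.weight] at *
    nlinarith [Nat.zero_le (e.weight * f.weight * (B + 2))]
  | div e f he hf =>
    have := hsize (.div e f)
    simp only [RExpr.cost, RExpr.weight] at *
    nlinarith [Nat.zero_le (e.weight * f.weight * (B + 2))]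

/-- A bound on the running time in units of the register length, if every loop is run through at
most `M` times. -/
def RProg.weight (M : ℕ) : RProg → ℕ
  | skip => 1
  | assign _ e => 1 + e.weight ^ 2
  | emit e => 1 + e.weight ^ 2
  | seq p q => 1 + p.weight M + q.weight M
  | cond e p q => 1 + e.weight ^ 2 + p.weight M + q.weight M
  | loop e p => (M + 1) * (1 + e.weight ^ 2 + p.weight M)

/-- Each nesting of loops contributes one factor `M + 1`, so the exponent depends on the program
text only. The base `M + 2 ≥ 2` lets constants be absorbed as powers. -/
lemma RProg.weight_le (p : RProg) : ∃ K, ∀ M, p.weight M ≤ (M + 2) ^ K := by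
  have hconst : ∀ c M : ℕ, c ≤ (M + 2) ^ c := fun c M =>
    (Nat.lt_two_pow_self (n := c)).le.trans (Nat.pow_le_pow_left (by omega) c)
  have hadd : ∀ c i j M : ℕ, c + (M + 2) ^ i + (M + 2) ^ j ≤ (M + 2) ^ (c + i + j + 2) := by
    intro c i j M
    have hc := hconst c M
    have h1 : 1 ≤ (M + 2) ^ c := Nat.one_le_pow _ _ (by omega)
    have h2 : 1 ≤ (M + 2) ^ i := Nat.one_le_pow _ _ (by omega)
    have h3 : 1 ≤ (M + 2) ^ j := Nat.one_le_pow _ _ (by omega)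
    have h4 : 4 ≤ (M + 2) ^ 2 :=
      le_trans (by norm_num : 4 ≤ 2 ^ 2) (Nat.pow_le_pow_left (by omega) 2)
    rw [pow_add, pow_add, pow_add]
    generalize (M + 2) ^ c = x at *
    generalize (M + 2) ^ i = y at *
    generalize (M + 2) ^ j = z at *
    have hx : x ≤ x * y * z := by
      rw [mul_assoc]; exact Nat.le_mul_of_pos_right _ (by positivity)
    have hy : y ≤ x * y * z := by
      rw [mul_comm x y, mul_assoc]; exact Nat.le_mul_of_pos_right _ (by positivity)
    have hz : z ≤ x * y * z := Nat.le_mul_of_pos_left _ (by positivity)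
    calc c + y + z ≤ x * y * z * 4 := by omega
      _ ≤ _ := Nat.mul_le_mul_left _ h4
  induction p with
  | skip => exact ⟨0, fun M => by simp [RProg.weight]⟩
  | assign i e => exact ⟨_, fun M => hconst (1 + e.weight ^ 2) M⟩
  | emit e => exact ⟨_, fun M => hconst (1 + e.weight ^ 2) M⟩
  | seq p q hp hq =>
    obtain ⟨i, hi⟩ := hp
    obtain ⟨j, hj⟩ := hq
    exact ⟨_, fun M => le_trans (by simp only [RProg.weight]; gcongr; exacts [hi M, hj M])
      (hadd 1 i j M)⟩
  | cond e p q hp hq =>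
    obtain ⟨i, hi⟩ := hp
    obtain ⟨j, hj⟩ := hq
    exact ⟨_, fun M => le_trans (by simp only [RProg.weight]; gcongr; exacts [hi M, hj M])
      (hadd (1 + e.weight ^ 2) i j M)⟩
  | loop e p hp =>
    obtain ⟨i, hi⟩ := hp
    refine ⟨1 + (1 + e.weight ^ 2 + i + 0 + 2), fun M => ?_⟩
    rw [pow_add _ 1, pow_one]
    simp only [RProg.weight]
    refine Nat.mul_le_mul (by omega) (le_trans ?_ (hadd (1 + e.weight ^ 2) i 0 M))
    have := hi M
    omega

/-! ## A calculus for register programs -/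

/-- Started with registers `σ` below `2 ^ B` and output `o`, the program halts with registers below
`2 ^ B` and a result satisfying `Q`, in the time allowed by its weight. -/
def RunsIn (inp : List ℕ) (M B : ℕ) (p : RProg) (σ : ℕ → ℕ) (o : List ℕ)
    (Q : (ℕ → ℕ) → List ℕ → Prop) : Prop :=
  (∀ i, σ i < 2 ^ B) → ∃ (t : ℕ) (σ' : ℕ → ℕ) (o' : List ℕ), RProg.Runs inp p σ o t σ' o' ∧
    t ≤ p.weight M * (B + 2) ∧ (∀ i, σ' i < 2 ^ B) ∧ Q σ' o'

namespace RunsIn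

variable {inp : List ℕ} {M B : ℕ} {σ : ℕ → ℕ} {o : List ℕ} {Q : (ℕ → ℕ) → List ℕ → Prop}

lemma assign (hinp : ∀ x ∈ inp, x < 2 ^ B) {i : ℕ} {e : RExpr} (he : e.val inp σ < 2 ^ B)
    (hQ : Q (Function.update σ i (e.val inp σ)) o) : RunsIn inp M B (.assign i e) σ o Q := by
  intro hσ
  refine ⟨_, _, _, .assign σ o i e, ?_, ?_, hQ⟩
  · have := e.cost_le hinp hσ
    simp only [RProg.weight]
    nlinarith
  · intro k
    by_cases hk : k = i
    · subst hk; simpa using he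
    · simpa [hk] using hσ k

lemma emit (hinp : ∀ x ∈ inp, x < 2 ^ B) {e : RExpr} (hQ : Q σ (o ++ [e.val inp σ])) :
    RunsIn inp M B (.emit e) σ o Q := by
  intro hσ
  refine ⟨_, _, _, .emit σ o e, ?_, hσ, hQ⟩
  have := e.cost_le hinp hσ
  simp only [RProg.weight]
  nlinarith

lemma seq {p q : RProg} {R : (ℕ → ℕ) → List ℕ → Prop} (hp : RunsIn inp M B p σ o R)
    (hq : ∀ σ' o', R σ' o' → RunsIn inp M B q σ' o' Q) : RunsIn inp M B (.seq p q) σ o Q := by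
  intro hσ
  obtain ⟨t, σ', o', h1, h2, h3, h4⟩ := hp hσ
  obtain ⟨t', σ'', o'', h1', h2', h3', h4'⟩ := hq σ' o' h4 h3
  refine ⟨_, _, _, .seq h1 h1', ?_, h3', h4'⟩
  simp only [RProg.weight]
  nlinarith

lemma seq_assign (hinp : ∀ x ∈ inp, x < 2 ^ B) {i : ℕ} {e : RExpr} {q : RProg}
    (he : e.val inp σ < 2 ^ B) (hq : RunsIn inp M B q (Function.update σ i (e.val inp σ)) o Q) :
    RunsIn inp M B (.seq (.assign i e) q) σ o Q :=
  seq (assign hinp he (Q := fun σ' o' => σ' = Function.update σ i (e.val inp σ) ∧ o' = o) ⟨rfl, rfl⟩)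
    fun _ _ h => by rw [h.1, h.2]; exact hq

lemma seq_emit (hinp : ∀ x ∈ inp, x < 2 ^ B) {e : RExpr} {q : RProg}
    (hq : RunsIn inp M B q σ (o ++ [e.val inp σ]) Q) : RunsIn inp M B (.seq (.emit e) q) σ o Q :=
  seq (emit hinp (Q := fun σ' o' => σ' = σ ∧ o' = o ++ [e.val inp σ]) ⟨rfl, rfl⟩)
    fun _ _ h => by rw [h.1, h.2]; exact hq

/-- The loop rule of a Hoare logic for total correctness: `I j` is the invariant after `j` rounds,
and the number `k` of rounds is known in advance. -/
lemma loop (hinp : ∀ x ∈ inp, x < 2 ^ B) {e : RExpr} {p : RProg} {k : ℕ} (hk : k ≤ M)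
    (I : ℕ → (ℕ → ℕ) → List ℕ → Prop) (h0 : I 0 σ o)
    (hstep : ∀ j < k, ∀ σ o, I j σ o → e.val inp σ ≠ 0 ∧ RunsIn inp M B p σ o (I (j + 1)))
    (hend : ∀ σ o, I k σ o → e.val inp σ = 0 ∧ Q σ o) :
    RunsIn inp M B (.loop e p) σ o Q := by
  intro hσ
  -- Induction on the number `r` of remaining rounds; the last, failing test of the condition
  -- accounts for the `+ 1`.
  have key : ∀ r j, j + r = k → ∀ σ o, (∀ i, σ i < 2 ^ B) → I j σ o →
      ∃ (t : ℕ) (σ' : ℕ → ℕ) (o' : List ℕ), RProg.Runs inp (.loop e p) σ o t σ' o' ∧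
        t ≤ (r + 1) * (1 + e.weight ^ 2 + p.weight M) * (B + 2) ∧ (∀ i, σ' i < 2 ^ B) ∧
        Q σ' o' := by
    intro r
    induction r with
    | zero =>
      intro j hj σ o hσ hI
      obtain rfl : j = k := hj
      obtain ⟨h1, h2⟩ := hend σ o hI
      refine ⟨_, _, _, .loopStop h1, ?_, hσ, h2⟩
      have := e.cost_le hinp hσ
      nlinarith
    | succ r ih =>
      intro j hj σ o hσ hI
      obtain ⟨h1, h2⟩ := hstep j (by omega) σ o hI
      obtain ⟨t, σ', o', h3, h4, h5, h6⟩ := h2 hσ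
      obtain ⟨t', σ'', o'', h3', h4', h5', h6'⟩ := ih (j + 1) (by omega) σ' o' h5 h6
      refine ⟨_, _, _, .loopStep h1 h3 h3', ?_, h5', h6'⟩
      have := e.cost_le hinp hσ
      nlinarith
  obtain ⟨t, σ', o', h1, h2, h3, h4⟩ := key k 0 (by omega) σ o hσ h0
  refine ⟨t, σ', o', h1, h2.trans ?_, h3, h4⟩
  simp only [RProg.weight]
  gcongr

end RunsIn

/-- Run `p` with register `r` ranging over the numbers below `e`. -/
def RProg.forEach (r : ℕ) (e : RExpr) (p : RProg) : RProg :=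
  .seq (.assign r (.const 0)) (.loop (.sub e (.reg r))
    (.seq p (.assign r (.add (.reg r) (.const 1)))))

/-- The body has to leave the counter alone, and the next invariant is required with the counter
already advanced, so that callers never see the increment. -/
lemma RunsIn.forEach {inp : List ℕ} {M B : ℕ} {σ : ℕ → ℕ} {o : List ℕ}
    {Q : (ℕ → ℕ) → List ℕ → Prop} (hinp : ∀ x ∈ inp, x < 2 ^ B) {r : ℕ} {e : RExpr} {p : RProg}
    {k : ℕ} (he : ∀ σ, e.val inp σ = k) (hk : k ≤ M) (hkB : k < 2 ^ B)
    (I : ℕ → (ℕ → ℕ) → List ℕ → Prop) (h0 : I 0 (Function.update σ r 0) o)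
    (hstep : ∀ j < k, ∀ σ o, σ r = j → I j σ o →
      RunsIn inp M B p σ o fun σ' o' => σ' r = j ∧ I (j + 1) (Function.update σ' r (j + 1)) o')
    (hend : ∀ σ o, I k σ o → Q σ o) : RunsIn inp M B (.forEach r e p) σ o Q := by
  refine RunsIn.seq_assign hinp (by simp [RExpr.val]) ?_
  refine RunsIn.loop hinp hk (fun j σ o => σ r = j ∧ I j σ o) ?_ ?_ ?_
  · exact ⟨by simp [RExpr.val], by simpa [RExpr.val] using h0⟩
  · rintro j hj σ o ⟨hr, hI⟩
    refine ⟨by simp only [RExpr.val, he, hr]; omega, ?_⟩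
    refine RunsIn.seq (hstep j hj σ o hr hI) ?_
    rintro σ' o' ⟨hr', hI'⟩
    refine RunsIn.assign hinp ?_ ?_
    · simp only [RExpr.val, hr']; omega
    · simp only [RExpr.val, hr', Function.update_self]
      exact ⟨trivial, hI'⟩
  · rintro σ o ⟨hr, hI⟩
    exact ⟨by simp [RExpr.val, he, hr], hend σ o hI⟩

lemma RunsIn.computesWithin {inp : List ℕ} {M B T : ℕ} {p : RProg} {out : List ℕ}
    (h : RunsIn inp M B p (fun _ => 0) [] fun _ o => o = out) (hT : p.weight M * (B + 2) ≤ T) :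
    p.ComputesWithin inp T out := by
  obtain ⟨t, σ, o, h1, h2, -, rfl⟩ := h fun _ => by positivity
  exact ⟨t, σ, h2.trans hT, h1⟩

/-! ## Computing arc cosines of rational numbers -/

/-- A rational number `± P / R` in `[-1, 1]`, negative if `neg = 1`, together with the first binary
digits `A` of an angle, to which the arc cosine of the number is added, or subtracted if `s = 1`. -/
structure ArcState where
  A : ℕ
  s : ℕ
  neg : ℕ
  P : ℕ
  R : ℕ

namespace ArcState

/-- The number `1 - 2 * c / m`. -/
def start (m c : ℕ) : ArcState where
  A := 0
  s := 0
  neg := 1 - (1 - (2 * c - m))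
  P := (m - 2 * c) + (2 * c - m)
  R := m

/-- One more binary digit: the number `x` is replaced by `2 * x ^ 2 - 1`. -/
def next (z : ArcState) : ArcState where
  -- If `x < 0`, then `2 arccos x = 2 π - arccos (2 x ^ 2 - 1)`: the sign in front of the arc cosine
  -- is reversed, and `2 π` moves into the digits, added or subtracted according to the old sign.
  A := 2 * z.A + 2 * (z.neg * (1 - z.s)) - 2 * (z.neg * z.s)
  s := z.s + z.neg - 2 * (z.s * z.neg)
  neg := 1 - (1 - (z.R * z.R - 2 * (z.P * z.P)))
  -- One of the two truncated differences is zero, so the sum is the absolute value.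
  P := (2 * (z.P * z.P) - z.R * z.R) + (z.R * z.R - 2 * (z.P * z.P))
  R := z.R * z.R

/-- The state after `j` binary digits. -/
def iter (m c : ℕ) : ℕ → ArcState
  | 0 => start m c
  | j + 1 => (iter m c j).next

/-- These bounds keep the registers short: the denominator is squared at each step, which is
affordable for logarithmically many steps, and `A` at most doubles and grows by 2. -/
lemma iter_bounds {m c : ℕ} (h : c ≤ m) (j : ℕ) :
    (iter m c j).R = m ^ 2 ^ j ∧ (iter m c j).P ≤ (iter m c j).R ∧
      (iter m c j).A + 2 ≤ 2 * 2 ^ j ∧ (iter m c j).s ≤ 1 ∧ (iter m c j).neg ≤ 1 := by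
  induction j with
  | zero => simp only [iter, start]; refine ⟨by simp, ?_, ?_, ?_, ?_⟩ <;> omega
  | succ j ih =>
    obtain ⟨h1, h2, h3, h4, h5⟩ := ih
    simp only [iter, next]
    generalize iter m c j = z at *
    refine ⟨?_, ?_, ?_, ?_, ?_⟩
    · rw [h1, pow_succ 2 j, pow_mul, sq]
    · have := Nat.mul_le_mul h2 h2
      omega
    · have hs : 1 - z.s ≤ 1 := by omega
      have : z.neg * (1 - z.s) ≤ 1 := Nat.mul_le_mul h5 hs
      rw [pow_succ]
      omega
    · have : z.s = 0 ∨ z.s = 1 := by omega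
      rcases this with h | h <;> rw [h] <;> omega
    · omega

end ArcState

/-- The double angle formula; for `x < 0` the doubled angle exceeds `π` and is reflected back into
`[0, π]`. -/
lemma arccos_two_mul_sq_sub_one {x : ℝ} (h1 : -1 ≤ x) (h2 : x ≤ 1) :
    Real.arccos (2 * x ^ 2 - 1) =
      if x < 0 then 2 * Real.pi - 2 * Real.arccos x else 2 * Real.arccos x := by
  have hcos : Real.cos (2 * Real.arccos x) = 2 * x ^ 2 - 1 := by
    rw [Real.cos_two_mul, Real.cos_arccos h1 h2]
  split_ifs with hx
  · have h3 : Real.pi / 2 < Real.arccos x := by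
      rw [← not_le, Real.arccos_le_pi_div_two]; exact not_le.mpr hx
    rw [← hcos, ← Real.cos_two_pi_sub]
    exact Real.arccos_cos (by linarith [Real.arccos_le_pi x]) (by linarith)
  · have h3 : Real.arccos x ≤ Real.pi / 2 := Real.arccos_le_pi_div_two.mpr (not_lt.mp hx)
    rw [← hcos]
    exact Real.arccos_cos (by linarith [Real.arccos_nonneg x]) (by linarith)

lemma natCast_sub_add_sub (p q : ℕ) : (((p - q) + (q - p) : ℕ) : ℝ) = |(p : ℝ) - q| := by
  rcases le_total p q with h | h
  · rw [Nat.sub_eq_zero_of_le h, zero_add, Nat.cast_sub h, abs_sub_comm, abs_of_nonneg]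
    exact sub_nonneg.mpr (Nat.cast_le.mpr h)
  · rw [Nat.sub_eq_zero_of_le h, add_zero, Nat.cast_sub h, abs_of_nonneg]
    exact sub_nonneg.mpr (Nat.cast_le.mpr h)

/-- The state holds the number `x`, and its digits are those of the angle `α` up to `arccos x`. -/
structure ArcState.Holds (z : ArcState) (v : ℕ) (α x : ℝ) : Prop where
  lower : -1 ≤ x
  upper : x ≤ 1
  R_pos : 0 < z.R
  abs_eq : |x| * z.R = z.P
  sign : z.neg = if x < 0 then 1 else 0
  digits : (z.s = 0 ∧ α * v = z.A * Real.pi + Real.arccos x) ∨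
    (z.s = 1 ∧ α * v = z.A * Real.pi - Real.arccos x)

lemma ArcState.Holds.next {z : ArcState} {v : ℕ} {α x : ℝ} (hα : 0 ≤ α) (h : z.Holds v α x) :
    z.next.Holds (2 * v) α (2 * x ^ 2 - 1) := by
  obtain ⟨h1, h2, hR, hP, hneg, hdig⟩ := h
  have hR' : (0 : ℝ) < z.R := Nat.cast_pos.mpr hR
  have hx : x ^ 2 ≤ 1 := by nlinarith
  have hPP : x ^ 2 * (z.R * z.R) = z.P * z.P := by
    rw [← hP, ← sq_abs]; ring
  have hpi := Real.pi_pos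
  refine ⟨by nlinarith, by linarith, Nat.mul_pos hR hR, ?_, ?_, ?_⟩
  · simp only [ArcState.next]
    rw [natCast_sub_add_sub]
    push_cast
    rw [← abs_of_pos (mul_pos hR' hR'), ← abs_mul, ← hPP, abs_of_pos (mul_pos hR' hR')]
    ring_nf
  · simp only [ArcState.next]
    have hiff : 2 * x ^ 2 - 1 < 0 ↔ 2 * (z.P * z.P) < z.R * z.R := by
      have h3 : (2 * x ^ 2 - 1) * (z.R * z.R : ℝ) = 2 * (z.P * z.P) - z.R * z.R := by
        rw [← hPP]; ring
      have hRR := mul_pos hR' hR'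
      rw [← Nat.cast_lt (α := ℝ)]
      push_cast
      constructor
      · intro h; nlinarith
      · intro h
        by_contra hc
        have := mul_nonneg (not_lt.mp hc) hRR.le
        linarith
    split_ifs with hc
    · have := hiff.mp hc; omega
    · have := not_lt.mp (fun h => hc (hiff.mpr h)); omega
  · simp only [ArcState.next]
    rw [arccos_two_mul_sq_sub_one h1 h2, hneg]
    push_cast
    split_ifs with hx0
    · rcases hdig with ⟨hs, hd⟩ | ⟨hs, hd⟩
      · right
        refine ⟨by rw [hs], ?_⟩
        rw [hs]
        norm_num
        linear_combination 2 * hd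
      · left
        refine ⟨by rw [hs], ?_⟩
        have h3 : Real.pi / 2 < Real.arccos x := by
          rw [← not_le, Real.arccos_le_pi_div_two]; exact not_le.mpr hx0
        -- If `A` were zero, then `α v = -arccos x < 0`, contradicting `0 ≤ α`. Hence the truncated
        -- subtraction of 2 from `2 A` is exact.
        have hA : 1 ≤ z.A := by
          by_contra hc
          have : z.A = 0 := by omega
          rw [this] at hd
          have h4 : 0 ≤ α * v := by positivity
          simp only [Nat.cast_zero, zero_mul] at hd
          linarith
        have h5 : 2 * z.A + 2 * (1 * (1 - z.s)) - 2 * (1 * z.s) = 2 * z.A - 2 := by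
          rw [hs]
          omega
        rw [h5, Nat.cast_sub (by omega)]
        push_cast
        linear_combination 2 * hd
    · rcases hdig with ⟨hs, hd⟩ | ⟨hs, hd⟩
      · left
        refine ⟨by rw [hs], ?_⟩
        norm_num
        linear_combination 2 * hd
      · right
        refine ⟨by rw [hs], ?_⟩
        norm_num
        linear_combination 2 * hd

lemma ArcState.Holds.start {m c : ℕ} (hm : 0 < m) (hc : c ≤ m) :
    (ArcState.start m c).Holds 1 (Real.arccos (1 - 2 * ((c : ℝ) / m)))
      (1 - 2 * ((c : ℝ) / m)) := by
  have hm' : (0 : ℝ) < m := Nat.cast_pos.mpr hm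
  have h1 : (c : ℝ) / m ≤ 1 := (div_le_one hm').mpr (Nat.cast_le.mpr hc)
  have h0 : 0 ≤ (c : ℝ) / m := by positivity
  refine ⟨by linarith, by linarith, hm, ?_, ?_, ?_⟩
  · simp only [ArcState.start]
    rw [natCast_sub_add_sub]
    nth_rewrite 2 [← abs_of_pos hm']
    rw [← abs_mul]
    congr 1
    push_cast
    field_simp
  · simp only [ArcState.start]
    have hiff : 1 - 2 * ((c : ℝ) / m) < 0 ↔ m < 2 * c := by
      rw [sub_neg, ← mul_div_assoc, lt_div_iff₀ hm', one_mul]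
      exact_mod_cast Iff.rfl
    split_ifs with h
    · have := hiff.mp h; omega
    · have := not_lt.mp (fun h' => h (hiff.mpr h')); omega
  · left
    simp [ArcState.start]

/-- After `j` steps the arc cosine is known with accuracy `π / 2 ^ j`. -/
lemma ArcState.abs_arccos_sub_le {m c : ℕ} (hm : 0 < m) (hc : c ≤ m) (j : ℕ) :
    |Real.arccos (1 - 2 * ((c : ℝ) / m)) - Real.pi * (ArcState.iter m c j).A / (2 ^ j : ℕ)| ≤
      Real.pi / (2 ^ j : ℕ) := by
  set α := Real.arccos (1 - 2 * ((c : ℝ) / m)) with hα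
  have h : ∃ x, (ArcState.iter m c j).Holds (2 ^ j) α x := by
    induction j with
    | zero => exact ⟨_, ArcState.Holds.start hm hc⟩
    | succ j ih =>
      obtain ⟨x, hx⟩ := ih
      exact ⟨_, by rw [pow_succ, mul_comm]; exact hx.next (Real.arccos_nonneg _)⟩
  obtain ⟨x, hx⟩ := h
  have hv : (0 : ℝ) < ((2 ^ j : ℕ) : ℝ) := by positivity
  have h0 := Real.arccos_nonneg x
  have h1 := Real.arccos_le_pi x
  rw [le_div_iff₀ hv]
  nth_rewrite 2 [← abs_of_pos hv]
  rw [← abs_mul, sub_mul, div_mul_cancel₀ _ hv.ne', abs_le]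
  rcases hx.digits with ⟨-, hd⟩ | ⟨-, hd⟩ <;> constructor <;> linarith

/-! ## The learning program

Registers: `0` site, `1` sample, `2` neighbour, `3` decoupling indicator, `4` number of decoupling
samples, `5` number of ones among them, `6`-`10` state of the arc cosine computation, `11` power of
two, `12` auxiliary. -/

namespace LearnProg

/-- The number of sites. -/
def sites : RExpr := .input (.const 0)

/-- The adjacency of the sites in registers `0` and `2`. -/
def adj : RExpr := .input (.add (.const 4) (.add (.mul sites (.reg 0)) (.reg 2)))

/-- The input bit of the sample in register `1` at the site in register `j`. -/
def xBit (j : ℕ) : RExpr :=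
  .input (.add (.add (.const 4) (.mul sites sites))
    (.add (.mul (.mul (.const 2) sites) (.reg 1)) (.reg j)))

/-- The output bit of the sample in register `1` at the site in register `0`. -/
def yBit : RExpr :=
  .input (.add (.add (.const 4) (.mul sites sites))
    (.add (.mul (.mul (.const 2) sites) (.reg 1)) (.add sites (.reg 0))))

/-- Decide whether a sample decouples the site. -/
def decouple : RProg :=
  .seq (.assign 3 (.sub (.const 1) (xBit 0)))
    (.forEach 2 sites (.assign 3
      (.mul (.reg 3) (.sub (.const 1) (.mul adj (.sub (.const 1) (xBit 2)))))))

/-- Count the samples that decouple the site, and the ones among their outputs. -/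
def count : RProg :=
  .seq (.assign 4 (.const 0)) (.seq (.assign 5 (.const 0))
    (.forEach 1 (.input (.const 3)) (.seq decouple (.seq (.assign 4 (.add (.reg 4) (.reg 3)))
      (.assign 5 (.add (.reg 5) (.mul (.reg 3) yBit)))))))

/-- Initialize the computation of the arc cosine. -/
def arcInit : RProg :=
  .seq (.assign 6 (.add (.sub (.reg 4) (.mul (.const 2) (.reg 5)))
    (.sub (.mul (.const 2) (.reg 5)) (.reg 4))))
  (.seq (.assign 7 (.reg 4))
  (.seq (.assign 8 (.sub (.const 1) (.sub (.const 1) (.sub (.mul (.const 2) (.reg 5)) (.reg 4)))))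
  (.seq (.assign 9 (.const 0)) (.seq (.assign 10 (.const 0)) (.assign 11 (.const 1))))))

/-- Compute one binary digit of the arc cosine. -/
def arcStep : RProg :=
  .seq (.assign 9 (.sub (.add (.mul (.const 2) (.reg 9))
      (.mul (.const 2) (.mul (.reg 8) (.sub (.const 1) (.reg 10)))))
    (.mul (.const 2) (.mul (.reg 8) (.reg 10)))))
  (.seq (.assign 10 (.sub (.add (.reg 10) (.reg 8)) (.mul (.const 2) (.mul (.reg 10) (.reg 8)))))
  (.seq (.assign 12 (.mul (.const 2) (.mul (.reg 6) (.reg 6))))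
  (.seq (.assign 7 (.mul (.reg 7) (.reg 7)))
  (.seq (.assign 8 (.sub (.const 1) (.sub (.const 1) (.sub (.reg 7) (.reg 12)))))
  (.seq (.assign 6 (.add (.sub (.reg 12) (.reg 7)) (.sub (.reg 7) (.reg 12))))
  (.assign 11 (.mul (.const 2) (.reg 11))))))))

/-- Compute the binary digits of the arc cosine. -/
def arcLoop : RProg :=
  .loop (.sub (.mul (.const 4) (.mul sites (.input (.const 1)))) (.reg 11)) arcStep

/-- Write the rotations. -/
def rotations : RProg :=
  .forEach 0 sites (.seq count (.seq arcInit (.seq arcLoop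
    (.seq (.emit (.const 2)) (.seq (.emit (.reg 0)) (.seq (.emit (.reg 9)) (.emit (.reg 11))))))))

/-- Write the controlled-`Z` gates. -/
def edges : RProg :=
  .forEach 0 sites (.forEach 2 sites (.seq (.emit (.const 1))
    (.seq (.emit (.add (.reg 0) (.mul sites (.sub (.const 1) (.mul adj
      (.sub (.const 1) (.sub (.const 1) (.sub (.reg 2) (.reg 0)))))))))
    (.seq (.emit (.reg 2)) (.emit (.const 0))))))

/-- Write the final Hadamard gates. -/
def hadamards : RProg :=
  .forEach 0 sites (.seq (.emit (.const 0)) (.seq (.emit (.reg 0))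
    (.seq (.emit (.const 0)) (.emit (.const 0)))))

/-- The learning program. -/
def main : RProg := .seq rotations (.seq edges hadamards)

/-- Whether sample `t` decouples site `i` from the sites below `k`, as a number. -/
def decoupleVal (E X : ℕ → ℕ → ℕ) (i t k : ℕ) : ℕ :=
  (1 - X t i) * ∏ j ∈ Finset.range k, (1 - E i j * (1 - X t j))

/-- The number of samples below `k` that decouple site `i`. -/
def countVal (E X : ℕ → ℕ → ℕ) (n i k : ℕ) : ℕ := ∑ t ∈ Finset.range k, decoupleVal E X i t n

/-- The number of ones at site `i` in the samples below `k` that decouple `i`. -/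
def onesVal (E X Y : ℕ → ℕ → ℕ) (n i k : ℕ) : ℕ :=
  ∑ t ∈ Finset.range k, decoupleVal E X i t n * Y t i

lemma decoupleVal_le_one (E X : ℕ → ℕ → ℕ) (i t k : ℕ) : decoupleVal E X i t k ≤ 1 :=
  Nat.mul_le_mul (Nat.sub_le _ _) (Finset.prod_le_one (fun _ _ => Nat.zero_le _)
    fun _ _ => Nat.sub_le _ _)

lemma countVal_le (E X : ℕ → ℕ → ℕ) (n i k : ℕ) : countVal E X n i k ≤ k := by
  have h := Finset.sum_le_card_nsmul (Finset.range k) (fun t => decoupleVal E X i t n) 1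
    fun t _ => decoupleVal_le_one E X i t n
  rwa [Finset.card_range, smul_eq_mul, mul_one] at h

lemma onesVal_le {E X Y : ℕ → ℕ → ℕ} (n i k : ℕ) (hY : ∀ t < k, Y t i ≤ 1) :
    onesVal E X Y n i k ≤ countVal E X n i k :=
  Finset.sum_le_sum fun t ht => by
    simpa using Nat.mul_le_mul_left (decoupleVal E X i t n) (hY t (Finset.mem_range.mp ht))

/-- The input lists a graph with adjacency matrix `E` and samples with inputs `X` and outputs `Y`;
the numbers `M` and `B` bound the numbers of iterations and the lengths of the registers. -/
structure Setting (inp : List ℕ) (M B n a N : ℕ) (E X Y : ℕ → ℕ → ℕ) : Prop where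
  lt : ∀ x ∈ inp, x < 2 ^ B
  sites : inp.getD 0 0 = n
  acc : inp.getD 1 0 = a
  samples : inp.getD 3 0 = N
  edge : ∀ i < n, ∀ j < n, inp.getD (4 + (n * i + j)) 0 = E i j
  xbit : ∀ t < N, ∀ j < n, inp.getD (4 + n * n + (2 * n * t + j)) 0 = X t j
  ybit : ∀ t < N, ∀ j < n, inp.getD (4 + n * n + (2 * n * t + (n + j))) 0 = Y t j
  ybit_le : ∀ t < N, ∀ j < n, Y t j ≤ 1
  n_le : n ≤ M
  N_le : N ≤ M
  acc_le : 4 * (n * a) ≤ M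
  -- The first term is the bit length of the numbers `m ^ 2 ^ j` with `m ≤ N` and `2 ^ j ≤ 8 n a`;
  -- the others bound counters and digits crudely by their values.
  le_B : 8 * (n * a) * N + 16 * (n * a) + n + N + 2 ≤ B

variable {inp : List ℕ} {M B n a N : ℕ} {E X Y : ℕ → ℕ → ℕ}

lemma Setting.lt_two_pow (h : Setting inp M B n a N E X Y) {k : ℕ}
    (hk : k ≤ 8 * (n * a) * N + 16 * (n * a) + n + N + 2) : k < 2 ^ B :=
  (hk.trans h.le_B).trans_lt Nat.lt_two_pow_self

lemma runs_decouple (h : Setting inp M B n a N E X Y) {σ : ℕ → ℕ} {o : List ℕ} {i t : ℕ}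
    (hi : i < n) (ht : t < N) (h0 : σ 0 = i) (h1 : σ 1 = t) :
    RunsIn inp M B decouple σ o fun σ' o' => σ' 3 = decoupleVal E X i t n ∧ σ' 0 = i ∧ σ' 1 = t ∧
      σ' 4 = σ 4 ∧ σ' 5 = σ 5 ∧ o' = o := by
  have hx0 : (xBit 0).val inp σ = X t i := by
    simp only [xBit, LearnProg.sites, RExpr.val, h.sites, h0, h1, h.xbit t ht i hi]
  refine RunsIn.seq_assign h.lt ?_ ?_
  · exact lt_of_le_of_lt (Nat.sub_le _ _) (h.lt_two_pow (by simp only [RExpr.val]; omega))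
  refine RunsIn.forEach h.lt (k := n) (fun σ => h.sites) h.n_le (h.lt_two_pow (by omega))
    (fun k σ' o' => σ' 3 = decoupleVal E X i t k ∧ σ' 0 = i ∧ σ' 1 = t ∧ σ' 4 = σ 4 ∧
      σ' 5 = σ 5 ∧ o' = o) ?_ ?_ ?_
  · simp [RExpr.val, hx0, decoupleVal, h0, h1]
  · rintro j hj σ' o' h2 ⟨h3, h0', h1', h4, h5, ho⟩
    have hval : (RExpr.mul (.reg 3) (.sub (.const 1) (.mul adj (.sub (.const 1) (xBit 2))))).val
        inp σ' = decoupleVal E X i t (j + 1) := by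
      simp only [xBit, adj, LearnProg.sites, RExpr.val, h.sites, h0', h1', h2, h3,
        h.xbit t ht j hj, h.edge i hi j hj, decoupleVal, Finset.prod_range_succ]
      rw [mul_assoc]
    refine RunsIn.assign h.lt ?_ ?_
    · rw [hval]
      exact (decoupleVal_le_one E X i t _).trans_lt (h.lt_two_pow (by omega))
    · rw [hval]
      simp [h2, h0', h1', h4, h5, ho]
  · intro σ' o' h'
    exact h'

lemma runs_count (h : Setting inp M B n a N E X Y) {σ : ℕ → ℕ} {o : List ℕ} {i : ℕ}
    (hi : i < n) (h0 : σ 0 = i) :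
    RunsIn inp M B count σ o fun σ' o' => σ' 4 = countVal E X n i N ∧
      σ' 5 = onesVal E X Y n i N ∧ σ' 0 = i ∧ o' = o := by
  refine RunsIn.seq_assign h.lt (h.lt_two_pow (by simp [RExpr.val])) ?_
  refine RunsIn.seq_assign h.lt (h.lt_two_pow (by simp [RExpr.val])) ?_
  refine RunsIn.forEach h.lt (k := N) (fun σ => h.samples) h.N_le (h.lt_two_pow (by omega))
    (fun k σ' o' => σ' 4 = countVal E X n i k ∧ σ' 5 = onesVal E X Y n i k ∧ σ' 0 = i ∧ o' = o)
    ?_ ?_ ?_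
  · simp [RExpr.val, countVal, onesVal, h0]
  · rintro t ht σ o' h1 ⟨h4, h5, h0', rfl⟩
    have hc := countVal_le E X n i (t + 1)
    have hd := onesVal_le (E := E) (X := X) n i (t + 1) fun t' ht' =>
      h.ybit_le t' (by omega) i hi
    refine RunsIn.seq (runs_decouple h hi ht h0' h1) ?_
    rintro σ' o' ⟨h3', h0', h1', h4', h5', rfl⟩
    have hv4 : (RExpr.add (.reg 4) (.reg 3)).val inp σ' = countVal E X n i (t + 1) := by
      simp only [RExpr.val, h4', h4, h3', countVal, Finset.sum_range_succ]
    refine RunsIn.seq_assign h.lt ?_ ?_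
    · rw [hv4]; exact h.lt_two_pow (by omega)
    rw [hv4]
    have hv5 : (RExpr.add (.reg 5) (.mul (.reg 3) yBit)).val inp
        (Function.update σ' 4 (countVal E X n i (t + 1))) = onesVal E X Y n i (t + 1) := by
      simp [RExpr.val, h5', h5, h3', onesVal, Finset.sum_range_succ, yBit, LearnProg.sites,
        h.sites, h0', h1', h.ybit t ht i hi, -List.getD_eq_getElem?_getD]
    refine RunsIn.assign h.lt ?_ ?_
    · rw [hv5]; exact h.lt_two_pow (by omega)
    · rw [hv5]
      simp [h0', h1']
  · intro σ' o' h'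
    exact h'

/-- The registers `6`-`10` hold the state `z`. -/
def ArcRegs (z : ArcState) (σ : ℕ → ℕ) : Prop :=
  σ 9 = z.A ∧ σ 10 = z.s ∧ σ 8 = z.neg ∧ σ 6 = z.P ∧ σ 7 = z.R

lemma runs_arcInit (h : Setting inp M B n a N E X Y) {σ : ℕ → ℕ} {o : List ℕ} {i m c : ℕ}
    (h0 : σ 0 = i) (h4 : σ 4 = m) (h5 : σ 5 = c) (hm : m ≤ N) (hc : c ≤ m) :
    RunsIn inp M B arcInit σ o fun σ' o' => ArcRegs (.start m c) σ' ∧ σ' 11 = 1 ∧ σ' 0 = i ∧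
      o' = o := by
  refine RunsIn.seq_assign h.lt (h.lt_two_pow ?_) ?_
  · simp only [RExpr.val, h4, h5]; omega
  refine RunsIn.seq_assign h.lt (h.lt_two_pow ?_) ?_
  · simp [RExpr.val, h4]; omega
  refine RunsIn.seq_assign h.lt (h.lt_two_pow ?_) ?_
  · simp only [RExpr.val]; omega
  refine RunsIn.seq_assign h.lt (h.lt_two_pow (by simp [RExpr.val])) ?_
  refine RunsIn.seq_assign h.lt (h.lt_two_pow (by simp [RExpr.val])) ?_
  refine RunsIn.assign h.lt (h.lt_two_pow (by simp [RExpr.val])) ?_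
  simp [RExpr.val, ArcRegs, ArcState.start, h0, h4, h5]

/-- The assignments are ordered so that old values are read before being overwritten: the digits
before the sign, and `2 P ^ 2` is saved in register `12`. The largest intermediate value is at most
`2 R ^ 2`, which explains `hR`. -/
lemma runs_arcStep (h : Setting inp M B n a N E X Y) {σ : ℕ → ℕ} {o : List ℕ} {i v : ℕ}
    {z : ArcState} (h0 : σ 0 = i) (hz : ArcRegs z σ) (h11 : σ 11 = v)
    (hA : z.next.A + 2 ≤ 2 * (2 * v)) (hs : z.next.s ≤ 1)
    (hv : 2 * v ≤ 8 * (n * a)) (hP : z.next.P ≤ z.next.R) (hPR : z.P ≤ z.R)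
    (hR : 2 * z.next.R < 2 ^ B) :
    RunsIn inp M B arcStep σ o fun σ' o' => ArcRegs z.next σ' ∧ σ' 11 = 2 * v ∧ σ' 0 = i ∧
      o' = o := by
  obtain ⟨h9, h10, h8, h6, h7⟩ := hz
  have hPP : z.P * z.P ≤ z.R * z.R := Nat.mul_le_mul hPR hPR
  simp only [ArcState.next] at hA hs hP hR
  refine RunsIn.seq_assign h.lt (h.lt_two_pow ?_) ?_
  · simp only [RExpr.val, h8, h9, h10]; omega
  refine RunsIn.seq_assign h.lt (h.lt_two_pow ?_) ?_
  · simp [RExpr.val, h8, h10]; omega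
  refine RunsIn.seq_assign h.lt ?_ ?_
  · simp [RExpr.val, h6]; omega
  refine RunsIn.seq_assign h.lt ?_ ?_
  · simp [RExpr.val, h7]; omega
  refine RunsIn.seq_assign h.lt (h.lt_two_pow ?_) ?_
  · simp only [RExpr.val]; omega
  refine RunsIn.seq_assign h.lt ?_ ?_
  · simp [RExpr.val, h7, h6]; omega
  refine RunsIn.assign h.lt (h.lt_two_pow ?_) ?_
  · simp [RExpr.val, h11]; omega
  simp [RExpr.val, ArcRegs, ArcState.next, h0, h6, h7, h8, h9, h10, h11]

/-- The number of binary digits computed for every angle. -/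
def digits (n a : ℕ) : ℕ := Nat.clog 2 (4 * (n * a))

lemma lt_digits_iff {n a j : ℕ} : j < digits n a ↔ 2 ^ j < 4 * (n * a) := by
  rw [digits, Nat.lt_clog_iff_pow_lt (by norm_num)]

/-- The loop compares the power of two in register `11` with `4 n a`, hence makes exactly `digits n
a` steps without computing a logarithm. -/
lemma runs_arcLoop (h : Setting inp M B n a N E X Y) {σ : ℕ → ℕ} {o : List ℕ} {i m c : ℕ}
    (h0 : σ 0 = i) (hz : ArcRegs (.start m c) σ) (h11 : σ 11 = 1) (hm : m ≤ N) (hc : c ≤ m) :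
    RunsIn inp M B arcLoop σ o fun σ' o' =>
      σ' 9 = (ArcState.iter m c (digits n a)).A ∧ σ' 11 = 2 ^ digits n a ∧ σ' 0 = i ∧ o' = o := by
  have hcond : ∀ σ : ℕ → ℕ, (RExpr.sub (.mul (.const 4) (.mul LearnProg.sites
      (.input (.const 1)))) (.reg 11)).val inp σ = 4 * (n * a) - σ 11 := by
    intro σ
    simp only [RExpr.val, LearnProg.sites, h.sites, h.acc]
  have hk : digits n a ≤ M := by
    refine le_trans ?_ h.acc_le
    by_contra hlt
    exact absurd (lt_digits_iff.mp (not_le.mp hlt)) (not_lt.mpr Nat.lt_two_pow_self.le)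
  refine RunsIn.loop h.lt hk
    (fun j σ' o' => ArcRegs (ArcState.iter m c j) σ' ∧ σ' 11 = 2 ^ j ∧ σ' 0 = i ∧ o' = o) ?_ ?_ ?_
  · exact ⟨hz, by simpa using h11, h0, rfl⟩
  · rintro j hj σ' o' ⟨hz', h11', h0', rfl⟩
    have hlt := lt_digits_iff.mp hj
    refine ⟨by rw [hcond, h11']; omega, ?_⟩
    obtain ⟨hR, hP, hA, hs, -⟩ := ArcState.iter_bounds hc (j + 1)
    have hP' := (ArcState.iter_bounds hc j).2.1
    have hv : 2 * 2 ^ j ≤ 8 * (n * a) := by omega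
    -- The doubly exponential denominator `m ^ 2 ^ (j + 1)` has polynomial length, because `2 ^ (j +
    -- 1)` is at most `8 n a`.
    have hRB : 2 * (ArcState.iter m c (j + 1)).R < 2 ^ B := by
      rw [hR]
      calc 2 * m ^ 2 ^ (j + 1) ≤ 2 * (2 ^ N) ^ (8 * (n * a)) := by
            refine Nat.mul_le_mul_left 2 ?_
            refine (Nat.pow_le_pow_left (hm.trans Nat.lt_two_pow_self.le) _).trans ?_
            exact Nat.pow_le_pow_right Nat.one_le_two_pow (by rw [pow_succ]; omega)
        _ = 2 ^ (N * (8 * (n * a)) + 1) := by rw [← pow_mul, pow_succ, mul_comm]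
        _ < 2 ^ B := by
            refine Nat.pow_lt_pow_right (by norm_num) ?_
            have := h.le_B
            rw [mul_comm N]
            omega
    have hrun := runs_arcStep (o := o') h h0' hz' h11'
      (by rw [pow_succ, mul_comm (2 ^ j)] at hA; exact hA) hs hv hP hP' hRB
    rw [pow_succ, mul_comm (2 ^ j)]
    exact hrun
  · rintro σ' o' ⟨hz', h11', h0', rfl⟩
    refine ⟨?_, hz'.1, h11', h0', rfl⟩
    rw [hcond, h11', Nat.sub_eq_zero_iff_le]
    exact not_lt.mp fun hlt => absurd (lt_digits_iff.mpr hlt) (lt_irrefl _)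

/-- The digits of the learned angle of site `i`. -/
def angleDigits (E X Y : ℕ → ℕ → ℕ) (n a N i : ℕ) : ℕ :=
  (ArcState.iter (countVal E X n i N) (onesVal E X Y n i N) (digits n a)).A

lemma runs_rotations (h : Setting inp M B n a N E X Y) {σ : ℕ → ℕ} {o : List ℕ} :
    RunsIn inp M B rotations σ o fun _ o' => o' = o ++ (List.range n).flatMap fun i =>
      [2, i, angleDigits E X Y n a N i, 2 ^ digits n a] := by
  refine RunsIn.forEach h.lt (k := n) (fun σ => h.sites) h.n_le (h.lt_two_pow (by omega))
    (fun k _ o' => o' = o ++ (List.range k).flatMap fun i =>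
      [2, i, angleDigits E X Y n a N i, 2 ^ digits n a]) ?_ ?_ ?_
  · simp
  · rintro i hi σ' _ h0 rfl
    have hm := countVal_le E X n i N
    have hc := onesVal_le (E := E) (X := X) n i N fun t ht => h.ybit_le t ht i hi
    refine RunsIn.seq (runs_count h hi h0) ?_
    rintro σ _ ⟨h4, h5, h0, rfl⟩
    refine RunsIn.seq (runs_arcInit h h0 h4 h5 hm hc) ?_
    rintro σ _ ⟨hz, h11, h0, rfl⟩
    refine RunsIn.seq (runs_arcLoop h h0 hz h11 hm hc) ?_
    rintro σ _ ⟨h9, h11, h0, rfl⟩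
    refine RunsIn.seq_emit h.lt (RunsIn.seq_emit h.lt (RunsIn.seq_emit h.lt (RunsIn.emit h.lt ?_)))
    simp [RExpr.val, h0, h9, h11, List.range_succ, angleDigits]
  · intro σ' o' h'
    exact h'

lemma runs_edges (h : Setting inp M B n a N E X Y) {σ : ℕ → ℕ} {o : List ℕ} :
    RunsIn inp M B edges σ o fun _ o' => o' = o ++ (List.range n).flatMap fun i =>
      (List.range n).flatMap fun j => [1, i + n * (1 - E i j * (1 - (1 - (j - i)))), j, 0] := by
  refine RunsIn.forEach h.lt (k := n) (fun σ => h.sites) h.n_le (h.lt_two_pow (by omega))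
    (fun k _ o' => o' = o ++ (List.range k).flatMap fun i =>
      (List.range n).flatMap fun j => [1, i + n * (1 - E i j * (1 - (1 - (j - i)))), j, 0]) ?_ ?_ ?_
  · simp
  · rintro i hi σ' o₁ h0 rfl
    refine RunsIn.forEach h.lt (k := n) (fun σ => h.sites) h.n_le (h.lt_two_pow (by omega))
      (fun k σ' o' => σ' 0 = i ∧ o' = (o ++ (List.range i).flatMap fun i =>
        (List.range n).flatMap fun j => [1, i + n * (1 - E i j * (1 - (1 - (j - i)))), j, 0]) ++
        (List.range k).flatMap fun j => [1, i + n * (1 - E i j * (1 - (1 - (j - i)))), j, 0])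
      ?_ ?_ ?_
    · simp [h0]
    · rintro j hj σ' o₂ h2 ⟨h0', rfl⟩
      refine RunsIn.seq_emit h.lt (RunsIn.seq_emit h.lt (RunsIn.seq_emit h.lt
        (RunsIn.emit h.lt ?_)))
      refine ⟨h2, by simpa using h0', ?_⟩
      simp only [RExpr.val, adj, LearnProg.sites, h.sites, h0', h2, h.edge i hi j hj,
        List.range_succ, List.flatMap_append]
      simp
    · rintro σ' o' ⟨h0', rfl⟩
      exact ⟨h0', by simp [List.range_succ]⟩
  · intro σ' o' h'
    exact h'

lemma runs_hadamards (h : Setting inp M B n a N E X Y) {σ : ℕ → ℕ} {o : List ℕ} :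
    RunsIn inp M B hadamards σ o fun _ o' =>
      o' = o ++ (List.range n).flatMap fun i => [0, i, 0, 0] := by
  refine RunsIn.forEach h.lt (k := n) (fun σ => h.sites) h.n_le (h.lt_two_pow (by omega))
    (fun k _ o' => o' = o ++ (List.range k).flatMap fun i => [0, i, 0, 0]) ?_ ?_ ?_
  · simp
  · rintro i hi σ' o' h0 rfl
    refine RunsIn.seq_emit h.lt (RunsIn.seq_emit h.lt (RunsIn.seq_emit h.lt (RunsIn.emit h.lt ?_)))
    simp [RExpr.val, h0, List.range_succ]
  · intro σ' o' h'
    exact h'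

/-- The learning program outputs the model. -/
lemma runs_main (h : Setting inp M B n a N E X Y) :
    RunsIn inp M B main (fun _ => 0) [] fun _ o =>
      o = modelDesc n E (angleDigits E X Y n a N) fun _ => 2 ^ digits n a := by
  refine RunsIn.seq (runs_rotations h) ?_
  rintro σ _ rfl
  refine RunsIn.seq (runs_edges h) ?_
  rintro σ _ rfl
  intro hσ
  obtain ⟨t, σ', o', h1, h2, h3, h4⟩ := runs_hadamards h hσ
  exact ⟨t, σ', o', h1, h2, h3, by rw [h4, modelDesc]; simp⟩

end LearnProg

/-! ## The inference program -/

namespace InferProg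

/-- The number of sites. -/
def sites : RExpr := .input (.const 0)

/-- The inference program: Hadamard gates on the qubits where the input vanishes, followed by the
gates of the model. -/
def main : RProg :=
  .seq (.forEach 0 sites (.seq (.emit (.const 0))
    (.seq (.emit (.add (.reg 0) (.mul sites (.input (.add (.const 1) (.reg 0))))))
    (.seq (.emit (.const 0)) (.emit (.const 0))))))
  (.forEach 1 (.mul (.const 4) (.mul sites (.add sites (.const 2))))
    (.emit (.input (.add (.add (.const 1) sites) (.reg 1)))))

/-- The length of the model is a function of `n` alone, so it can be copied without any end marker.
-/
lemma runs_main {inp : List ℕ} {M B n : ℕ} {xb : ℕ → ℕ} {model : List ℕ}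
    (hinp : ∀ x ∈ inp, x < 2 ^ B) (hn : inp.getD 0 0 = n)
    (hx : ∀ i < n, inp.getD (1 + i) 0 = xb i)
    (hmodel : ∀ k < 4 * (n * (n + 2)), inp.getD (1 + n + k) 0 = model.getD k 0)
    (hlen : model.length = 4 * (n * (n + 2))) (hM : 4 * (n * (n + 2)) ≤ M)
    (hB : 4 * (n * (n + 2)) ≤ B) :
    RunsIn inp M B main (fun _ => 0) [] fun _ o => o = circuitDesc n xb model := by
  have hnle : n ≤ 4 * (n * (n + 2)) := by nlinarith
  have hlt : ∀ k ≤ 4 * (n * (n + 2)), k < 2 ^ B := fun k hk =>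
    (hk.trans hB).trans_lt Nat.lt_two_pow_self
  refine RunsIn.seq (R := fun _ o => o = (List.range n).flatMap fun i =>
    [0, i + n * xb i, 0, 0]) ?_ ?_
  · refine RunsIn.forEach hinp (k := n) (fun σ => hn) (hnle.trans hM) (hlt n hnle)
      (fun k _ o => o = (List.range k).flatMap fun i => [0, i + n * xb i, 0, 0]) ?_ ?_ ?_
    · simp
    · rintro i hi σ o h0 rfl
      refine RunsIn.seq_emit hinp (RunsIn.seq_emit hinp (RunsIn.seq_emit hinp (RunsIn.emit hinp ?_)))
      simp only [RExpr.val, sites, h0, hn, hx i hi, List.range_succ]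
      simp
    · intro σ o h
      exact h
  · rintro σ _ rfl
    refine RunsIn.forEach hinp (k := 4 * (n * (n + 2))) (fun σ => ?_) hM (hlt _ le_rfl)
      (fun k _ o => o = (List.range n).flatMap (fun i => [0, i + n * xb i, 0, 0]) ++
        model.take k) ?_ ?_ ?_
    · simp only [RExpr.val, sites, hn]
    · simp
    · rintro k hk σ o h1 rfl
      refine RunsIn.emit hinp ⟨h1, ?_⟩
      have hk' : k < model.length := by omega
      simp only [RExpr.val, sites, hn, h1, hmodel k hk]
      rw [List.append_assoc, List.take_add_one, List.getD_eq_getElem?_getD,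
        List.getElem?_eq_getElem hk']
      rfl
    · rintro σ o rfl
      rw [circuitDesc, ← hlen, List.take_length]

end InferProg

/-! ## Positions in the input lists -/

/-- Random access in a concatenation of blocks of constant length `c`; it justifies the address
arithmetic of the programs. -/
lemma getElem?_flatMap_of_length {α β : Type} (L : List α) (f : α → List β) {c : ℕ}
    (hf : ∀ a ∈ L, (f a).length = c) (i : ℕ) {j : ℕ} (hj : j < c) :
    (L.flatMap f)[c * i + j]? = L[i]?.bind fun a => (f a)[j]? := by
  induction L generalizing i with
  | nil => simp
  | cons a L ih =>
    have ha : (f a).length = c := hf a (by simp)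
    rw [List.flatMap_cons]
    cases i with
    | zero =>
      rw [mul_zero, zero_add, List.getElem?_append_left (by omega)]
      simp
    | succ i =>
      rw [List.getElem?_append_right (by rw [ha, mul_add]; omega), ha,
        show c * (i + 1) + j - c = c * i + j by rw [mul_add]; omega,
        ih (fun a h => hf a (List.mem_cons_of_mem _ h))]
      simp

lemma length_flatMap_of_length {α β : Type} (L : List α) (f : α → List β) {c : ℕ}
    (hf : ∀ a ∈ L, (f a).length = c) : (L.flatMap f).length = L.length * c := by
  induction L with
  | nil => simp
  | cons a L ih =>
    rw [List.flatMap_cons, List.length_append, hf a (by simp),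
      ih fun a h => hf a (List.mem_cons_of_mem _ h), List.length_cons, add_mul, one_mul, add_comm]

section Encoding

variable {n N : ℕ} (G : SimpleGraph (Fin n)) (a b : ℕ) (d : Dataset n N)

lemma length_encodeBits (x : Bits n) : (encodeBits x).length = n := by simp [encodeBits]

lemma getD_encodeBits (x : Bits n) (i : Fin n) : (encodeBits x)[(i : ℕ)]? = some (x i).toNat := by
  simp [encodeBits]

lemma length_encodeGraph : (encodeGraph G).length = n * n := by
  rw [encodeGraph, length_flatMap_of_length _ _ (c := n) (by simp)]
  simp

open Classical in
lemma getElem?_encodeGraph (i j : Fin n) :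
    (encodeGraph G)[n * i + j]? = some (if G.Adj i j then 1 else 0) := by
  rw [encodeGraph, getElem?_flatMap_of_length _ _ (c := n) (by simp) _ j.2]
  simp

lemma getElem?_encodeDataset (t : Fin N) {k : ℕ} (hk : k < 2 * n) :
    (encodeDataset d)[2 * n * t + k]? = (encodeBits (d t).1 ++ encodeBits (d t).2)[k]? := by
  rw [encodeDataset, getElem?_flatMap_of_length _ _ (c := 2 * n)
    (fun t _ => by simp [length_encodeBits]; omega) _ hk]
  simp

open Classical in
lemma getD_learnInput_graph (i j : Fin n) :
    (learnInput G a b d).getD (4 + (n * i + j)) 0 = if G.Adj i j then 1 else 0 := by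
  have hlt : n * (i : ℕ) + j < n * n := by
    have h1 := i.2
    have h2 := j.2
    nlinarith
  rw [learnInput, List.getD_eq_getElem?_getD, List.append_assoc,
    List.getElem?_append_right (by simp), List.getElem?_append_left]
  · simp [getElem?_encodeGraph]
  · rw [length_encodeGraph]; simpa using hlt

lemma getD_learnInput_dataset (t : Fin N) {k : ℕ} (hk : k < 2 * n) :
    (learnInput G a b d).getD (4 + n * n + (2 * n * t + k)) 0 =
      ((encodeBits (d t).1 ++ encodeBits (d t).2)[k]?).getD 0 := by
  rw [learnInput, List.getD_eq_getElem?_getD, List.getElem?_append_right]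
  · rw [List.length_append, length_encodeGraph]
    have : 4 + n * n + (2 * n * (t : ℕ) + k) - ([n, a, b, N].length + n * n) = 2 * n * t + k := by
      simp only [List.length_cons, List.length_nil]; omega
    rw [this, getElem?_encodeDataset d t hk]
  · rw [List.length_append, length_encodeGraph]
    simp only [List.length_cons, List.length_nil]; omega

lemma getD_learnInput_x (t : Fin N) (j : Fin n) :
    (learnInput G a b d).getD (4 + n * n + (2 * n * t + j)) 0 = ((d t).1 j).toNat := by
  have hj := j.2
  rw [getD_learnInput_dataset G a b d t (by omega),
    List.getElem?_append_left (by rw [length_encodeBits]; exact hj), getD_encodeBits]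
  rfl

lemma getD_learnInput_y (t : Fin N) (j : Fin n) :
    (learnInput G a b d).getD (4 + n * n + (2 * n * t + (n + j))) 0 = ((d t).2 j).toNat := by
  have hj := j.2
  rw [getD_learnInput_dataset G a b d t (by omega),
    List.getElem?_append_right (by rw [length_encodeBits]; omega), length_encodeBits,
    Nat.add_sub_cancel_left, getD_encodeBits]
  rfl

lemma mem_encodeBits {x : Bits n} {k : ℕ} (hk : k ∈ encodeBits x) : k ≤ 1 := by
  simp only [encodeBits, List.mem_ofFn] at hk
  obtain ⟨i, rfl⟩ := hk
  exact Bool.toNat_le _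

lemma mem_learnInput {k : ℕ} (hk : k ∈ learnInput G a b d) :
    k = n ∨ k = a ∨ k = b ∨ k = N ∨ k ≤ 1 := by
  classical
  simp only [learnInput, List.mem_append, encodeGraph, encodeDataset, List.mem_flatMap,
    List.mem_map, List.mem_cons, List.not_mem_nil, or_false] at hk
  rcases hk with (hk | ⟨i, _, j, _, rfl⟩) | ⟨t, _, hk⟩
  · omega
  · split_ifs <;> omega
  · have := hk.elim mem_encodeBits mem_encodeBits
    omega

/-- The adjacency matrix, as listed in the input. -/
def adjOf (i j : ℕ) : ℕ := (learnInput G a b d).getD (4 + (n * i + j)) 0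

/-- The input bits of the samples, as listed in the input. -/
def xOf (t j : ℕ) : ℕ := (learnInput G a b d).getD (4 + n * n + (2 * n * t + j)) 0

/-- The output bits of the samples, as listed in the input. -/
def yOf (t j : ℕ) : ℕ := (learnInput G a b d).getD (4 + n * n + (2 * n * t + (n + j))) 0

lemma learnProg_setting {M B : ℕ} (h1 : n ≤ M) (h2 : N ≤ M) (h3 : 4 * (n * a) ≤ M)
    (hB : 8 * (n * a) * N + 16 * (n * a) + n + N + 2 ≤ B) (ha : a ≤ B) (hb : b ≤ B) :
    LearnProg.Setting (learnInput G a b d) M B n a N (adjOf G a b d) (xOf G a b d)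
      (yOf G a b d) where
  lt x hx := by
    refine lt_of_le_of_lt ?_ (Nat.lt_two_pow_self (n := B))
    rcases mem_learnInput G a b d hx with h | h | h | h | h <;> omega
  sites := rfl
  acc := rfl
  samples := rfl
  edge _ _ _ _ := rfl
  xbit _ _ _ _ := rfl
  ybit _ _ _ _ := rfl
  ybit_le t ht j hj := by
    rw [yOf, getD_learnInput_y G a b d ⟨t, ht⟩ ⟨j, hj⟩]
    exact Bool.toNat_le _
  n_le := h1
  N_le := h2
  acc_le := h3
  le_B := hB

-- A factor of the product vanishes exactly at a neighbour of `i` whose input bit is 0.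
open Classical in
lemma decoupleVal_eq (i : Fin n) (t : Fin N) :
    LearnProg.decoupleVal (adjOf G a b d) (xOf G a b d) i t n =
      if Decouples G i (d t).1 then 1 else 0 := by
  have hx : ∀ j : Fin n, xOf G a b d t j = ((d t).1 j).toNat := getD_learnInput_x G a b d t
  have he : ∀ j : Fin n, adjOf G a b d i j = if G.Adj i j then 1 else 0 :=
    getD_learnInput_graph G a b d i
  rw [LearnProg.decoupleVal, Finset.prod_range, hx]
  simp only [hx, he]
  by_cases h : Decouples G i (d t).1
  · rw [if_pos h, h.1, Finset.prod_eq_one]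
    · rfl
    · intro j _
      by_cases hj : G.Adj i j
      · simp [hj, h.2 j hj]
      · simp [hj]
  · rw [if_neg h]
    rw [Decouples, not_and_or] at h
    rcases h with h | h
    · rw [Bool.not_eq_false] at h
      simp [h]
    · push Not at h
      obtain ⟨j, hj, hx⟩ := h
      rw [ne_eq, Bool.not_eq_true] at hx
      rw [Finset.prod_eq_zero (Finset.mem_univ j), mul_zero]
      simp [hj, hx]

lemma countVal_eq (i : Fin n) :
    LearnProg.countVal (adjOf G a b d) (xOf G a b d) n i N = decoupledCount G d i := by
  classical
  rw [LearnProg.countVal, Finset.sum_range, decoupledCount, Finset.card_filter]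
  exact Finset.sum_congr rfl fun t _ => decoupleVal_eq G a b d i t

lemma onesVal_eq (i : Fin n) :
    LearnProg.onesVal (adjOf G a b d) (xOf G a b d) (yOf G a b d) n i N = decoupledOnes G d i := by
  classical
  rw [LearnProg.onesVal, Finset.sum_range, decoupledOnes, Finset.sum_filter]
  refine Finset.sum_congr rfl fun t _ => ?_
  rw [decoupleVal_eq, yOf, getD_learnInput_y G a b d t i]
  split_ifs with h1 h2 <;> simp [*]

end Encoding

/-! ## Efficient quantum learning -/

lemma length_modelDesc (n : ℕ) (e : ℕ → ℕ → ℕ) (A v : ℕ → ℕ) :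
    (modelDesc n e A v).length = 4 * (n * (n + 2)) := by
  rw [modelDesc, List.length_append, List.length_append,
    length_flatMap_of_length _ _ (c := 4) (fun _ _ => rfl),
    length_flatMap_of_length _ _ (c := n * 4)
      (fun _ _ => by rw [length_flatMap_of_length _ _ (c := 4) fun _ _ => rfl, List.length_range]),
    length_flatMap_of_length _ _ (c := 4) (fun _ _ => rfl), List.length_range]
  ring

/-- The model is part of the input of the inference program, whose time bound needs a bound on all
input entries. -/
lemma mem_modelDesc {n C : ℕ} {e : ℕ → ℕ → ℕ} {A v : ℕ → ℕ} (h2 : 2 ≤ C) (hn : 2 * n ≤ C)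
    (hA : ∀ i < n, A i ≤ C) (hv : ∀ i < n, v i ≤ C) {k : ℕ} (hk : k ∈ modelDesc n e A v) :
    k ≤ C := by
  simp only [modelDesc, List.mem_append, List.mem_flatMap, List.mem_range, List.mem_cons,
    List.not_mem_nil, or_false] at hk
  rcases hk with ⟨i, hi, hk⟩ | ⟨i, hi, j, hj, hk⟩ | ⟨i, hi, hk⟩
  · have := hA i hi
    have := hv i hi
    omega
  · rcases hk with rfl | rfl | rfl | rfl
    · omega
    · have : n * (1 - e i j * (1 - (1 - (j - i)))) ≤ n * 1 :=
        Nat.mul_le_mul_left n (Nat.sub_le _ _)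
      omega
    · omega
    · omega
  · omega

/-- For `s = n + a + b + N`, the number `4 s ^ 2` bounds the rounds of every loop and `27 s ^ 3` the
register lengths of both programs. -/
lemma RProg.weight_mul_le (p : RProg) : ∃ K, ∀ s, 3 ≤ s →
    p.weight (4 * s ^ 2) * (27 * s ^ 3 + 2) ≤ s ^ K := by
  obtain ⟨K, hK⟩ := p.weight_le
  refine ⟨4 * K + 7, fun s hs => ?_⟩
  have h1 : 4 * s ^ 2 + 2 ≤ s ^ 4 := by
    have : s ^ 4 = s ^ 2 * s ^ 2 := by ring
    have : 9 ≤ s ^ 2 := by nlinarith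
    nlinarith
  have h2 : 27 * s ^ 3 + 2 ≤ s ^ 7 := by
    have h3 : 3 ^ 4 ≤ s ^ 4 := Nat.pow_le_pow_left hs 4
    have h4 : 1 ≤ s ^ 3 := Nat.one_le_pow _ _ (by omega)
    have : s ^ 7 = s ^ 4 * s ^ 3 := by ring
    nlinarith
  calc p.weight (4 * s ^ 2) * (27 * s ^ 3 + 2) ≤ (4 * s ^ 2 + 2) ^ K * s ^ 7 :=
        Nat.mul_le_mul (hK _) h2
    _ ≤ (s ^ 4) ^ K * s ^ 7 := by gcongr
    _ = s ^ (4 * K + 7) := by rw [← pow_mul, ← pow_add]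

/-- The model computed by the learning program. -/
def learnedModel {n N : ℕ} (G : SimpleGraph (Fin n)) (a b : ℕ) (d : Dataset n N) : List ℕ :=
  modelDesc n (adjOf G a b d)
    (LearnProg.angleDigits (adjOf G a b d) (xOf G a b d) (yOf G a b d) n a N)
    fun _ => 2 ^ LearnProg.digits n a

/-- The angle in the model computed by the learning program. -/
def learnedAngle {n N : ℕ} (G : SimpleGraph (Fin n)) (a b : ℕ) (d : Dataset n N) (i : ℕ) : ℝ :=
  Real.pi * LearnProg.angleDigits (adjOf G a b d) (xOf G a b d) (yOf G a b d) n a N i /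
    (2 ^ LearnProg.digits n a : ℕ)

/-- The numbers in a bit string, as a function on all numbers. -/
def bitNat {n : ℕ} (x : Bits n) (i : ℕ) : ℕ := ((encodeBits x)[i]?).getD 0

lemma quantumOutput_learnedModel {n N : ℕ} (G : SimpleGraph (Fin n)) (a b : ℕ) (d : Dataset n N)
    (x : Bits n) : quantumOutput n (circuitDesc n (bitNat x) (learnedModel G a b d)) =
      idqnn G (fun i => learnedAngle G a b d i) x := by
  classical
  refine quantumOutput_circuitDesc G _ (fun i j h => ?_) (fun i j h => ?_) x _ (fun i => ?_) _ _
  · rw [adjOf, getD_learnInput_graph, if_pos h]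
  · rw [adjOf, getD_learnInput_graph, if_neg h]
  · rw [bitNat, getD_encodeBits]; rfl

lemma two_pow_digits_bounds {n a : ℕ} (hn : 1 ≤ n) (ha : 1 ≤ a) :
    4 * (n * a) ≤ 2 ^ LearnProg.digits n a ∧ 2 ^ LearnProg.digits n a ≤ 8 * (n * a) := by
  have hna : 1 ≤ n * a := Nat.mul_pos hn ha
  refine ⟨not_lt.mp fun h => absurd (LearnProg.lt_digits_iff.mpr h) (lt_irrefl _), ?_⟩
  rcases h : LearnProg.digits n a with _ | k
  · rw [pow_zero]; omega
  · have := LearnProg.lt_digits_iff.mp (h ▸ Nat.lt_succ_self k : k < LearnProg.digits n a)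
    rw [pow_succ]; omega

/-- The rounding error is at most `π / 2 ^ digits n a`, where `2 ^ digits n a ≥ 4 n a` and `π ≤ 4`.
-/
lemma abs_angleEstimate_sub_learnedAngle_le {n N a : ℕ} (hn : 1 ≤ n) (ha : 1 ≤ a)
    (G : SimpleGraph (Fin n)) (b : ℕ) (d : Dataset n N) (i : Fin n)
    (hm : 0 < decoupledCount G d i) :
    |angleEstimate G d i - learnedAngle G a b d i| ≤ 1 / ((n * a : ℕ) : ℝ) := by
  have h := ArcState.abs_arccos_sub_le hm (decoupledOnes_le G d i) (LearnProg.digits n a)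
  rw [angleEstimate_eq, learnedAngle, LearnProg.angleDigits, countVal_eq, onesVal_eq]
  refine h.trans ?_
  have hna : (0 : ℝ) < ((n * a : ℕ) : ℝ) := Nat.cast_pos.mpr (Nat.mul_pos hn ha)
  have hv : (4 : ℝ) * ((n * a : ℕ) : ℝ) ≤ ((2 ^ LearnProg.digits n a : ℕ) : ℝ) := by
    exact_mod_cast (two_pow_digits_bounds hn ha).1
  rw [div_le_div_iff₀ (by linarith) hna, one_mul]
  exact (mul_le_mul_of_nonneg_right Real.pi_le_four hna.le).trans hv

lemma learn_computesWithin {K : ℕ} (hK : ∀ s, 3 ≤ s →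
      LearnProg.main.weight (4 * s ^ 2) * (27 * s ^ 3 + 2) ≤ s ^ K)
    {n a b N : ℕ} (hn : 1 ≤ n) (ha : 1 ≤ a) (hb : 1 ≤ b) (G : SimpleGraph (Fin n))
    (d : Dataset n N) :
    LearnProg.main.ComputesWithin (learnInput G a b d) ((n + a + b + N) ^ K)
      (learnedModel G a b d) := by
  set s := n + a + b + N with hs
  have hs3 : 3 ≤ s := by omega
  have hss : s ≤ s ^ 2 := by nlinarith
  have hsss : s ^ 2 ≤ s ^ 3 := Nat.pow_le_pow_right (by omega) (by norm_num)
  have hna : n * a ≤ s ^ 2 := by rw [sq]; exact Nat.mul_le_mul (by omega) (by omega)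
  have hnaN : n * a * N ≤ s ^ 3 := by
    rw [pow_succ]; exact Nat.mul_le_mul hna (by omega)
  refine (LearnProg.runs_main (learnProg_setting G a b d (M := 4 * s ^ 2) (B := 27 * s ^ 3)
    (by omega) (by omega) (by omega) ?_ (by omega) (by omega))).computesWithin (hK s hs3)
  have : 8 * (n * a) * N = 8 * (n * a * N) := by ring
  omega

lemma infer_computesWithin {K : ℕ} (hK : ∀ s, 3 ≤ s →
      InferProg.main.weight (4 * s ^ 2) * (27 * s ^ 3 + 2) ≤ s ^ K)
    {n a b N : ℕ} (hn : 1 ≤ n) (ha : 1 ≤ a) (hb : 1 ≤ b) (G : SimpleGraph (Fin n))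
    (d : Dataset n N) (x : Bits n) :
    InferProg.main.ComputesWithin (inferInput x (learnedModel G a b d)) ((n + a + b + N) ^ K)
      (circuitDesc n (bitNat x) (learnedModel G a b d)) := by
  set s := n + a + b + N with hs
  have hs3 : 3 ≤ s := by omega
  have hss : s ≤ s ^ 2 := by nlinarith
  have hsss : s ^ 2 ≤ s ^ 3 := Nat.pow_le_pow_right (by omega) (by norm_num)
  have hna : n * a ≤ s ^ 2 := by rw [sq]; exact Nat.mul_le_mul (by omega) (by omega)
  have hnn : n * (n + 2) ≤ s ^ 2 := by rw [sq]; exact Nat.mul_le_mul (by omega) (by omega)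
  have hv := (two_pow_digits_bounds hn ha).2
  have hB : ∀ k ≤ 27 * s ^ 3, k < 2 ^ (27 * s ^ 3) := fun k hk => hk.trans_lt Nat.lt_two_pow_self
  refine (InferProg.runs_main (n := n) (M := 4 * s ^ 2) (B := 27 * s ^ 3) ?_ rfl ?_ ?_ ?_ ?_
    ?_).computesWithin (hK s hs3)
  · intro k hk
    refine hB k ?_
    simp only [inferInput, List.mem_append, List.mem_singleton] at hk
    rcases hk with (rfl | hk) | hk
    · omega
    · have := mem_encodeBits hk
      omega
    · refine mem_modelDesc (by omega) (by omega) (fun i hi => ?_) (fun i hi => ?_) hk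
      · have := (ArcState.iter_bounds (decoupledOnes_le G d ⟨i, hi⟩)
          (LearnProg.digits n a)).2.2.1
        rw [← countVal_eq G a b d, ← onesVal_eq G a b d] at this
        change LearnProg.angleDigits _ _ _ n a N i + 2 ≤ _ at this
        omega
      · omega
  · intro i hi
    rw [inferInput, List.getD_eq_getElem?_getD, List.append_assoc,
      List.getElem?_append_right (by simp),
      List.getElem?_append_left (by rw [length_encodeBits]; simpa using hi), bitNat]
    simp
  · intro k hk
    rw [inferInput, List.getD_eq_getElem?_getD, List.getD_eq_getElem?_getD,
      List.getElem?_append_right (by simp [length_encodeBits]; omega)]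
    congr 2
    simp [length_encodeBits]
    omega
  · exact length_modelDesc _ _ _ _
  · omega
  · omega

theorem quantumlyLearnable (Δ : ℕ) : QuantumlyLearnable Δ := by
  obtain ⟨K₁, hK₁⟩ := LearnProg.main.weight_mul_le
  obtain ⟨K₂, hK₂⟩ := InferProg.main.weight_mul_le
  set K := K₁ + K₂ + 2 * (2 * Δ + 14) with hK
  have hmono : ∀ K' ≤ K, ∀ s, 3 ≤ s → s ^ K' ≤ s ^ K := fun K' h s hs =>
    Nat.pow_le_pow_right (by omega) h
  refine ⟨LearnProg.main, InferProg.main, K, fun n a b N hn ha hb G hG => ?_⟩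
  refine ⟨learnedModel G a b, fun d x => circuitDesc n (bitNat x) (learnedModel G a b d),
    fun d => ?_, fun d x => ?_, fun hN θ hθ => ?_⟩
  · exact learn_computesWithin (fun s hs => (hK₁ s hs).trans (hmono _ (by omega) s hs)) hn ha hb G d
  · exact infer_computesWithin (fun s hs => (hK₂ s hs).trans (hmono _ (by omega) s hs)) hn ha hb G
      d x
  · have hna : 1 ≤ n * a := Nat.mul_pos hn ha
    -- The errors of the `n` angles add up, so the estimates are used with accuracy `1 / (n a)`.
    -- Since `n + n a + b ≤ (n + a + b) ^ 2`, this doubles the exponent.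
    have hN' : (n + n * a + b) ^ (2 * Δ + 14) ≤ N := by
      refine le_trans ?_ hN
      calc (n + n * a + b) ^ (2 * Δ + 14) ≤ ((n + a + b) ^ 2) ^ (2 * Δ + 14) := by
            refine Nat.pow_le_pow_left ?_ _
            nlinarith
        _ = (n + a + b) ^ (2 * (2 * Δ + 14)) := by rw [← pow_mul]
        _ ≤ (n + a + b) ^ K := Nat.pow_le_pow_right (by omega) (by omega)
    refine (estimates_accurate_prob hn hna hb hN' hG hθ).trans
      (datasetProb_mono (isDistribution_uniformBits n).1 (idqnn_nonneg G θ) fun d hd x => ?_)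
    rw [quantumOutput_learnedModel]
    refine (tvDist_idqnn_le G _ _ x).trans ?_
    have hn' : (0 : ℝ) < n := Nat.cast_pos.mpr hn
    have ha' : (0 : ℝ) < a := Nat.cast_pos.mpr ha
    -- Each angle is off by at most `1 / (n a)` from sampling and `1 / (n a)` from rounding; the
    -- factor `1 / 2` of the Lipschitz bound compensates for the two contributions.
    calc ∑ i : Fin n, |learnedAngle G a b d i - θ i| / 2
        ≤ ∑ _i : Fin n, 1 / ((n * a : ℕ) : ℝ) := by
          refine Finset.sum_le_sum fun i _ => ?_
          have h1 := (hd i).1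
          have h2 := abs_angleEstimate_sub_learnedAngle_le hn ha G b d i (hd i).2
          rw [abs_sub_comm] at h2
          have h3 := abs_sub_le (learnedAngle G a b d i) (angleEstimate G d i) (θ i)
          linarith
      _ = 1 / a := by
          simp only [Finset.sum_const, Finset.card_univ, Fintype.card_fin, nsmul_eq_mul]
          push_cast
          field_simp

/-! ## Polynomially bounded functions -/

/-- A form that is easily closed under sums and products, as the base is at least 2 even for `n =
0`. In the converse, the values at `n < 2` are absorbed by the additive constant. -/
lemma polyBounded_iff {f : ℕ → ℕ} : PolyBounded f ↔ ∃ k, ∀ n, f n ≤ (n + 2) ^ k := by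
  constructor
  · rintro ⟨k, hk⟩
    refine ⟨k + 1, fun n => (hk n).trans ?_⟩
    have h1 : n ^ k ≤ (n + 2) ^ k := Nat.pow_le_pow_left (by omega) k
    have h2 : k ≤ (n + 2) ^ k :=
      Nat.lt_two_pow_self.le.trans (Nat.pow_le_pow_left (by omega) k)
    rw [pow_succ]
    nlinarith
  · rintro ⟨k, hk⟩
    refine ⟨2 * k + 3 ^ k, fun n => (hk n).trans ?_⟩
    rcases lt_or_ge n 2 with hn | hn
    · have : (n + 2) ^ k ≤ 3 ^ k := Nat.pow_le_pow_left (by omega) k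
      omega
    · have h1 : (n + 2) ^ k ≤ (n ^ 2) ^ k := Nat.pow_le_pow_left (by nlinarith) k
      have h2 : n ^ (2 * k) ≤ n ^ (2 * k + 3 ^ k) := 
        Nat.pow_le_pow_right (by omega) (Nat.le_add_right _ _)
      rw [← pow_mul] at h1
      exact h1.trans (h2.trans (Nat.le_add_right _ _))

lemma PolyBounded.mono {f g : ℕ → ℕ} (hg : PolyBounded g) (h : ∀ n, f n ≤ g n) : PolyBounded f := by
  obtain ⟨k, hk⟩ := hg
  exact ⟨k, fun n => (h n).trans (hk n)⟩

lemma PolyBounded.mul {f g : ℕ → ℕ} (hf : PolyBounded f) (hg : PolyBounded g) :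
    PolyBounded fun n => f n * g n := by
  rw [polyBounded_iff] at *
  obtain ⟨k, hk⟩ := hf
  obtain ⟨l, hl⟩ := hg
  exact ⟨k + l, fun n => by rw [pow_add]; exact Nat.mul_le_mul (hk n) (hl n)⟩

lemma PolyBounded.add {f g : ℕ → ℕ} (hf : PolyBounded f) (hg : PolyBounded g) :
    PolyBounded fun n => f n + g n := by
  rw [polyBounded_iff] at *
  obtain ⟨k, hk⟩ := hf
  obtain ⟨l, hl⟩ := hg
  refine ⟨k + l + 1, fun n => ?_⟩
  have h1 : (n + 2) ^ k ≤ (n + 2) ^ (k + l) := Nat.pow_le_pow_right (by omega) (by omega)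
  have h2 : (n + 2) ^ l ≤ (n + 2) ^ (k + l) := Nat.pow_le_pow_right (by omega) (by omega)
  have := hk n
  have := hl n
  rw [pow_succ]
  nlinarith

lemma polyBounded_const (c : ℕ) : PolyBounded fun _ => c := ⟨c, fun _ => Nat.le_add_left _ _⟩

lemma polyBounded_id : PolyBounded fun n => n := ⟨1, fun n => by simp⟩

/-! ## Total variation distance of images -/

/-- The triangle inequality on each fibre of `T`. -/
lemma tvDist_map_le {α β : Type} [Fintype α] [Fintype β] [DecidableEq β] (T : α → β) (p q : α → ℝ) :
    tvDist (fun b => ∑ a, if T a = b then p a else 0) (fun b => ∑ a, if T a = b then q a else 0) ≤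
      tvDist p q := by
  unfold tvDist
  refine mul_le_mul_of_nonneg_left ?_ (by norm_num)
  calc ∑ b, |(∑ a, if T a = b then p a else 0) - ∑ a, if T a = b then q a else 0|
      ≤ ∑ b, ∑ a, if T a = b then |p a - q a| else 0 := by
        refine Finset.sum_le_sum fun b _ => ?_
        rw [← Finset.sum_sub_distrib]
        refine (Finset.abs_sum_le_sum_abs _ _).trans (le_of_eq ?_)
        refine Finset.sum_congr rfl fun a _ => ?_
        split_ifs <;> simp
    _ = ∑ a, |p a - q a| := by
        rw [Finset.sum_comm]
        simp

/-! ## Fixing inputs and flipping outputs of Boolean circuits -/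

namespace BoolCircuit

variable {I I' O O' : Type}

/-- A wire after some inputs have been replaced by constants, with a function to apply to its value. -/
def fixWire (f : I → I' ⊕ Bool) : I ⊕ ℕ → (I' ⊕ ℕ) × (Bool → Bool)
  | Sum.inl i => match f i with
    | Sum.inl i' => (Sum.inl i', id)
    -- The wire number is a dummy: the function discards its value.
    | Sum.inr c => (Sum.inr 0, fun _ => c)
  | Sum.inr k => (Sum.inr k, id)

/-- The inputs after some of them have been replaced by constants. -/
def fixInput (f : I → I' ⊕ Bool) (a : I' → Bool) (i : I) : Bool := Sum.elim a id (f i)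

lemma wire_fixWire (f : I → I' ⊕ Bool) (a : I' → Bool) (vals : List Bool) (w : I ⊕ ℕ) :
    (fixWire f w).2 (wire a vals (fixWire f w).1) = wire (fixInput f a) vals w := by
  rcases w with i | k
  · rcases h : f i with i' | c <;> simp [fixWire, fixInput, wire, h]
  · rfl

/-- A gate after some inputs have been replaced by constants. -/
def fixGate (f : I → I' ⊕ Bool) (g : BoolGate I) : BoolGate I' where
  op b c := g.op ((fixWire f g.left).2 b) ((fixWire f g.right).2 c)
  left := (fixWire f g.left).1
  right := (fixWire f g.right).1

/-- Compute the values of further gates. -/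
def extendValues (a : I → Bool) (vals : List Bool) (gs : List (BoolGate I)) : List Bool :=
  gs.foldl (fun vals g => vals ++ [g.op (wire a vals g.left) (wire a vals g.right)]) vals

lemma extendValues_fixGate (f : I → I' ⊕ Bool) (a : I' → Bool) (vals : List Bool)
    (gs : List (BoolGate I)) :
    extendValues a vals (gs.map (fixGate f)) = extendValues (fixInput f a) vals gs := by
  induction gs generalizing vals with
  | nil => rfl
  | cons g gs ih =>
    change extendValues a (vals ++ [_]) (gs.map (fixGate f)) = extendValues _ (vals ++ [_]) gs
    rw [ih]
    simp only [fixGate, wire_fixWire]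

lemma length_extendValues (a : I → Bool) (vals : List Bool) (gs : List (BoolGate I)) :
    (extendValues a vals gs).length = vals.length + gs.length := by
  induction gs generalizing vals with
  | nil => rfl
  | cons g gs ih =>
    change (extendValues a (vals ++ [_]) gs).length = _
    rw [ih]
    simp only [List.length_append, List.length_cons, List.length_nil]
    omega

/-- Gates that only read the values `vals` can be evaluated independently. -/
lemma extendValues_of_independent (a : I → Bool) (vals : List Bool) (gs : List (BoolGate I))
    (F : BoolGate I → Bool)
    (hF : ∀ g ∈ gs, ∀ acc, g.op (wire a (vals ++ acc) g.left) (wire a (vals ++ acc) g.right) = F g)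
    (acc : List Bool) : extendValues a (vals ++ acc) gs = vals ++ (acc ++ gs.map F) := by
  induction gs generalizing acc with
  | nil => simp [extendValues]
  | cons g gs ih =>
    change extendValues a ((vals ++ acc) ++ [_]) gs = _
    rw [hF g (by simp), List.append_assoc, ih fun g' h => hF g' (List.mem_cons_of_mem _ h)]
    simp

/-- A gate that copies the wire `w` if it is an input or a gate below `N`, and yields `0` otherwise,
flipped if `flip` holds. -/
def copyGate (f : I → I' ⊕ Bool) (N : ℕ) (flip : Bool) (w : I ⊕ ℕ) : BoolGate I' where
  -- A reference beyond the last gate reads 0 in the original circuit, but could hit one of the new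
  -- gates after the extension; the test `k < N` restores the 0.
  op b _ := xor flip ((fixWire f w).2 b && Sum.elim (fun _ => true) (fun k => decide (k < N)) w)
  left := (fixWire f w).1
  right := (fixWire f w).1

lemma copyGate_op (f : I → I' ⊕ Bool) (a : I' → Bool) (vals acc : List Bool) (flip : Bool)
    (w : I ⊕ ℕ) :
    (copyGate f vals.length flip w).op (wire a (vals ++ acc) (copyGate f vals.length flip w).left)
      (wire a (vals ++ acc) (copyGate f vals.length flip w).right) =
      xor flip (wire (fixInput f a) vals w) := by
  simp only [copyGate, wire_fixWire]
  congr 1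
  rcases w with i | k
  · simp [wire]
  · by_cases hk : k < vals.length
    · simp [wire, hk, List.getElem?_append_left]
    · simp [wire, hk]

/-- Fix some inputs of a circuit, and select and flip outputs. -/
def postprocess [Fintype O'] (c : BoolCircuit I O) (f : I → I' ⊕ Bool) (h : O' → O)
    (flip : O' → Bool) : BoolCircuit I' O' where
  gates := c.gates.map (fixGate f) ++ (List.finRange (Fintype.card O')).map fun j =>
    copyGate f c.size (flip ((Fintype.equivFin O').symm j))
      (c.out (h ((Fintype.equivFin O').symm j)))
  out o := Sum.inr (c.size + Fintype.equivFin O' o)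

lemma size_postprocess [Fintype O'] (c : BoolCircuit I O) (f : I → I' ⊕ Bool) (h : O' → O)
    (flip : O' → Bool) : (c.postprocess f h flip).size = c.size + Fintype.card O' := by
  simp [postprocess, size]

/-- The copying gates depend on the original gates only, never on each other, so their values can be
read off one by one. -/
lemma eval_postprocess [Fintype O'] (c : BoolCircuit I O) (f : I → I' ⊕ Bool) (h : O' → O)
    (flip : O' → Bool) (a : I' → Bool) (o : O') :
    (c.postprocess f h flip).eval a o = xor (flip o) (c.eval (fixInput f a) (h o)) := by
  set vals := c.gateValues (fixInput f a) with hvals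
  have hlen : vals.length = c.size := by
    have := length_extendValues (fixInput f a) [] c.gates
    rw [List.length_nil, zero_add] at this
    exact this
  have hgates : (c.postprocess f h flip).gateValues a = vals ++
      (List.finRange (Fintype.card O')).map fun j =>
        xor (flip ((Fintype.equivFin O').symm j))
          (wire (fixInput f a) vals (c.out (h ((Fintype.equivFin O').symm j)))) := by
    change extendValues a [] (_ ++ _) = _
    rw [extendValues, List.foldl_append]
    change extendValues a (extendValues a [] (c.gates.map (fixGate f))) _ = _
    rw [extendValues_fixGate]
    change extendValues a vals _ = _
    have key := extendValues_of_independent a vals ((List.finRange (Fintype.card O')).map fun j =>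
      copyGate f c.size (flip ((Fintype.equivFin O').symm j))
        (c.out (h ((Fintype.equivFin O').symm j))))
      (fun g => g.op (wire a vals g.left) (wire a vals g.right)) (by
        intro g hg acc
        obtain ⟨j, -, rfl⟩ := List.mem_map.mp hg
        have h1 := copyGate_op f a vals acc (flip ((Fintype.equivFin O').symm j))
          (c.out (h ((Fintype.equivFin O').symm j)))
        have h2 := copyGate_op f a vals [] (flip ((Fintype.equivFin O').symm j))
          (c.out (h ((Fintype.equivFin O').symm j)))
        rw [List.append_nil] at h2
        rw [← hlen]
        exact h1.trans h2.symm) []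
    rw [List.append_nil] at key
    rw [key, List.nil_append, List.map_map]
    congr 1
    refine List.map_congr_left fun j _ => ?_
    have h2 := copyGate_op f a vals [] (flip ((Fintype.equivFin O').symm j))
      (c.out (h ((Fintype.equivFin O').symm j)))
    rw [List.append_nil, hlen] at h2
    exact h2
  change wire a ((c.postprocess f h flip).gateValues a)
    (Sum.inr (c.size + Fintype.equivFin O' o)) = _
  rw [hgates]
  change List.getD _ _ false = _
  rw [List.getD_eq_getElem?_getD, List.getElem?_append_right (by omega), hlen,
    Nat.add_sub_cancel_left]
  simp [eval, hvals]

/-- The circuit with the input `a` hardwired, with selected and flipped outputs. -/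
def hardwire [Fintype O'] {k : ℕ} (c : BoolCircuit (I ⊕ Fin k) O) (a : I → Bool) (h : O' → O)
    (flip : O' → Bool) : BoolCircuit (Empty ⊕ Fin k) O' :=
  c.postprocess (Sum.elim (fun i => Sum.inr (a i)) fun j => Sum.inl (Sum.inr j)) h flip

lemma eval_hardwire [Fintype O'] {k : ℕ} (c : BoolCircuit (I ⊕ Fin k) O) (a : I → Bool)
    (h : O' → O) (flip : O' → Bool) (ρ : Fin k → Bool) (o : O') :
    (c.hardwire a h flip).eval (Sum.elim Empty.elim ρ) o =
      xor (flip o) (c.eval (Sum.elim a ρ) (h o)) := by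
  rw [hardwire, eval_postprocess]
  congr 3
  funext i
  rcases i with i | j <;> rfl

lemma size_hardwire [Fintype O'] {k : ℕ} (c : BoolCircuit (I ⊕ Fin k) O) (a : I → Bool)
    (h : O' → O) (flip : O' → Bool) :
    (c.hardwire a h flip).size = c.size + Fintype.card O' :=
  size_postprocess _ _ _ _

/-- The random strings are sorted by the output `v` of the original circuit, which exhibits the new
law as an image of the old one. -/
lemma law_hardwire [Fintype O] [DecidableEq O] [Fintype O'] {k : ℕ} (c : BoolCircuit (I ⊕ Fin k) O) (a : I → Bool)
    (h : O' → O) (flip : O' → Bool) (w : O' → Bool) :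
    (c.hardwire a h flip).law Empty.elim w =
      ∑ v : O → Bool, if (fun o => xor (flip o) (v (h o))) = w then c.law a v else 0 := by
  classical
  simp only [law]
  have heval : ∀ ρ : Fin k → Bool, (c.hardwire a h flip).eval (Sum.elim Empty.elim ρ) =
      fun o => xor (flip o) (c.eval (Sum.elim a ρ) (h o)) :=
    fun ρ => funext fun o => eval_hardwire c a h flip ρ o
  simp only [heval, Finset.card_filter]
  push_cast
  simp only [Finset.sum_div]
  have : ∀ v : O → Bool, (if (fun o => xor (flip o) (v (h o))) = w then
      ∑ ρ : Fin k → Bool, (if c.eval (Sum.elim a ρ) = v then (1 : ℝ) else 0) / 2 ^ k else 0) =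
      ∑ ρ : Fin k → Bool, if c.eval (Sum.elim a ρ) = v then
        (if (fun o => xor (flip o) (v (h o))) = w then (1 : ℝ) else 0) / 2 ^ k else 0 := by
    intro v
    split_ifs with hv
    · exact Finset.sum_congr rfl fun ρ _ => by split_ifs <;> simp
    · simp
  simp only [this]
  rw [Finset.sum_comm]
  simp

lemma law_hardwire_id [Fintype O] [DecidableEq O] {k : ℕ} (c : BoolCircuit (I ⊕ Fin k) O) (a : I → Bool) :
    (c.hardwire a id fun _ => false).law Empty.elim = c.law a := by
  funext w
  rw [law_hardwire]
  simp

end BoolCircuit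

/-- A sampler for a distribution yields one for its image under selecting and flipping bits. -/
lemma ClassicallySamplable.image {O O' : ℕ → Type} [∀ n, Fintype (O n)] [∀ n, DecidableEq (O n)]
    [∀ n, Fintype (O' n)] [∀ n, DecidableEq (O' n)] {p : ∀ n, (O n → Bool) → ℝ}
    {p' : ∀ n, (O' n → Bool) → ℝ} {η : ℕ → ℝ} (h : ∀ n, O' n → O n) (flip : ∀ n, O' n → Bool)
    (hp : ∀ n w, p' n w =
      ∑ v : O n → Bool, if (fun o => xor (flip n o) (v (h n o))) = w then p n v else 0)
    (hcard : PolyBounded fun n => Fintype.card (O' n)) (hs : ClassicallySamplable O p η) :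
    ClassicallySamplable O' p' η := by
  obtain ⟨k, S, hS, hη⟩ := hs
  refine ⟨k, fun n => (S n).hardwire Empty.elim (h n) (flip n), ?_, fun n hn => ?_⟩
  · refine (hS.add hcard).mono fun n => ?_
    rw [BoolCircuit.size_hardwire]
  · refine le_trans ?_ (hη n hn)
    have h1 : ((S n).hardwire Empty.elim (h n) (flip n)).law Empty.elim = fun w =>
        ∑ v : O n → Bool, if (fun o => xor (flip n o) (v (h n o))) = w then
          (S n).law Empty.elim v else 0 :=
      funext fun w => BoolCircuit.law_hardwire _ _ _ _ w
    have h2 : p' n = fun w =>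
        ∑ v : O n → Bool, if (fun o => xor (flip n o) (v (h n o))) = w then p n v else 0 :=
      funext fun w => hp n w
    rw [h1, h2]
    exact tvDist_map_le (fun (v : O n → Bool) o => xor (flip n o) (v (h n o)))
      ((S n).law Empty.elim) (p n)

/-- A classical learner yields a classical sampler, by hardwiring good data. -/
lemma ClassicallyLearnable.samplable {size : ℕ → ℕ} {G : ∀ n, SimpleGraph (Fin (size n))}
    {η : ℕ → ℝ} {δ : ℝ} (hδ : δ < 1) (hsize : PolyBounded size)
    (hL : ClassicallyLearnable size G η δ) {θ : ∀ n, Fin (size n) → ℝ}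
    (hθ : ∀ n, AnglesInRange (θ n)) (x : ∀ n, Bits (size n)) :
    ClassicallySamplable (fun n => Fin (size n)) (fun n => idqnn (G n) (θ n) (x n)) η := by
  classical
  obtain ⟨q, N, k, L, hq, -, hLsize, hgood⟩ := hL
  -- If no data set were good, the set in the learning guarantee would be empty, of probability `0 <
  -- 1 - δ`.
  have hd : ∀ n, ∃ d : Dataset (size n) (N n), 1 ≤ n →
      tvDist ((L n).law (learnerBits d (x n))) (idqnn (G n) (θ n) (x n)) ≤ η n := by
    intro n
    by_cases hn : 1 ≤ n
    · by_contra hc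
      push Not at hc
      have h1 := hgood n hn (θ n) (hθ n)
      have h2 : {d : Dataset (size n) (N n) |
          ∀ x, tvDist ((L n).law (learnerBits d x)) (idqnn (G n) (θ n) x) ≤ η n} = ∅ := by
        ext d
        simp only [Set.mem_ofPred_eq, Set.mem_empty_iff_false, iff_false]
        exact fun h => absurd (h (x n)) (not_le.mpr (hc d).2)
      rw [h2] at h1
      simp only [datasetProb, Set.indicator_empty, Finset.sum_const_zero] at h1
      linarith
    · exact ⟨fun _ => (zeroBits _, zeroBits _), fun h => absurd h hn⟩
  choose d hd using hd
  refine ⟨k, fun n => (L n).hardwire (learnerBits (d n) (x n)) id fun _ => false, ?_,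
    fun n hn => ?_⟩
  · refine (hLsize.add hsize).mono fun n => ?_
    rw [BoolCircuit.size_hardwire, Fintype.card_fin]
  · rw [BoolCircuit.law_hardwire_id]
    exact hd n hn

/-! ## Sums over paths -/

/-- The state after `k` steps of the transfer matrix `T` with weights `w`. -/
def pathState {X : Type} [Fintype X] (w : ℕ → X → ℂ) (T : X → X → ℂ) : ℕ → X → ℂ
  | 0 => w 0
  | k + 1 => fun x => w (k + 1) x * ∑ x', T x x' * pathState w T k x'

lemma pathState_succ {X : Type} [Fintype X] (w : ℕ → X → ℂ) (T : X → X → ℂ) (k : ℕ) (x : X) :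
    pathState w T (k + 1) x = w (k + 1) x * ∑ x', T x x' * pathState w T k x' := rfl

lemma sum_snoc {X M : Type} [Fintype X] [AddCommMonoid M] {k : ℕ} (f : (Fin (k + 1) → X) → M) :
    ∑ B, f B = ∑ x, ∑ B : Fin k → X, f (Fin.snoc (α := fun _ => X) B x) := by
  rw [← Fintype.sum_prod_type', ← Equiv.sum_comp (Fin.snocEquiv fun _ : Fin (k + 1) => X)]
  rfl

/-- The transfer matrix method. The test function `F` at the endpoint is kept general so that the
induction can absorb the last step into it. -/
lemma sum_path {X : Type} [Fintype X] (w : ℕ → X → ℂ) (T : X → X → ℂ) (k : ℕ) (F : X → ℂ) :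
    ∑ B : Fin (k + 1) → X, (∏ j : Fin (k + 1), w j (B j)) *
      (∏ j : Fin k, T (B j.succ) (B j.castSucc)) * F (B (Fin.last k)) =
      ∑ x, pathState w T k x * F x := by
  induction k generalizing F with
  | zero =>
    rw [sum_snoc]
    refine Finset.sum_congr rfl fun x _ => ?_
    simp [pathState, Fin.snoc]
  | succ k ih =>
    rw [sum_snoc]
    refine Finset.sum_congr rfl fun x _ => ?_
    have h1 := ih fun x' => w (k + 1) x * T x x' * F x
    have h2 : ∀ B : Fin (k + 1) → X,
        (∏ j : Fin (k + 2), w j (Fin.snoc (α := fun _ => X) B x j)) *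
          (∏ j : Fin (k + 1), T (Fin.snoc (α := fun _ => X) B x j.succ)
            (Fin.snoc (α := fun _ => X) B x j.castSucc)) *
          F (Fin.snoc (α := fun _ => X) B x (Fin.last (k + 1))) =
        (∏ j : Fin (k + 1), w j (B j)) * (∏ j : Fin k, T (B j.succ) (B j.castSucc)) *
          (w (k + 1) x * T x (B (Fin.last k)) * F x) := by
      intro B
      rw [Fin.prod_univ_castSucc, Fin.prod_univ_castSucc (n := k)
        (f := fun j => T (Fin.snoc (α := fun _ => X) B x j.succ)
            (Fin.snoc (α := fun _ => X) B x j.castSucc))]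
      simp only [Fin.snoc_castSucc, Fin.snoc_last, Fin.succ_last, Fin.succ_castSucc, Fin.val_castSucc,
        Fin.val_last]
      ring
    simp only [h2, h1, pathState_succ, Finset.mul_sum, Finset.sum_mul]
    exact Finset.sum_congr rfl fun x' _ => by ring

/-! ## Square lattices -/

/-- The `s × m` square lattice, with the edges of the graph `E j` in row `j`. -/
def latticeGraph (s m : ℕ) (E : ℕ → SimpleGraph (Fin m)) : SimpleGraph (Fin (s * m)) where
  Adj u v := (u.divNat = v.divNat ∧ (E u.divNat).Adj u.modNat v.modNat) ∨
    (u.modNat = v.modNat ∧ ((u.divNat : ℕ) + 1 = v.divNat ∨ (v.divNat : ℕ) + 1 = u.divNat))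
  symm := ⟨by
    rintro u v (⟨h1, h2⟩ | ⟨h1, h2⟩)
    · exact Or.inl ⟨h1.symm, h1 ▸ h2.symm⟩
    · exact Or.inr ⟨h1.symm, h2.symm⟩⟩
  loopless := ⟨by
    rintro u (⟨-, h⟩ | ⟨-, h⟩)
    · exact h.ne rfl
    · omega⟩

lemma isSquareLattice_latticeGraph {s m : ℕ} {E : ℕ → SimpleGraph (Fin m)}
    (hE : ∀ j, E j ≤ SimpleGraph.pathGraph m) : IsSquareLattice s m (latticeGraph s m E) := by
  constructor
  · rintro u v (⟨h1, h2⟩ | ⟨h1, h2⟩)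
    · have h3 := SimpleGraph.pathGraph_adj.mp (hE _ h2)
      rw [h1, Nat.dist_self, zero_add]
      simp only [Nat.dist]
      omega
    · rw [h1, Nat.dist_self, add_zero]
      simp only [Nat.dist]
      omega
  · intro u v h1 h2
    have h3 : (u.divNat : ℕ) ≠ v.divNat := fun h => h2 (Fin.ext h)
    simp only [Nat.dist] at h1
    exact Or.inr ⟨Fin.ext (by omega), by omega⟩

/-- Neighbours embed into the four nearest points of `ℤ × ℤ`; integer coordinates avoid special
cases at the boundary. -/
lemma IsSquareLattice.degreeLE {s m : ℕ} {G : SimpleGraph (Fin (s * m))}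
    (h : IsSquareLattice s m G) : DegreeLE G 4 := by
  intro v
  let f : Fin (s * m) → ℤ × ℤ := fun u => ((u.divNat : ℕ), (u.modNat : ℕ))
  let t : Finset (ℤ × ℤ) := {((f v).1 + 1, (f v).2), ((f v).1 - 1, (f v).2),
    ((f v).1, (f v).2 + 1), ((f v).1, (f v).2 - 1)}
  have hf : Function.Injective f := by
    intro u u' huu
    simp only [f, Prod.mk.injEq, Nat.cast_inj] at huu
    refine finProdFinEquiv.symm.injective (Prod.ext (Fin.ext huu.1) (Fin.ext huu.2))
  have ht : t.card ≤ 4 := Finset.card_le_four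
  refine le_trans (Set.ncard_le_ncard_of_injOn (t := (t : Set (ℤ × ℤ))) f ?_ hf.injOn
    t.finite_toSet) (by rwa [Set.ncard_coe_finset])
  intro u hu
  have h1 := h.1 v u hu
  simp only [Nat.dist] at h1
  simp only [t, f, Finset.coe_insert, Finset.coe_singleton, Set.mem_insert_iff,
    Set.mem_singleton_iff, Prod.mk.injEq]
  omega

/-! ## Rows of bits -/

/-- The bit string with rows `B j`. -/
def flatten {s m : ℕ} (B : Fin s → Bits m) : Bits (s * m) := fun u => B u.divNat u.modNat

/-- Bit strings on a lattice as families of rows. -/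
def rowsEquiv (s m : ℕ) : (Fin s → Bits m) ≃ Bits (s * m) where
  toFun := flatten
  invFun b j i := b (finProdFinEquiv (j, i))
  left_inv B := by
    funext j i
    have h := finProdFinEquiv.symm_apply_apply (j, i)
    exact congrArg (fun p : Fin s × Fin m => B p.1 p.2) h
  right_inv b := by
    funext u
    exact congrArg b (finProdFinEquiv.apply_symm_apply u)

lemma divNat_finProdFinEquiv {s m : ℕ} (j : Fin s) (i : Fin m) :
    (finProdFinEquiv (j, i)).divNat = j :=
  congrArg Prod.fst (finProdFinEquiv.symm_apply_apply (j, i))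

lemma modNat_finProdFinEquiv {s m : ℕ} (j : Fin s) (i : Fin m) :
    (finProdFinEquiv (j, i)).modNat = i :=
  congrArg Prod.snd (finProdFinEquiv.symm_apply_apply (j, i))

lemma flatten_apply {s m : ℕ} (B : Fin s → Bits m) (j : Fin s) (i : Fin m) :
    flatten B (finProdFinEquiv (j, i)) = B j i := by
  rw [flatten, divNat_finProdFinEquiv, modNat_finProdFinEquiv]

lemma sum_flatten {s m : ℕ} {M : Type} [AddCommMonoid M] (f : Bits (s * m) → M) :
    ∑ b, f b = ∑ B : Fin s → Bits m, f (flatten B) :=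
  (Equiv.sum_comp (rowsEquiv s m) f).symm

lemma prod_sites {s m : ℕ} {M : Type} [CommMonoid M] (f : Fin (s * m) → M) :
    ∏ u, f u = ∏ j, ∏ i, f (finProdFinEquiv (j, i)) := by
  rw [← Equiv.prod_comp finProdFinEquiv, Fintype.prod_prod_type]

/-- `czSign` counts each edge once, from its smaller endpoint; in the row-major numbering this means
rightwards within a row, or to the next row. -/
lemma lt_and_latticeGraph_adj {s m : ℕ} {E : ℕ → SimpleGraph (Fin m)} (j j' : Fin s) (i i' : Fin m) :
    (finProdFinEquiv (j, i) < finProdFinEquiv (j', i') ∧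
      (latticeGraph s m E).Adj (finProdFinEquiv (j, i)) (finProdFinEquiv (j', i'))) ↔
    (j = j' ∧ i < i' ∧ (E j).Adj i i') ∨ ((j : ℕ) + 1 = j' ∧ i = i') := by
  have hm : 0 < m := i.pos
  have hlt : finProdFinEquiv (j, i) < finProdFinEquiv (j', i') ↔
      (i : ℕ) + m * j < i' + m * j' := Iff.rfl
  simp only [latticeGraph, divNat_finProdFinEquiv, modNat_finProdFinEquiv, hlt]
  constructor
  · rintro ⟨h1, ⟨rfl, h2⟩ | ⟨rfl, h2⟩⟩
    · exact Or.inl ⟨rfl, by rw [Fin.lt_def]; omega, h2⟩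
    · rcases h2 with h2 | h2
      · exact Or.inr ⟨h2, rfl⟩
      · rw [← h2, mul_add] at h1
        omega
  · rintro (⟨rfl, h1, h2⟩ | ⟨h1, rfl⟩)
    · rw [Fin.lt_def] at h1
      exact ⟨by omega, Or.inl ⟨rfl, h2⟩⟩
    · refine ⟨?_, Or.inr ⟨rfl, Or.inl h1⟩⟩
      rw [← h1, mul_add]
      omega

lemma czSign_latticeGraph {k m : ℕ} (E : ℕ → SimpleGraph (Fin m)) (B : Fin (k + 1) → Bits m) :
    czSign (latticeGraph (k + 1) m E) (flatten B) = (∏ j : Fin (k + 1), czSign (E j) (B j)) *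
      ∏ j : Fin k, ∏ i, if B j.castSucc i && B j.succ i then -1 else 1 := by
  classical
  have h1 : czSign (latticeGraph (k + 1) m E) (flatten B) =
      ∏ j : Fin (k + 1), ∏ i, ∏ j' : Fin (k + 1), ∏ i',
        ((if j = j' then (if i < i' ∧ (E j).Adj i i' then
          (if B j i && B j i' then (-1 : ℂ) else 1) else 1) else 1) *
        (if (j : ℕ) + 1 = j' then (if i = i' then
          (if B j i && B j' i then (-1 : ℂ) else 1) else 1) else 1)) := by
    rw [czSign, Finset.prod_filter, Fintype.prod_prod_type, prod_sites]
    refine Finset.prod_congr rfl fun j _ => Finset.prod_congr rfl fun i _ => ?_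
    rw [prod_sites]
    refine Finset.prod_congr rfl fun j' _ => Finset.prod_congr rfl fun i' _ => ?_
    simp only [lt_and_latticeGraph_adj, flatten_apply]
    by_cases hjj : j = j'
    · subst hjj
      simp
    · by_cases hj : (j : ℕ) + 1 = j'
      · by_cases hi : i = i'
        · subst hi
          simp [hjj, hj]
        · simp [hjj, hj, hi]
      · simp [hjj, hj]
  rw [h1]
  simp only [Finset.prod_mul_distrib]
  congr 1
  · refine Finset.prod_congr rfl fun j _ => ?_
    rw [czSign, Finset.prod_filter, Fintype.prod_prod_type]
    refine Finset.prod_congr rfl fun i _ => ?_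
    rw [Finset.prod_eq_single j]
    · simp
    · intro j' _ hj'
      simp [Ne.symm hj']
    · simp
  · rw [Fin.prod_univ_castSucc]
    have hlast : ∏ i : Fin m, ∏ j' : Fin (k + 1), ∏ i' : Fin m,
        (if ((Fin.last k : Fin (k + 1)) : ℕ) + 1 = j' then (if i = i' then
          (if B (Fin.last k) i && B j' i then (-1 : ℂ) else 1) else 1) else 1) = 1 := by
      refine Finset.prod_eq_one fun i _ => Finset.prod_eq_one fun j' _ =>
        Finset.prod_eq_one fun i' _ => if_neg ?_
      have := j'.2
      rw [Fin.val_last]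
      omega
    rw [hlast, mul_one]
    refine Finset.prod_congr rfl fun j _ => Finset.prod_congr rfl fun i _ => ?_
    rw [Finset.prod_eq_single j.succ]
    · simp
    · intro j' _ hj'
      refine Finset.prod_eq_one fun i' _ => if_neg fun h => hj' (Fin.ext ?_)
      rw [← h]
      simp
    · simp

/-! ## Amplitudes of lattice networks -/

/-- The diagonal of `zLayer s`. -/
def zSign {m : ℕ} (s b : Bits m) : ℂ := ∏ i, if s i && b i then -1 else 1

lemma zLayer_mulVec {m : ℕ} (s : Bits m) (v : Bits m → ℂ) (b : Bits m) :
    (zLayer s *ᵥ v) b = zSign s b * v b := by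
  rw [zLayer, Matrix.mulVec_diagonal]; rfl

lemma norm_zSign {m : ℕ} (s b : Bits m) : ‖zSign s b‖ = 1 := by
  rw [zSign, norm_prod]
  refine Finset.prod_eq_one fun e _ => ?_
  split_ifs <;> simp

lemma zSign_mul {m : ℕ} (s t b : Bits m) :
    zSign s b * zSign t b = zSign (fun i => xor (s i) (t i)) b := by
  rw [zSign, zSign, zSign, ← Finset.prod_mul_distrib]
  refine Finset.prod_congr rfl fun i _ => ?_
  cases s i <;> cases t i <;> cases b i <;> simp

/-- The square root of the dimension of the space of `m` qubits. -/
def rootDim (m : ℕ) : ℂ := (Real.sqrt 2 : ℂ) ^ m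

lemma rootDim_ne_zero (m : ℕ) : rootDim m ≠ 0 := by
  refine pow_ne_zero _ fun h => ?_
  have := sqrt_two_mul_self
  rw [h] at this
  norm_num at this

lemma norm_rootDim_sq (m : ℕ) : ‖rootDim m‖ ^ 2 = 2 ^ m := by
  rw [rootDim, norm_pow, ← pow_mul, mul_comm, pow_mul, Complex.norm_real, Real.norm_eq_abs, sq_abs,
    Real.sq_sqrt (by norm_num)]

lemma hLayer_apply {m : ℕ} (b c : Bits m) : hLayer m b c = (rootDim m)⁻¹ * zSign b c := by
  simp only [hLayer, hadamard, zSign, rootDim, Matrix.of_apply, Finset.prod_div_distrib]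
  simp [div_eq_inv_mul]

lemma hLayer_zeroBits {m : ℕ} (b : Bits m) : hLayer m b (zeroBits m) = (rootDim m)⁻¹ := by
  rw [hLayer_apply]
  simp [zSign, zeroBits]

/-- The diagonal of the gates within a row. -/
def rowWeight {m : ℕ} (E : SimpleGraph (Fin m)) (θ : Fin m → ℝ) (b : Bits m) : ℂ :=
  czSign E b * ∏ i, rzPhase (θ i) (b i)

/-- The weights of the rows in the expansion of the amplitude of `y` as a sum over paths. -/
def stepWeight {m : ℕ} (E : ℕ → SimpleGraph (Fin m)) (A : ℕ → Fin m → ℝ) (y : ℕ → Bits m) (j : ℕ)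
    (b : Bits m) : ℂ :=
  hLayer m (y j) b * rowWeight (E j) (A j) b * (rootDim m)⁻¹

/-- All ingredients factorize over rows except the `CZ` gates between neighbouring rows, whose signs
`(-1) ^ (b · c)` are the entries of the Hadamard layer times `rootDim m`. So rows play the role of
time steps. -/
lemma amplitude_latticeGraph {k m : ℕ} (E : ℕ → SimpleGraph (Fin m)) (A : ℕ → Fin m → ℝ)
    (y : ℕ → Bits m) :
    (hLayer _ *ᵥ graphState (latticeGraph (k + 1) m E) (fun u => A u.divNat u.modNat)
      (zeroBits _)) (flatten fun j => y j) =
      ∑ b, pathState (stepWeight E A y) (fun b c => rootDim m * hLayer m b c) k b := by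
  have h := sum_path (stepWeight E A y) (fun b c => rootDim m * hLayer m b c) k fun _ => 1
  simp only [mul_one] at h
  rw [← h, Matrix.mulVec, dotProduct, sum_flatten]
  refine Finset.sum_congr rfl fun B _ => ?_
  rw [graphState_apply, czSign_latticeGraph]
  have h1 : hLayer ((k + 1) * m) (flatten fun j => y j) (flatten B) =
      ∏ j : Fin (k + 1), hLayer m (y j) (B j) := by
    simp only [hLayer, Matrix.of_apply]
    rw [prod_sites]
    simp only [flatten_apply]
  have h2 : ∏ u : Fin ((k + 1) * m), rzPhase (A u.divNat u.modNat) (flatten B u) =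
      ∏ j : Fin (k + 1), ∏ i, rzPhase (A j i) (B j i) := by
    rw [prod_sites]
    simp only [flatten_apply, divNat_finProdFinEquiv, modNat_finProdFinEquiv]
  have h3 : inputState (zeroBits ((k + 1) * m)) (flatten B) =
      ∏ _j : Fin (k + 1), (rootDim m)⁻¹ := by
    simp only [inputState, zeroBits]
    rw [prod_sites]
    simp [rootDim]
  have h4 : ∀ b c : Bits m, (∏ i, if c i && b i then (-1 : ℂ) else 1) =
      rootDim m * hLayer m b c := by
    intro b c
    rw [hLayer_apply, ← mul_assoc, mul_inv_cancel₀ (rootDim_ne_zero m), one_mul, zSign]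
    simp only [Bool.and_comm]
  rw [h1, h2, h3]
  simp only [h4, stepWeight, rowWeight, Finset.prod_mul_distrib]
  ring

/-! ## Layered circuits as lattice networks -/

/-- Subtract `q π` with `q = ⌊θ / π⌋`: the rotation by `-q π` is a scalar times `Z ^ q`, so only the
parity of `q` matters. -/
lemma exists_reduced_angle (θ : ℝ) : ∃ (θ' : ℝ) (k : Bool) (u : ℂ), θ' ∈ Set.Icc 0 Real.pi ∧
    ‖u‖ = 1 ∧ ∀ b, rzPhase θ' b = u * (if k && b then -1 else 1) * rzPhase θ b := by
  have hpi := Real.pi_pos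
  set q : ℤ := ⌊θ / Real.pi⌋ with hq
  have h1 : (q : ℝ) * Real.pi ≤ θ := by
    rw [← le_div_iff₀ hpi]; exact Int.floor_le _
  have h2 : θ ≤ (q + 1) * Real.pi := by
    rw [← div_le_iff₀ hpi]; exact (Int.lt_floor_add_one _).le
  have hadd : ∀ b, rzPhase (θ - q * Real.pi) b = rzPhase (-(q * Real.pi)) b * rzPhase θ b := by
    intro b
    rw [rzPhase, rzPhase, rzPhase, ← Complex.exp_add]
    congr 1
    push_cast
    ring
  have htrue : rzPhase (-(q * Real.pi)) true = rzPhase (-(q * Real.pi)) false * (-1) ^ (-q) := by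
    rw [← Complex.exp_pi_mul_I, ← Complex.exp_int_mul, rzPhase, rzPhase, ← Complex.exp_add]
    congr 1
    push_cast
    simp
    ring
  refine ⟨θ - q * Real.pi, decide (Odd q), rzPhase (-(q * Real.pi)) false,
    ⟨by linarith, by linarith⟩, norm_rzPhase _ _, fun b => ?_⟩
  rw [hadd]
  cases b
  · simp
  · rw [htrue]
    congr 2
    rcases Int.even_or_odd q with hq' | hq'
    · rw [hq'.neg.neg_one_zpow]
      simp [hq']
    · rw [hq'.neg.neg_one_zpow]
      simp [hq']

namespace LayeredCircuit

variable {m : ℕ} (D : LayeredCircuit m)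

/-- The graphs of the rounds, followed by empty graphs. -/
def rowGraph (j : ℕ) : SimpleGraph (Fin m) := if h : j < D.r + 1 then D.cz ⟨j, h⟩ else ⊥

lemma rowGraph_le (j : ℕ) : D.rowGraph j ≤ SimpleGraph.pathGraph m := by
  unfold rowGraph
  split_ifs
  · exact D.cz_le _
  · exact bot_le

/-- Angles of the rounds, followed by zeros. -/
def rowAngle (α : Fin (D.r + 1) → Fin m → ℝ) (j : ℕ) (i : Fin m) : ℝ :=
  if h : j < D.r + 1 then α ⟨j, h⟩ i else 0

lemma round_mulVec (j : Fin (D.r + 1)) (v : Bits m → ℂ) (b : Bits m) :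
    (D.round j *ᵥ v) b = rowWeight (D.cz j) (D.angle j) b * ∑ c, hLayer m b c * v c := by
  rw [round, ← Matrix.mulVec_mulVec, ← Matrix.mulVec_mulVec, czLayer_mulVec, rzLayer_mulVec,
    rowWeight, mul_assoc]
  rfl

/-- If the angles are changed by multiples of `π`, the sum over paths gives the state of the circuit
with additional `Z` gates, up to normalization and signs. -/
lemma pathState_eq {α : Fin (D.r + 1) → Fin m → ℝ} {s : Fin (D.r + 1) → Bits m}
    {u : Fin (D.r + 1) → Fin m → ℂ} (hu : ∀ j i, ‖u j i‖ = 1)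
    (hα : ∀ j i b, rzPhase (α j i) b = u j i * (if s j i && b then -1 else 1) *
      rzPhase (D.angle j i) b) (y : ℕ → Bits m) (k : ℕ) (hk : k ≤ D.r) :
    ∃ c : ℂ, ‖c‖ = 1 ∧ ∀ b, pathState (stepWeight D.rowGraph (D.rowAngle α) y)
        (fun b c => rootDim m * hLayer m b c) k b =
      (rootDim m)⁻¹ ^ (k + 1) * c *
        zSign (fun i => xor (s ⟨k, Nat.lt_succ_of_le hk⟩ i) (y k i)) b *
        (D.upTo (fun j i => xor (s j.castSucc i) (y j i)) k hk *ᵥ Pi.single (zeroBits m) 1) b := by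
  -- Two sources of `Z` gates are combined: the outcome `y j`, through the Hadamards of the
  -- measurement, and the angle reduction `s j`.
  have hrow : ∀ (j : ℕ) (hj : j < D.r + 1) (b : Bits m),
      stepWeight D.rowGraph (D.rowAngle α) y j b =
        (∏ i, u ⟨j, hj⟩ i) * (rootDim m)⁻¹ ^ 2 * zSign (fun i => xor (s ⟨j, hj⟩ i) (y j i)) b *
          rowWeight (D.cz ⟨j, hj⟩) (D.angle ⟨j, hj⟩) b := by
    intro j hj b
    have h1 : ∏ i, rzPhase (D.rowAngle α j i) (b i) = (∏ i, u ⟨j, hj⟩ i) * zSign (s ⟨j, hj⟩) b *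
        ∏ i, rzPhase (D.angle ⟨j, hj⟩ i) (b i) := by
      simp only [rowAngle, dif_pos hj, hα, Finset.prod_mul_distrib, zSign]
    have h2 : D.rowGraph j = D.cz ⟨j, hj⟩ := dif_pos hj
    rw [stepWeight, rowWeight, h1, h2, hLayer_apply, rowWeight, ← zSign_mul]
    ring
  have hnorm : ∀ j, ‖∏ i, u j i‖ = 1 := fun j => by
    rw [norm_prod]
    exact Finset.prod_eq_one fun i _ => hu j i
  induction k with
  | zero =>
    refine ⟨∏ i, u ⟨0, Nat.lt_succ_of_le hk⟩ i, hnorm _, fun b => ?_⟩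
    rw [pathState, hrow 0 (Nat.lt_succ_of_le hk)]
    have h0 : (D.upTo (fun j i => xor (s j.castSucc i) (y j i)) 0 hk *ᵥ
        Pi.single (zeroBits m) 1) b = rowWeight (D.cz 0) (D.angle 0) b * (rootDim m)⁻¹ := by
      rw [upTo, round_mulVec]
      congr 1
      simp [Pi.single_apply, hLayer_zeroBits]
    rw [h0]
    simp only [Fin.zero_eta]
    ring
  | succ k ih =>
    obtain ⟨c, hc, hstate⟩ := ih (Nat.le_of_succ_le hk)
    refine ⟨(∏ i, u ⟨k + 1, Nat.lt_succ_of_le hk⟩ i) * c, by rw [norm_mul, hnorm, hc, one_mul],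
      fun b => ?_⟩
    have hsucc : (D.upTo (fun j i => xor (s j.castSucc i) (y j i)) (k + 1) hk *ᵥ
        Pi.single (zeroBits m) 1) b =
        rowWeight (D.cz ⟨k + 1, Nat.lt_succ_of_le hk⟩) (D.angle ⟨k + 1, Nat.lt_succ_of_le hk⟩) b *
        ∑ b', hLayer m b b' * (zSign (fun i => xor (s ⟨k, by omega⟩ i) (y k i)) b' *
          (D.upTo (fun j i => xor (s j.castSucc i) (y j i)) k (Nat.le_of_succ_le hk) *ᵥ
            Pi.single (zeroBits m) 1) b') := by
      rw [upTo, ← Matrix.mulVec_mulVec, ← Matrix.mulVec_mulVec, round_mulVec]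
      simp only [zLayer_mulVec]
      rfl
    rw [pathState_succ, hrow (k + 1) (Nat.lt_succ_of_le hk), hsucc]
    simp only [hstate, Finset.mul_sum]
    refine Finset.sum_congr rfl fun b' _ => ?_
    -- A row brings two factors `(rootDim m)⁻¹`, from preparation and measurement, and the link to
    -- the previous row cancels one of them.
    have hr := inv_mul_cancel₀ (rootDim_ne_zero m)
    generalize (rootDim m)⁻¹ = ρ at *
    generalize (D.upTo _ k _ *ᵥ Pi.single (zeroBits m) 1) b' = ψ
    linear_combination (∏ i, u ⟨k + 1, Nat.lt_succ_of_le hk⟩ i) *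
      zSign (fun i => xor (s ⟨k + 1, Nat.lt_succ_of_le hk⟩ i) (y (k + 1) i)) b *
      rowWeight (D.cz ⟨k + 1, Nat.lt_succ_of_le hk⟩) (D.angle ⟨k + 1, Nat.lt_succ_of_le hk⟩) b *
      hLayer m b b' * ρ ^ (k + 2) * c * zSign (fun i => xor (s ⟨k, by omega⟩ i) (y k i)) b' * ψ * hr

/-- Select the bits `(y', z)` among the outcomes of the lattice network: `y'` are the rows but the
last two, and `z` is the last row. -/
def selectOut : D.Out → Fin ((D.r + 2) * m) :=
  Sum.elim (fun p => finProdFinEquiv (p.1.castSucc.castSucc, p.2))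
    fun i => finProdFinEquiv (Fin.last _, i)

/-- The bits `y'` that are flipped because of the reduction of the angles. -/
def flipOut (s : Fin (D.r + 1) → Bits m) : D.Out → Bool :=
  Sum.elim (fun p => s p.1.castSucc p.2) fun _ => false

/-- The output distribution of the lattice network is the one of the layered circuit, together with
uniformly random bits. -/
lemma idqnn_latticeGraph {α : Fin (D.r + 1) → Fin m → ℝ} {s : Fin (D.r + 1) → Bits m}
    {u : Fin (D.r + 1) → Fin m → ℂ} (hu : ∀ j i, ‖u j i‖ = 1)
    (hα : ∀ j i b, rzPhase (α j i) b = u j i * (if s j i && b then -1 else 1) *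
      rzPhase (D.angle j i) b) (v : Bits ((D.r + 2) * m)) :
    idqnn (latticeGraph (D.r + 2) m D.rowGraph) (fun u => D.rowAngle α u.divNat u.modNat)
      (zeroBits _) v =
      1 / 2 ^ m * D.law fun o => xor (D.flipOut s o) (v (D.selectOut o)) := by
  obtain ⟨Y, rfl⟩ := (rowsEquiv (D.r + 2) m).surjective v
  change idqnn _ _ _ (flatten Y) = 1 / 2 ^ m * D.law fun o =>
    xor (D.flipOut s o) (flatten Y (D.selectOut o))
  set y : ℕ → Bits m := fun j => if h : j < D.r + 2 then Y ⟨j, h⟩ else zeroBits m with hy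
  have hY : Y = fun j : Fin (D.r + 2) => y j := by
    funext j
    simp [hy]
  obtain ⟨c, hc, hstate⟩ := D.pathState_eq hu hα y D.r le_rfl
  -- The extra row has no edges and zero angles, hence only the weights of preparation and
  -- measurement.
  have hlast : ∀ b, stepWeight D.rowGraph (D.rowAngle α) y (D.r + 1) b =
      hLayer m (y (D.r + 1)) b * (rootDim m)⁻¹ := by
    intro b
    have h1 : rowWeight (D.rowGraph (D.r + 1)) (D.rowAngle α (D.r + 1)) b = 1 := by
      simp [rowWeight, rowGraph, rowAngle, czSign, rzPhase]
    rw [stepWeight, h1, mul_one]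
  have hamp : (hLayer _ *ᵥ graphState (latticeGraph (D.r + 2) m D.rowGraph)
      (fun u => D.rowAngle α u.divNat u.modNat) (zeroBits _)) (flatten fun j => y j) =
      pathState (stepWeight D.rowGraph (D.rowAngle α) y) (fun b c => rootDim m * hLayer m b c) D.r
        (y (D.r + 1)) := by
    rw [amplitude_latticeGraph]
    set ψ := pathState (stepWeight D.rowGraph (D.rowAngle α) y)
      (fun b c => rootDim m * hLayer m b c) D.r with hψ
    have h2 : ∀ b, pathState (stepWeight D.rowGraph (D.rowAngle α) y)
        (fun b c => rootDim m * hLayer m b c) (D.r + 1) b =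
        hLayer m (y (D.r + 1)) b * (hLayer m *ᵥ ψ) b := by
      intro b
      rw [pathState_succ, hlast, ← hψ, Matrix.mulVec, dotProduct]
      simp only [Finset.mul_sum]
      refine Finset.sum_congr rfl fun b' _ => ?_
      have hr := rootDim_ne_zero m
      field_simp
    simp only [h2]
    -- The Hadamards from the link to the extra row cancel those of its measurement, so the outcome
    -- is a standard-basis one.
    change (hLayer m *ᵥ (hLayer m *ᵥ ψ)) (y (D.r + 1)) = _
    rw [Matrix.mulVec_mulVec, hLayer_mul_hLayer, Matrix.one_mulVec]
  have hflip : (fun (j : Fin D.r) i => xor (D.flipOut s (Sum.inl (j, i)))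
      (flatten Y (D.selectOut (Sum.inl (j, i))))) =
      fun (j : Fin D.r) i => xor (s j.castSucc i) (y j i) := by
    funext j i
    simp only [flipOut, selectOut, Sum.elim_inl, flatten_apply, hY]
    rfl
  have hz : (fun i => xor (D.flipOut s (Sum.inr i)) (flatten Y (D.selectOut (Sum.inr i)))) =
      y (D.r + 1) := by
    funext i
    simp only [flipOut, selectOut, Sum.elim_inr, flatten_apply, hY, Bool.false_xor]
    rfl
  -- Only moduli are left. The sign of row `D.r` disappears, and the normalization `2 ^ (-m (D.r +
  -- 1))` splits into the uniform law of `y'` and that of the discarded row.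
  rw [idqnn_eq, law, hflip, hz]
  conv_lhs => rw [hY]
  rw [hamp, hstate, measureZero, unitary, norm_mul, norm_mul, norm_mul, hc, norm_zSign, norm_pow,
    norm_inv, mul_one, mul_one, mul_pow, ← pow_mul, mul_comm (D.r + 1) 2, pow_mul, inv_pow,
    norm_rootDim_sq, ← mul_assoc]
  congr 1
  rw [inv_pow, ← pow_mul, one_div, one_div, ← mul_inv, ← pow_add]
  congr 2
  ring

/-- All rows except the second to last are determined by `w`; that one is free, and its `2 ^ m`
values have equal probabilities. -/
lemma sum_idqnn_latticeGraph {α : Fin (D.r + 1) → Fin m → ℝ} {s : Fin (D.r + 1) → Bits m}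
    {u : Fin (D.r + 1) → Fin m → ℂ} (hu : ∀ j i, ‖u j i‖ = 1)
    (hα : ∀ j i b, rzPhase (α j i) b = u j i * (if s j i && b then -1 else 1) *
      rzPhase (D.angle j i) b) (w : D.Out → Bool) :
    D.law w = ∑ v : Bits ((D.r + 2) * m),
      if (fun o => xor (D.flipOut s o) (v (D.selectOut o))) = w then
        idqnn (latticeGraph (D.r + 2) m D.rowGraph) (fun u => D.rowAngle α u.divNat u.modNat)
          (zeroBits _) v else 0 := by
  have h1 : ∀ v : Bits ((D.r + 2) * m),
      (if (fun o => xor (D.flipOut s o) (v (D.selectOut o))) = w then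
        idqnn (latticeGraph (D.r + 2) m D.rowGraph) (fun u => D.rowAngle α u.divNat u.modNat)
          (zeroBits _) v else 0) =
      if (fun o => xor (D.flipOut s o) (v (D.selectOut o))) = w then 1 / 2 ^ m * D.law w else 0 := by
    intro v
    split_ifs with h
    · rw [D.idqnn_latticeGraph hu hα, h]
    · rfl
  simp only [h1]
  -- Split off the last row, and below the row that is discarded.
  rw [sum_flatten, sum_snoc]
  simp only [sum_snoc (k := D.r)]
  have h2 : ∀ (z x : Bits m) (B : Fin D.r → Bits m),
      (fun o => xor (D.flipOut s o) (flatten (Fin.snoc (α := fun _ => Bits m)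
        (Fin.snoc (α := fun _ => Bits m) B x) z) (D.selectOut o))) = w ↔
      z = (fun i => w (Sum.inr i)) ∧ B = fun j i => xor (s j.castSucc i) (w (Sum.inl (j, i))) := by
    intro z x B
    constructor
    · rintro rfl
      constructor
      · funext i
        simp [flipOut, selectOut, flatten_apply]
      · funext j i
        simp [flipOut, selectOut, flatten_apply]
    · rintro ⟨rfl, rfl⟩
      funext o
      rcases o with ⟨j, i⟩ | i
      · simp [flipOut, selectOut, flatten_apply]
      · simp [flipOut, selectOut, flatten_apply]
  simp only [h2, ite_and]
  simp

end LayeredCircuit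

/-- Hardness of sampling deep layered circuits implies hardness of sampling, and of learning,
networks on square lattices. -/
theorem hardness_of_hardDeepSampling {η : ℕ → ℝ} (h : HardDeepSampling η) :
    ∃ (s : ℕ → ℕ) (G : ∀ n, SimpleGraph (Fin (s n * n))) (θ : ∀ n, Fin (s n * n) → ℝ),
      (∀ n, 1 ≤ s n) ∧ PolyBounded s ∧
      (∀ n, IsSquareLattice (s n) n (G n) ∧ DegreeLE (G n) 4 ∧ AnglesInRange (θ n)) ∧
      ¬ ClassicallySamplable (fun n => Fin (s n * n))
          (fun n => idqnn (G n) (θ n) (zeroBits (s n * n))) η ∧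
      ∀ δ : ℝ, δ < 1 → ¬ ClassicallyLearnable (fun n => s n * n) G η δ := by
  obtain ⟨-, D, -, hD, -, hhard⟩ := h
  choose reduce flip phase hrange hphase hreduce using exists_reduced_angle
  let α : ∀ n, Fin ((D n).r + 1) → Fin n → ℝ := fun n j i => reduce ((D n).angle j i)
  let s : ℕ → ℕ := fun n => (D n).r + 2
  let G : ∀ n, SimpleGraph (Fin (s n * n)) := fun n =>
    latticeGraph ((D n).r + 2) n (D n).rowGraph
  let θ : ∀ n, Fin (s n * n) → ℝ := fun n u => (D n).rowAngle (α n) u.divNat u.modNat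
  -- There is one row per round and one extra row for the final measurement.
  have hs : PolyBounded s := hD.add (polyBounded_const 1)
  have hθ : ∀ n, AnglesInRange (θ n) := by
    intro n u
    simp only [θ, LayeredCircuit.rowAngle]
    split_ifs
    · exact hrange _
    · exact ⟨le_rfl, Real.pi_pos.le⟩
  have hlattice : ∀ n, IsSquareLattice (s n) n (G n) := fun n =>
    isSquareLattice_latticeGraph (D n).rowGraph_le
  have hsample : ¬ ClassicallySamplable (fun n => Fin (s n * n))
      (fun n => idqnn (G n) (θ n) (zeroBits (s n * n))) η := by
    intro hc
    refine hhard (hc.image (fun n => (D n).selectOut)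
      (fun n => (D n).flipOut fun j i => flip ((D n).angle j i)) (fun n w => ?_) ?_)
    · exact (D n).sum_idqnn_latticeGraph (α := α n) (fun j i => hphase ((D n).angle j i))
        (fun j i b => hreduce ((D n).angle j i) b) w
    · refine (hD.mul polyBounded_id).mono fun n => ?_
      simp [LayeredCircuit.rounds, add_mul]
  refine ⟨s, G, θ, fun n => by simp only [s]; omega, hs,
    fun n => ⟨hlattice n, (hlattice n).degreeLE, hθ n⟩, hsample, fun δ hδ hL => ?_⟩
  exact hsample (hL.samplable hδ (hs.mul polyBounded_id) hθ fun n => zeroBits (s n * n))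

end

theorem mainTheorem1 :
    -- law of the output bit at a decoupled site
    (∀ (n : ℕ) (G : SimpleGraph (Fin n)) (θ : Fin n → ℝ) (i : Fin n) (x : Bits n),
      Decouples G i x →
      ∑ y : Bits n, (if y i then idqnn G θ x y else 0) = (1 - Real.cos (θ i)) / 2) ∧
    -- the estimator learns all angles from polynomially many samples
    (∀ Δ : ℕ, ∃ K : ℕ, ∀ n a b N : ℕ, 1 ≤ n → 1 ≤ a → 1 ≤ b → (n + a + b) ^ K ≤ N →
      ∀ G : SimpleGraph (Fin n), DegreeLE G Δ → ∀ θ : Fin n → ℝ, AnglesInRange θ →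
      1 - 1 / (b : ℝ) ≤ datasetProb (uniformBits n) (idqnn G θ)
        {d : Dataset n N | ∀ i, |angleEstimate G d i - θ i| ≤ 1 / (a : ℝ)}) ∧
    -- quantum easiness
    (∀ Δ : ℕ, QuantumlyLearnable Δ) ∧
    -- classical hardness under the conjecture, on square lattices of polynomial size
    (∀ η : ℕ → ℝ, HardDeepSampling η →
      ∃ (s : ℕ → ℕ) (G : ∀ n, SimpleGraph (Fin (s n * n))) (θ : ∀ n, Fin (s n * n) → ℝ),
        (∀ n, 1 ≤ s n) ∧ PolyBounded s ∧
        (∀ n, IsSquareLattice (s n) n (G n) ∧ DegreeLE (G n) 4 ∧ AnglesInRange (θ n)) ∧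
        ¬ ClassicallySamplable (fun n => Fin (s n * n))
            (fun n => idqnn (G n) (θ n) (zeroBits (s n * n))) η ∧
        ∀ δ : ℝ, δ < 1 → ¬ ClassicallyLearnable (fun n => s n * n) G η δ) := by
  exact ⟨fun _ G θ i x hx => idqnn_decoupled G θ i x hx,
    fun Δ => ⟨2 * Δ + 14, fun _ _ _ _ hn ha hb hN _ hG _ hθ =>
      angleEstimate_prob hn ha hb hN hG hθ⟩,
    quantumlyLearnable, fun _ h => hardness_of_hardDeepSampling h⟩
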